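/- **Setting.** Let $l\ge 1$, let $\alpha_k,\gamma_k>0$ and $\beta_k\ge 0$ for $k=1,\dots,l$, and consider on $\mathbb{R}^4$ the system $$i\alpha_k\partial_t u_k+\gamma_k\Delta u_k-\beta_k u_k=-f_k(u_1,\dots,u_l),\qquad k=1,\dots,l, \tag{S$_\beta$}$$ where $f_k:\mathbb{C}^l\to\mathbb{C}$ are (real-)differentiable and satisfy the following, for a (real-)differentiable $F:\mathbb{C}^l\to\mathbb{C}$: - (H1) $f_k(0)=0$; - (H2) there is $C>0$ with $|\partial_{z_m}f_k(z)-\partial_{z_m}f_k(z')|\le C\sum_j|z_j-z_j'|$ and $|\partial_{\bar z_m}f_k(z)-\partial_{\bar z_m}f_k(z')|\le C\sum_j|z_j-z_j'|$ for all $k,m,z,z'$; - (H3) $f_k=\partial_{\bar z_k}F+\overline{\partial_{z_k}F}$; - (H4) $\mathrm{Re}\,F(e^{i\frac{\alpha_1}{\gamma_1}\theta}z_1,\dots,e^{i\frac{\alpha_l}{\gamma_l}\theta}z_l)=\mathrm{Re}\,F(z)$ for all $\theta\in\mathbb{R}$; - (H5) $F(\lambda z)=\lambda^3F(z)$ for all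 $\lambda>0$; - (H6) $|\mathrm{Re}\int F(u_1,\dots,u_l)\,dx|\le\int F(|u_1|,\dots,|u_l|)\,dx$ for $u_1,\dots,u_l\in H^1(\mathbb{R}^4)$; - (H7) $F$ is real-valued on $\mathbb{R}^l$, and $f_k(y)\ge 0$ for $y\in[0,\infty)^l$; - (H8) on $[0,\infty)^l$, $F$ is a finite sum of functions, each of which depends on a nonempty subset of the variables, is super-modular in these variables, and vanishes whenever one of them is $0$. Put $Q(u)=\sum_k\frac{\alpha_k^2}{\gamma_k}\|u_k\|_{L^2}^2$ and $K(u)=\sum_k\gamma_k\|\nabla u_k\|_{L^2}^2$. Let $\mathcal{G}(1,0)$ be the set of ground states, that is, of those nonzero real-valued weak solutions $\psi=(\psi_1,\dots,\psi_l)$ in $H^1(\mathbb{R}^4)^l$ of $$-\gamma_k\Delta\psi_k+\tfrac{\alpha_k^2}{\gamma_k}\psi_k=f_k(\psi),\qquad k=1,\dots,l,$$ that minimize the action $I(\psi)=\frac12\big(K(\psi)+Q(\psi)\big)-\int F(\psi)\,dx$ among all nonzero solutions. For an interval $J\ni 0$, a solution of (S$_\beta$) on $J$ is a function $u\in C(J;H^1(\mathbb{R}^4)^l)\cap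 L^2_{\mathrm{loc}}(J;W^{1,4}(\mathbb{R}^4)^l)$ with $$u_k(t)=U_k(t)u_k(0)+\frac{i}{\alpha_k}\int_0^tU_k(t-s)f_k(u(s))\,ds,\qquad U_k(t)=e^{i\frac{t}{\alpha_k}(\gamma_k\Delta-\beta_k)},\quad t\in J.$$ **Theorem.** Let $\psi\in\mathcal{G}(1,0)$ and $T>0$. Let $v^A$ be the pseudo-conformal transform $$v^A_k(x,t)=(a+bt)^{-2}e^{i\frac{\alpha_k}{\gamma_k}\frac{b|x|^2}{4(a+bt)}}\,\tilde u_k\Big(\frac{x}{a+bt},\frac{c+dt}{a+bt}\Big),\qquad A=\begin{pmatrix}a&b\\c&d\end{pmatrix}=\begin{pmatrix}T&-1\\0&1/T\end{pmatrix},$$ of the standing wave $\tilde u_k(x,t)=e^{i\frac{\alpha_k}{\gamma_k}t}\psi_k(x)$; explicitly, for $t<T$, $$v^A_k(x,t)=(T-t)^{-2}e^{-i\frac{\alpha_k}{\gamma_k}\frac{|x|^2}{4(T-t)}+i\frac{\alpha_k}{\gamma_k}\frac{t}{T(T-t)}}\psi_k\Big(\frac{x}{T-t}\Big).$$ Then: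 1. $v^A$ is a solution of (S$_\beta$) with $\beta=0$ on $(-\infty,T)$; 2. $v^A_k(x,0)=T^{-2}e^{-i\frac{\alpha_k}{\gamma_k}\frac{|x|^2}{4T}}\psi_k(x/T)$; 3. $Q(v^A(t))=Q(\psi)$ for all $t<T$, in particular for $t=0$; 4. $K(v^A(t))$ is of exact order $(T-t)^{-2}$ as $t\to T^-$, that is, $c\,(T-t)^{-2}\le K(v^A(t))\le C\,(T-t)^{-2}$ for some $c,C>0$ and all $t<T$ close to $T$; 5. $u^A_k(x,t)=e^{-i\frac{\alpha_k}{\gamma_k}t}v^A_k(x,t)$ is a solution of (S$_\beta$) with $\beta_k=\alpha_k^2/\gamma_k$ on $(-\infty,T)$, it satisfies $Q(u^A(0))=Q(\psi)$, and it blows up at time $T$: $\|u^A(t)\|_{H^1}\to\infty$ as $t\to T^-$, and no solution with the initial data $u^A(0)$ exists on $[0,S)$ if $S>T$. Hence the condition $Q(u_0)<Q(\psi)$ for global existence is sharp when $\beta_k=\alpha_k^2/\gamma_k$: there is $u_0\in H^1(\mathbb{R}^4)^l$ with $Q(u_0)=Q(\psi)$ for which (S$_\beta$) has no solution on $[0,\infty)$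 with $u(0)=u_0$. -/

import Mathlib

open MeasureTheory Filter Topology Set Asymptotics
open scoped ENNReal

noncomputable section

namespace QuadNLS

/-- The space `ℝ⁴`. -/
abbrev R4 : Type := EuclideanSpace ℝ (Fin 4)

/-! ### Sobolev functions on `ℝ⁴` -/

section Sobolev

variable {V : Type*} [NormedAddCommGroup V] [NormedSpace ℝ V]

/-- `G` is the weak `j`-th partial derivative of `u`, tested against `C_c^∞(ℝ⁴)`. It is only used
for locally integrable `u` and `G`. -/
def HasWeakPartial (j : Fin 4) (u G : R4 → V) : Prop :=
  ∀ φ : R4 → ℝ, ContDiff ℝ (⊤ : ℕ∞) φ → HasCompactSupport φ →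
    ∫ x, (fderiv ℝ φ x (EuclideanSpace.single j (1 : ℝ))) • u x = -∫ x, φ x • G x

/-- The Sobolev space `H¹(ℝ⁴; V)`. -/
def MemH1 (u : R4 → V) : Prop :=
  MemLp u 2 volume ∧ ∀ j : Fin 4, ∃ G : R4 → V, MemLp G 2 volume ∧ HasWeakPartial j u G

open Classical in
/-- The weak partial derivative `∂_j u` (a representative of it), for `u` in `H¹`. -/
def weakPartial (j : Fin 4) (u : R4 → V) : R4 → V :=
  if h : ∃ G : R4 → V, MemLp G 2 volume ∧ HasWeakPartial j u G then h.choose else 0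

end Sobolev

/-- The `L²`-class of a square integrable function. -/
def toL2 (u : R4 → ℂ) : Lp ℂ 2 (volume : Measure R4) :=
  open Classical in if h : MemLp u 2 volume then h.toLp u else 0

/-! ### The functionals -/

section Functionals

variable {l : ℕ} {V : Type*} [NormedAddCommGroup V] [NormedSpace ℝ V]

/-- The charge `Q(u) = ∑ₖ (αₖ² / γₖ) ‖uₖ‖²_{L²}`. -/
def charge (α γ : Fin l → ℝ) (u : Fin l → R4 → V) : ℝ :=
  ∑ k, (α k ^ 2 / γ k) * ∫ x, ‖u k x‖ ^ 2

/-- `K(u) = ∑ₖ γₖ ‖∇uₖ‖²_{L²}`. -/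
def kinetic (γ : Fin l → ℝ) (u : Fin l → R4 → V) : ℝ :=
  ∑ k, γ k * ∑ j, ∫ x, ‖weakPartial j (u k) x‖ ^ 2

/-- The norm of `H¹ × ⋯ × H¹` (the sum of the `H¹`-norms of the components). -/
def h1Norm (u : Fin l → R4 → V) : ℝ :=
  ∑ k, Real.sqrt ((∫ x, ‖u k x‖ ^ 2) + ∑ j, ∫ x, ‖weakPartial j (u k) x‖ ^ 2)

end Functionals

/-! ### The nonlinearities -/

section Nonlinearity

variable {l : ℕ}

/-- `∂g/∂z_m = (∂g/∂x_m - i ∂g/∂y_m) / 2`. -/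
def dz (m : Fin l) (g : (Fin l → ℂ) → ℂ) (z : Fin l → ℂ) : ℂ :=
  (1 / 2) * (fderiv ℝ g z (Pi.single m 1) - Complex.I * fderiv ℝ g z (Pi.single m Complex.I))

/-- `∂g/∂z̄_m = (∂g/∂x_m + i ∂g/∂y_m) / 2`. -/
def dzbar (m : Fin l) (g : (Fin l → ℂ) → ℂ) (z : Fin l → ℂ) : ℂ :=
  (1 / 2) * (fderiv ℝ g z (Pi.single m 1) + Complex.I * fderiv ℝ g z (Pi.single m Complex.I))

/-- `G`, a function on the cone `y ≥ 0` of the variables `y_i`, `i ∈ S`, is super-modular. -/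
def IsSupermodularOn (S : Finset (Fin l)) (G : (Fin l → ℝ) → ℝ) : Prop :=
  ∀ y : Fin l → ℝ, (∀ i, 0 ≤ y i) → ∀ i ∈ S, ∀ j ∈ S, i ≠ j → ∀ h k : ℝ, 0 < h → 0 < k →
    G (y + Pi.single i h) + G (y + Pi.single j k) ≤
      G (y + Pi.single i h + Pi.single j k) + G y

/-- The standing assumptions on the nonlinearities `f₁, …, f_l` and their potential `F`. -/
structure IsAdmissible (α γ : Fin l → ℝ) (f : Fin l → (Fin l → ℂ) → ℂ) (F : (Fin l → ℂ) → ℂ) :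
    Prop where
  map_zero : ∀ k, f k 0 = 0
  differentiable : ∀ k, Differentiable ℝ (f k)
  /-- The first derivatives of `f k` are Lipschitz continuous. -/
  lipschitz_deriv : ∃ C : ℝ, 0 < C ∧ ∀ (k m : Fin l) (z z' : Fin l → ℂ),
    ‖dz m (f k) z - dz m (f k) z'‖ ≤ C * ∑ j, ‖z j - z' j‖ ∧
    ‖dzbar m (f k) z - dzbar m (f k) z'‖ ≤ C * ∑ j, ‖z j - z' j‖
  differentiable_potential : Differentiable ℝ F
  eq_deriv : ∀ k z, f k z = dzbar k F z + (starRingEnd ℂ) (dz k F z)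
  gauge : ∀ (θ : ℝ) (z : Fin l → ℂ),
    (F fun k => Complex.exp (Complex.I * ((α k / γ k * θ : ℝ) : ℂ)) * z k).re = (F z).re
  homogeneous : ∀ (r : ℝ), 0 < r → ∀ z : Fin l → ℂ,
    F (fun k => (r : ℂ) * z k) = (r : ℂ) ^ 3 * F z
  abs_integral_le : ∀ u : Fin l → R4 → ℂ, (∀ k, MemH1 (u k)) →
    |(∫ x, F fun k => u k x).re| ≤ (∫ x, F fun k => ((‖u k x‖ : ℝ) : ℂ)).re
  real_on_real : ∀ y : Fin l → ℝ, (F fun k => (y k : ℂ)).im = 0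
  nonneg_on_cone : ∀ y : Fin l → ℝ, (∀ i, 0 ≤ y i) → ∀ k,
    (f k fun i => (y i : ℂ)).im = 0 ∧ 0 ≤ (f k fun i => (y i : ℂ)).re
  /-- On the cone `y ≥ 0`, `F` is a finite sum of functions `G s`, each of which depends on
  a nonempty set `S s` of the variables, is super-modular in them, and vanishes as soon as one of
  them vanishes. -/
  supermodular : ∃ (m : ℕ) (G : Fin m → (Fin l → ℝ) → ℝ) (S : Fin m → Finset (Fin l)),
    (∀ y : Fin l → ℝ, (∀ i, 0 ≤ y i) → F (fun k => (y k : ℂ)) = ((∑ s, G s y : ℝ) : ℂ)) ∧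
    ∀ s, (S s).Nonempty ∧
      (∀ y y' : Fin l → ℝ, (∀ i ∈ S s, y i = y' i) → G s y = G s y') ∧
      IsSupermodularOn (S s) (G s) ∧
      ∀ y : Fin l → ℝ, (∀ i, 0 ≤ y i) → (∃ j ∈ S s, y j = 0) → G s y = 0

end Nonlinearity

/-! ### Ground states -/

section GroundStates

variable {l : ℕ}

/-- The action `I(ψ) = ½ (∑ₖ γₖ ‖∇ψₖ‖² + ∑ₖ bₖ ‖ψₖ‖²) - ∫ F(ψ)`. -/
def action (γ b : Fin l → ℝ) (F : (Fin l → ℂ) → ℂ) (ψ : Fin l → R4 → ℝ) : ℝ :=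
  (1 / 2) * (kinetic γ ψ + ∑ k, b k * ∫ x, ‖ψ k x‖ ^ 2) - ∫ x, (F fun k => (ψ k x : ℂ)).re

/-- The weak solutions `ψ ∈ H¹(ℝ⁴; ℝˡ)`, `ψ ≠ 0`, of `-γₖ Δψₖ + bₖ ψₖ = fₖ(ψ)`, `k = 1, …, l`,
tested against `H¹`. -/
def nontrivialSolutions (γ b : Fin l → ℝ) (f : Fin l → (Fin l → ℂ) → ℂ) :
    Set (Fin l → R4 → ℝ) :=
  {ψ | (∀ k, MemH1 (ψ k)) ∧ (¬ ∀ k, ψ k =ᵐ[volume] 0) ∧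
    ∀ g : R4 → ℝ, MemH1 g → ∀ k,
      ((γ k * (∫ x, ∑ j, weakPartial j (ψ k) x * weakPartial j g x) +
          b k * ∫ x, ψ k x * g x : ℝ) : ℂ) =
        ∫ x, f k (fun m => (ψ m x : ℂ)) * (g x : ℂ)}

/-- The set `𝒢(ω, β)` of ground states: the nontrivial solutions of least action, with
`bₖ = (αₖ² / γₖ) ω + βₖ`. -/
def groundStates (α γ : Fin l → ℝ) (f : Fin l → (Fin l → ℂ) → ℂ) (F : (Fin l → ℂ) → ℂ)
    (ω : ℝ) (β : Fin l → ℝ) : Set (Fin l → R4 → ℝ) :=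
  let b : Fin l → ℝ := fun k => α k ^ 2 / γ k * ω + β k
  {ψ | ψ ∈ nontrivialSolutions γ b f ∧
    ∀ φ ∈ nontrivialSolutions γ b f, action γ b F ψ ≤ action γ b F φ}

end GroundStates

/-! ### The evolution system -/

section Evolution

/-- The symbol `exp(-i (t/a) (c |2πξ|² + b))` of `exp(i (t/a) (c Δ - b))`. -/
def schrodingerSymbol (a c b t : ℝ) (ξ : R4) : ℂ :=
  Complex.exp (((-(t / a) * (c * (2 * Real.pi * ‖ξ‖) ^ 2 + b) : ℝ) : ℂ) * Complex.I)

lemma memLp_schrodingerSymbol (a c b t : ℝ) :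
    MemLp (schrodingerSymbol a c b t) ∞ (volume : Measure R4) := by
  refine memLp_top_of_bound (C := 1) ?_ (Eventually.of_forall fun ξ => ?_)
  · have : Continuous (schrodingerSymbol a c b t) := by
      unfold schrodingerSymbol
      fun_prop
    exact this.aestronglyMeasurable
  · simp only [schrodingerSymbol]
    rw [Complex.norm_exp_ofReal_mul_I]

open FourierTransform in
/-- The Schrödinger group `exp(i (t/a) (c Δ - b))` on `L²(ℝ⁴)`. -/
def propagator (a c b t : ℝ) (g : Lp ℂ 2 (volume : Measure R4)) :
    Lp ℂ 2 (volume : Measure R4) :=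
  𝓕⁻ (((memLp_schrodingerSymbol a c b t).toLp _ • 𝓕 g : Lp ℂ 2 (volume : Measure R4)))

variable {l : ℕ}

/-- `u` is an `H¹`-solution, on the time interval `J` (which contains `0`), of
`i αₖ ∂ₜuₖ + γₖ Δuₖ - βₖ uₖ = -fₖ(u₁, …, u_l)`, `k = 1, …, l`: it belongs to
`C(J; H¹) ∩ L²_loc(J; W^{1,4})` and satisfies Duhamel's formula
`uₖ(t) = Uₖ(t) uₖ(0) + (i/αₖ) ∫₀ᵗ Uₖ(t-s) fₖ(u(s)) ds` with
`Uₖ(t) = exp(i (t/αₖ) (γₖ Δ - βₖ))`.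
(For `u ∈ C(J; H¹)` and quadratic `fₖ`, the functions `fₖ(u(s))` belong to `C(J; L²)`, so that the
fields `source_memLp` and `source_integrable` only record that the formula makes sense.) -/
structure IsH1Solution (α γ β : Fin l → ℝ) (f : Fin l → (Fin l → ℂ) → ℂ) (J : Set ℝ)
    (u : Fin l → ℝ → R4 → ℂ) : Prop where
  memH1 : ∀ k, ∀ t ∈ J, MemH1 (u k t)
  continuousOn : ∀ k, ContinuousOn (fun t => toL2 (u k t)) J
  continuousOn_grad : ∀ k j, ContinuousOn (fun t => toL2 (weakPartial j (u k t))) J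
  memW14 : ∀ k, ∀ a b : ℝ, Icc a b ⊆ J →
    ∫⁻ t in Icc a b, ((eLpNorm (u k t) 4 volume) ^ 2 +
      ∑ j, (eLpNorm (weakPartial j (u k t)) 4 volume) ^ 2) < ∞
  source_memLp : ∀ k, ∀ t ∈ J, MemLp (fun x => f k fun m => u m t x) 2 volume
  source_integrable : ∀ k, ∀ t ∈ J, IntervalIntegrable
    (fun s => propagator (α k) (γ k) (β k) (t - s) (toL2 fun x => f k fun m => u m s x))
    volume 0 t
  duhamel : ∀ k, ∀ t ∈ J,
    toL2 (u k t) = propagator (α k) (γ k) (β k) t (toL2 (u k 0)) +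
      (Complex.I / (α k : ℂ)) •
        ∫ s in (0 : ℝ)..t,
          propagator (α k) (γ k) (β k) (t - s) (toL2 fun x => f k fun m => u m s x)

/-- The standing wave `e^{i (αₖ/γₖ) ω t} ψₖ(x)`. -/
def standingWave (α γ : Fin l → ℝ) (ω : ℝ) (ψ : Fin l → R4 → ℝ) : Fin l → ℝ → R4 → ℂ :=
  fun k t x => Complex.exp (Complex.I * ((α k / γ k * ω * t : ℝ) : ℂ)) * (ψ k x : ℂ)

/-- The pseudo-conformal transform of `u` by `A = (a b; c d) ∈ SL(2, ℝ)`: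
`(a+bt)⁻² e^{i (αₖ/γₖ) b|x|²/(4(a+bt))} uₖ(x/(a+bt), (c+dt)/(a+bt))`. -/
def pseudoConformal (α γ : Fin l → ℝ) (A : Matrix.SpecialLinearGroup (Fin 2) ℝ)
    (u : Fin l → ℝ → R4 → ℂ) : Fin l → ℝ → R4 → ℂ :=
  fun k t x =>
    let q : ℝ := A.1 0 0 + A.1 0 1 * t
    (((q ^ 2)⁻¹ : ℝ) : ℂ) *
      Complex.exp (Complex.I * ((α k / γ k * (A.1 0 1 * ‖x‖ ^ 2 / (4 * q)) : ℝ) : ℂ)) *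
      u k ((A.1 1 0 + A.1 1 1 * t) / q) (q⁻¹ • x)

/-- The matrix `(T -1; 0 1/T)`. -/
def blowUpMatrix (T : ℝ) (hT : 0 < T) : Matrix.SpecialLinearGroup (Fin 2) ℝ :=
  ⟨!![T, -1; 0, 1 / T], by
    rw [Matrix.det_fin_two_of]
    field_simp
    ring⟩

/-- The transform `v^A` of the standing wave of frequency `1`, with `A = (T -1; 0 1/T)`. -/
def vA (α γ : Fin l → ℝ) (ψ : Fin l → R4 → ℝ) (T : ℝ) (hT : 0 < T) : Fin l → ℝ → R4 → ℂ :=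
  pseudoConformal α γ (blowUpMatrix T hT) (standingWave α γ 1 ψ)

/-- `u^A_k(x, t) = e^{-i (αₖ/γₖ) t} v^A_k(x, t)`. -/
def uA (α γ : Fin l → ℝ) (ψ : Fin l → R4 → ℝ) (T : ℝ) (hT : 0 < T) : Fin l → ℝ → R4 → ℂ :=
  fun k t x => Complex.exp (-Complex.I * ((α k / γ k * t : ℝ) : ℂ)) * vA α γ ψ T hT k t x

end Evolution

end QuadNLS

end

/-! Put κ_k = α_k/γ_k and let θ be the phase `lensAngle`. Both v^A and u^A belong to one family
`lensWave`, (T-t)⁻² e^{iκ_k θ(x,t)} ψ_k(x/(T-t)), in which the parameter σ is 0 for v^A and 1 for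
u^A; it solves the system with β_k = σ α_k²/γ_k. The reason is symmetry: the nonlinearity is
quadratic, hence L²-critical in dimension four, and it is covariant under exactly the phases κ_k θ
that the pseudo-conformal transform produces (`source_lensWave`).

A weak solution ψ comes without decay or regularity beyond H¹, whereas v^A lies in H¹ only if xψ is
in L², and in W^{1,4} only if ∇ψ and xψ are in L⁴. Decay comes from Agmon's method: the elliptic
system is tested with η²ψ for bounded weights η approximating an exponential, and the nonlinear term
is absorbed by the Sobolev inequality outside a large ball (`exists_weighted_bound`). Then -γΔψ + bψ
= f(ψ), read on the Fourier side, puts the second derivatives in L².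

The evolution equation is checked frequency by frequency. After the substitution x = (T-t)y, the
Fourier transform of the lens transform is the integral of ψ against a quadratic phase in y that
depends smoothly on t (`fourier_lens`). Its time derivative is the right-hand side of the equation
because the elliptic system may be tested against quadratic phases (`integral_quadPhase_mul`). The
resulting scalar equations integrate to Duhamel's formula (`duhamel_of_hasDerivAt_fourier`).

The transform preserves L²-norms, hence the charge. As ψ is real, the contributions of ∇ψ and of the
phase to the gradient are orthogonal, so that K(v^A(t)) = K(ψ)(T-t)⁻² + const.

Nonexistence beyond T rests on uniqueness in the whole solution class (`IsH1Solution.unique`), by an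
argument of Yudovich type. The squared L²-distance y of two solutions satisfies y' ≤ m A(t)
y^{1-3/(2m)} for all m ≥ 3 with A integrable, since the L^p-norms of a W^{1,4} function on ℝ⁴ grow
at most linearly in p (`exists_trudinger`). Letting m → ∞ gives y = 0. A solution living beyond T
would thus agree with u^A before T, against the continuity of its gradient at T. The choice T = 1
gives the sharpness statement. -/

noncomputable section

namespace QuadNLS

/-! ### Weak derivatives -/

/-- The `j`-th unit vector of `ℝ⁴`. -/
abbrev unitVec (j : Fin 4) : R4 := EuclideanSpace.single j (1 : ℝ)

/-- The `j`-th partial derivative of a function on `ℝ⁴`. -/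
def pderiv {V : Type*} [NormedAddCommGroup V] [NormedSpace ℝ V] (j : Fin 4) (u : R4 → V) (x : R4) :
    V :=
  fderiv ℝ u x (unitVec j)

section WeakDerivative

variable {V : Type*} [NormedAddCommGroup V] [NormedSpace ℝ V]

lemma contDiff_pderiv {j : Fin 4} {u : R4 → V} (hu : ContDiff ℝ (⊤ : ℕ∞) u) :
    ContDiff ℝ (⊤ : ℕ∞) (pderiv j u) :=
  (hu.fderiv_right (m := (⊤ : ℕ∞)) (by norm_cast)).clm_apply contDiff_const

lemma hasCompactSupport_pderiv {j : Fin 4} {u : R4 → V} (hu : HasCompactSupport u) :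
    HasCompactSupport (pderiv j u) :=
  hu.fderiv_apply ℝ (unitVec j)

lemma norm_pderiv_le (j : Fin 4) (u : R4 → V) (x : R4) : ‖pderiv j u x‖ ≤ ‖fderiv ℝ u x‖ := by
  simpa [pderiv] using (fderiv ℝ u x).le_opNorm (unitVec j)

lemma fderiv_apply_eq_sum (u : R4 → V) (x v : R4) :
    fderiv ℝ u x v = ∑ j, v j • pderiv j u x := by
  have hv : v = ∑ j, v j • unitVec j := by
    ext i
    simp [Finset.sum_apply, unitVec, Pi.single_apply]
  conv_lhs => rw [hv]
  simp [pderiv]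

lemma norm_fderiv_le_sum (u : R4 → V) (x : R4) :
    ‖fderiv ℝ u x‖ ≤ ∑ j, ‖pderiv j u x‖ := by
  refine ContinuousLinearMap.opNorm_le_bound _ (by positivity) fun v => ?_
  rw [fderiv_apply_eq_sum, Finset.sum_mul]
  refine (norm_sum_le _ _).trans (Finset.sum_le_sum fun j _ => ?_)
  rw [norm_smul, mul_comm]
  gcongr
  exact PiLp.norm_apply_le v j

lemma pderiv_smul {W : Type*} [NormedAddCommGroup W] [NormedSpace ℝ W] {j : Fin 4} {a : R4 → ℝ}
    {u : R4 → W} {x : R4} (ha : DifferentiableAt ℝ a x) (hu : DifferentiableAt ℝ u x) :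
    pderiv j (fun y => a y • u y) x = a x • pderiv j u x + pderiv j a x • u x := by
  simp [pderiv, fderiv_fun_smul ha hu]

lemma pderiv_mul {j : Fin 4} {a u : R4 → ℂ} {x : R4} (ha : DifferentiableAt ℝ a x)
    (hu : DifferentiableAt ℝ u x) :
    pderiv j (fun y => a y * u y) x = a x * pderiv j u x + pderiv j a x * u x := by
  simp [pderiv, fderiv_fun_mul ha hu, mul_comm]

lemma integrable_smul_of_hasCompactSupport {φ : R4 → ℝ} {u : R4 → V} (hφ : Continuous φ)
    (hc : HasCompactSupport φ) (hu : LocallyIntegrable u) : Integrable fun x => φ x • u x :=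
  hu.integrable_smul_left_of_hasCompactSupport hφ hc

lemma locallyIntegrable_of_memLp_two {W : Type*} [NormedAddCommGroup W] {u : R4 → W} (hu : MemLp u 2) : LocallyIntegrable u :=
  hu.locallyIntegrable (by norm_num)

lemma HasWeakPartial.ae_eq [CompleteSpace V] {j : Fin 4} {u G G' : R4 → V}
    (h : HasWeakPartial j u G) (h' : HasWeakPartial j u G') (hG : LocallyIntegrable G)
    (hG' : LocallyIntegrable G') : G =ᵐ[volume] G' := by
  refine ae_eq_of_integral_contDiff_smul_eq hG hG' fun g hg hc => ?_
  have h1 := h g hg hc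
  have h2 := h' g hg hc
  rw [h1] at h2
  exact neg_injective h2

lemma HasWeakPartial.congr {j : Fin 4} {u u' G G' : R4 → V} (h : HasWeakPartial j u G)
    (hu : u =ᵐ[volume] u') (hG : G =ᵐ[volume] G') : HasWeakPartial j u' G' := by
  intro φ hφ hc
  have e1 : ∫ x, (fderiv ℝ φ x (EuclideanSpace.single j (1 : ℝ))) • u' x =
      ∫ x, (fderiv ℝ φ x (EuclideanSpace.single j (1 : ℝ))) • u x :=
    integral_congr_ae (hu.mono fun x hx => by simp [hx])
  have e2 : ∫ x, φ x • G' x = ∫ x, φ x • G x :=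
    integral_congr_ae (hG.mono fun x hx => by simp [hx])
  rw [e1, e2, h φ hφ hc]

lemma weakPartial_spec {u : R4 → V} {j : Fin 4}
    (h : ∃ G : R4 → V, MemLp G 2 volume ∧ HasWeakPartial j u G) :
    MemLp (weakPartial j u) 2 ∧ HasWeakPartial j u (weakPartial j u) := by
  rw [weakPartial, dif_pos h]
  exact h.choose_spec

lemma MemH1.memLp_weakPartial {u : R4 → V} (h : MemH1 u) (j : Fin 4) :
    MemLp (weakPartial j u) 2 :=
  (weakPartial_spec (h.2 j)).1

lemma MemH1.hasWeakPartial {u : R4 → V} (h : MemH1 u) (j : Fin 4) :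
    HasWeakPartial j u (weakPartial j u) :=
  (weakPartial_spec (h.2 j)).2

/-- `weakPartial` is an arbitrary choice of a representative. This lemma identifies it with any
explicit square integrable weak derivative and is how it gets computed below. -/
lemma HasWeakPartial.weakPartial_ae_eq [CompleteSpace V] {u G : R4 → V} {j : Fin 4}
    (h : HasWeakPartial j u G) (hG : MemLp G 2) : weakPartial j u =ᵐ[volume] G := by
  obtain ⟨h1, h2⟩ := weakPartial_spec ⟨G, hG, h⟩
  exact h2.ae_eq h (locallyIntegrable_of_memLp_two h1) (locallyIntegrable_of_memLp_two hG)

lemma HasWeakPartial.add {j : Fin 4} {u u' G G' : R4 → V} (h : HasWeakPartial j u G)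
    (h' : HasWeakPartial j u' G') (hu : LocallyIntegrable u) (hu' : LocallyIntegrable u')
    (hG : LocallyIntegrable G) (hG' : LocallyIntegrable G') :
    HasWeakPartial j (fun x => u x + u' x) (fun x => G x + G' x) := by
  intro φ hφ hc
  have hφ' : Continuous (pderiv j φ) := (contDiff_pderiv hφ).continuous
  have hc' : HasCompactSupport (pderiv j φ) := hasCompactSupport_pderiv hc
  simp only [smul_add]
  change ∫ x, pderiv j φ x • u x + pderiv j φ x • u' x = _
  rw [integral_add (integrable_smul_of_hasCompactSupport hφ' hc' hu)
      (integrable_smul_of_hasCompactSupport hφ' hc' hu'),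
    integral_add (integrable_smul_of_hasCompactSupport hφ.continuous hc hG)
      (integrable_smul_of_hasCompactSupport hφ.continuous hc hG'), neg_add,
    ← h φ hφ hc, ← h' φ hφ hc]
  rfl

lemma HasWeakPartial.comp_clm {W : Type*} [NormedAddCommGroup W] [NormedSpace ℝ W]
    [CompleteSpace V] [CompleteSpace W]
    {j : Fin 4} {u G : R4 → V} (h : HasWeakPartial j u G) (hu : LocallyIntegrable u)
    (hG : LocallyIntegrable G) (L : V →L[ℝ] W) :
    HasWeakPartial j (fun x => L (u x)) (fun x => L (G x)) := by
  intro φ hφ hc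
  have hφ' : Continuous (pderiv j φ) := (contDiff_pderiv hφ).continuous
  have hc' : HasCompactSupport (pderiv j φ) := hasCompactSupport_pderiv hc
  simp only [← map_smul]
  change ∫ x, L (pderiv j φ x • u x) = _
  rw [L.integral_comp_comm (integrable_smul_of_hasCompactSupport hφ' hc' hu),
    L.integral_comp_comm (integrable_smul_of_hasCompactSupport hφ.continuous hc hG), ← map_neg,
    ← h φ hφ hc]
  rfl

/-- The product rule for a smooth real factor. -/
lemma HasWeakPartial.smul {j : Fin 4} {u G : R4 → V} (h : HasWeakPartial j u G)
    (hu : LocallyIntegrable u) (hG : LocallyIntegrable G) {a : R4 → ℝ}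
    (ha : ContDiff ℝ (⊤ : ℕ∞) a) :
    HasWeakPartial j (fun x => a x • u x) (fun x => a x • G x + pderiv j a x • u x) := by
  intro φ hφ hc
  have hda : Continuous (pderiv j a) := (contDiff_pderiv ha).continuous
  have hφ' : Continuous (pderiv j φ) := (contDiff_pderiv hφ).continuous
  have hc' : HasCompactSupport (pderiv j φ) := hasCompactSupport_pderiv hc
  have key := h (fun x => φ x * a x) (hφ.mul ha) hc.mul_right
  have e : ∀ x, fderiv ℝ (fun x => φ x * a x) x (EuclideanSpace.single j (1 : ℝ)) =
      φ x * pderiv j a x + a x * pderiv j φ x := fun x => by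
    rw [fderiv_fun_mul (hφ.differentiable (by simp) x) (ha.differentiable (by simp) x)]
    simp [pderiv]
  simp only [e, add_smul] at key
  have i1 : Integrable fun x => (φ x * pderiv j a x) • u x :=
    integrable_smul_of_hasCompactSupport (hφ.continuous.mul hda) hc.mul_right hu
  have i2 : Integrable fun x => (a x * pderiv j φ x) • u x :=
    integrable_smul_of_hasCompactSupport (ha.continuous.mul hφ') hc'.mul_left hu
  have i3 : Integrable fun x => (φ x * a x) • G x :=
    integrable_smul_of_hasCompactSupport (hφ.continuous.mul ha.continuous) hc.mul_right hG
  rw [integral_add i1 i2] at key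
  simp only [smul_add, smul_smul]
  rw [integral_add i3 i1, neg_add, ← key]
  simp only [mul_comm _ (a _), pderiv]
  abel

lemma pderiv_re {j : Fin 4} {φ : R4 → ℂ} {x : R4} (h : DifferentiableAt ℝ φ x) :
    pderiv j (fun x => (φ x).re) x = (pderiv j φ x).re :=
  congrArg (fun L => L (unitVec j)) (Complex.reCLM.hasFDerivAt.comp x h.hasFDerivAt).fderiv

lemma pderiv_im {j : Fin 4} {φ : R4 → ℂ} {x : R4} (h : DifferentiableAt ℝ φ x) :
    pderiv j (fun x => (φ x).im) x = (pderiv j φ x).im :=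
  congrArg (fun L => L (unitVec j)) (Complex.imCLM.hasFDerivAt.comp x h.hasFDerivAt).fderiv

/-- Weak derivatives are tested against real functions only. Splitting a complex test function into
real and imaginary parts extends them to the complex factors that occur in quadratic phases and lens
transforms. -/
lemma integral_mul_eq_re_add_im {g v : R4 → ℂ} (hg : Continuous g) (hgc : HasCompactSupport g)
    (hv : LocallyIntegrable v) :
    ∫ x, g x * v x = (∫ x, (g x).re • v x) + Complex.I * ∫ x, (g x).im • v x := by
  have split : ∀ (a b : ℂ), a * b = a.re • b + Complex.I * (a.im • b) := fun a b => by
    conv_lhs => rw [← Complex.re_add_im a]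
    simp only [Complex.real_smul]
    ring
  have c1 : HasCompactSupport fun x => (g x).re := hgc.comp_left (g := Complex.re) rfl
  have c2 : HasCompactSupport fun x => (g x).im := hgc.comp_left (g := Complex.im) rfl
  simp_rw [split (g _)]
  have i1 : Integrable fun x => (g x).re • v x :=
    integrable_smul_of_hasCompactSupport (Complex.continuous_re.comp hg) c1 hv
  have i2 : Integrable fun x => (g x).im • v x :=
    integrable_smul_of_hasCompactSupport (Complex.continuous_im.comp hg) c2 hv
  rw [integral_add i1 (i2.const_mul _), integral_const_mul]

/-- The weak derivative tested against complex functions. -/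
lemma HasWeakPartial.complex {j : Fin 4} {u G : R4 → ℂ} (h : HasWeakPartial j u G)
    (hu : LocallyIntegrable u) (hG : LocallyIntegrable G) {φ : R4 → ℂ}
    (hφ : ContDiff ℝ (⊤ : ℕ∞) φ) (hc : HasCompactSupport φ) :
    ∫ x, pderiv j φ x * u x = -∫ x, φ x * G x := by
  have d : ∀ x, DifferentiableAt ℝ φ x := fun x => hφ.differentiable (by simp) x
  have k1 := h _ (Complex.reCLM.contDiff.comp hφ) (hc.comp_left (g := Complex.re) rfl)
  have k2 := h _ (Complex.imCLM.contDiff.comp hφ) (hc.comp_left (g := Complex.im) rfl)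
  rw [integral_mul_eq_re_add_im (contDiff_pderiv hφ).continuous (hasCompactSupport_pderiv hc) hu,
    integral_mul_eq_re_add_im hφ.continuous hc hG]
  simp only [← pderiv_re (d _), ← pderiv_im (d _)]
  refine (congrArg₂ (fun a b => a + Complex.I * b) k1 k2).trans ?_
  simp only [Function.comp_apply, Complex.reCLM_apply, Complex.imCLM_apply]
  ring

lemma HasWeakPartial.ofReal {j : Fin 4} {u G : R4 → ℝ} (h : HasWeakPartial j u G)
    (hu : LocallyIntegrable u) (hG : LocallyIntegrable G) :
    HasWeakPartial j (fun x => (u x : ℂ)) (fun x => (G x : ℂ)) :=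
  h.comp_clm hu hG Complex.ofRealCLM

/-- The product rule for a smooth complex factor. -/
lemma HasWeakPartial.mul {j : Fin 4} {u G : R4 → ℂ} (h : HasWeakPartial j u G)
    (hu : LocallyIntegrable u) (hG : LocallyIntegrable G) {a : R4 → ℂ}
    (ha : ContDiff ℝ (⊤ : ℕ∞) a) :
    HasWeakPartial j (fun x => a x * u x) (fun x => a x * G x + pderiv j a x * u x) := by
  intro φ hφ hc
  have hda : Continuous (pderiv j a) := (contDiff_pderiv ha).continuous
  have hφ' : Continuous (pderiv j φ) := (contDiff_pderiv hφ).continuous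
  have hc' : HasCompactSupport (pderiv j φ) := hasCompactSupport_pderiv hc
  have hcs : HasCompactSupport fun x => φ x • a x := hc.smul_right
  have key := h.complex hu hG (φ := fun x => φ x • a x) (hφ.smul ha) hcs
  have e : ∀ x, pderiv j (fun x => φ x • a x) x = φ x • pderiv j a x + pderiv j φ x • a x :=
    fun x => pderiv_smul (hφ.differentiable (by simp) x) (ha.differentiable (by simp) x)
  simp only [e, add_mul] at key
  have gen : ∀ (g : R4 → ℂ), Continuous g → HasCompactSupport g → ∀ {v : R4 → ℂ},
      LocallyIntegrable v → Integrable fun x => g x * v x := fun g hg hgc v hv =>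
    hv.integrable_smul_left_of_hasCompactSupport hg hgc
  have i1 : Integrable fun x => (φ x • pderiv j a x) * u x :=
    gen _ (hφ.continuous.smul hda) hc.smul_right hu
  have i2 : Integrable fun x => (pderiv j φ x • a x) * u x :=
    gen _ (hφ'.smul ha.continuous) hc'.smul_right hu
  have i3 : Integrable fun x => (φ x • a x) * G x :=
    gen _ (hφ.continuous.smul ha.continuous) hcs hG
  rw [integral_add i1 i2] at key
  simp only [smul_add, ← smul_mul_assoc]
  rw [integral_add i3 i1, neg_add, ← key]
  simp only [pderiv]
  abel

end WeakDerivative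

/-! ### Cutoff functions -/

/-- The cutoffs are the dilates b(x/(n+1)) of one bump. A derivative gains 1/(n+1); at a fixed x the
cutoff is constantly 1 in a neighbourhood once n ≥ ‖x‖, so that its derivatives vanish there as
well. -/
lemma exists_cutoff : ∃ C : ℝ, 0 ≤ C ∧ ∃ χ : ℕ → R4 → ℝ,
    (∀ n, ContDiff ℝ (⊤ : ℕ∞) (χ n)) ∧ (∀ n, HasCompactSupport (χ n)) ∧
    (∀ n x, |χ n x| ≤ 1) ∧ (∀ n j x, |pderiv j (χ n) x| ≤ C / (n + 1)) ∧
    ∀ x, ∀ᶠ n in atTop, χ n x = 1 ∧ ∀ j, pderiv j (χ n) x = 0 := by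
  let b : ContDiffBump (0 : R4) := ⟨1, 2, by norm_num, by norm_num⟩
  have hb : ContDiff ℝ (⊤ : ℕ∞) b := b.contDiff
  obtain ⟨C, hC⟩ := (b.hasCompactSupport.fderiv (𝕜 := ℝ)).exists_bound_of_continuous
    (hb.continuous_fderiv (by simp))
  have hd : ∀ (n : ℕ) (x : R4), fderiv ℝ (fun x : R4 => b (((n : ℝ) + 1)⁻¹ • x)) x =
      ((n : ℝ) + 1)⁻¹ • fderiv ℝ b (((n : ℝ) + 1)⁻¹ • x) := fun n x => by
    rw [fderiv_comp_smul]
  have hn : ∀ n : ℕ, (0 : ℝ) < (n : ℝ) + 1 := fun n => by positivity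
  have hlim : ∀ x : R4, ∀ᶠ n : ℕ in atTop, ∀ᶠ y in 𝓝 x, b (((n : ℝ) + 1)⁻¹ • y) = 1 := by
    intro x
    filter_upwards [eventually_ge_atTop ⌈‖x‖⌉₊] with n hnx
    have hx : ‖x‖ < n + 1 := lt_of_le_of_lt (Nat.ceil_le.1 hnx) (by linarith)
    have : ∀ᶠ y in 𝓝 x, ‖y‖ < n + 1 := continuous_norm.continuousAt.eventually_lt_const hx
    filter_upwards [this] with y hy
    refine b.one_of_mem_closedBall ?_
    rw [mem_closedBall_zero_iff, norm_smul, norm_inv, Real.norm_of_nonneg (hn n).le]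
    exact (inv_mul_le_one₀ (hn n)).2 hy.le
  refine ⟨C, (norm_nonneg _).trans (hC 0), fun n x => b (((n : ℝ) + 1)⁻¹ • x), ?_, ?_, ?_, ?_, ?_⟩
  · intro n
    exact hb.comp (contDiff_const_smul _)
  · intro n
    exact b.hasCompactSupport.comp_smul (inv_ne_zero (hn n).ne')
  · intro n x
    rw [abs_of_nonneg b.nonneg]
    exact b.le_one
  · intro n j x
    have := norm_pderiv_le j (fun x : R4 => b (((n : ℝ) + 1)⁻¹ • x)) x
    rw [hd, norm_smul, norm_inv, Real.norm_of_nonneg (hn n).le] at this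
    refine this.trans ?_
    rw [div_eq_inv_mul]
    exact mul_le_mul_of_nonneg_left (hC _) (inv_nonneg.2 (hn n).le)
  · intro x
    filter_upwards [hlim x] with n h
    refine ⟨h.self_of_nhds, fun j => ?_⟩
    have : (fun y : R4 => b (((n : ℝ) + 1)⁻¹ • y)) =ᶠ[𝓝 x] fun _ => (1 : ℝ) := h
    simp [pderiv, this.fderiv_eq]

/-- Integration by parts against a smooth function without compact support, as long as the
integrals make sense. -/
lemma HasWeakPartial.integral_eq {j : Fin 4} {u G : R4 → ℂ} (h : HasWeakPartial j u G)
    (hu : LocallyIntegrable u) (hG : LocallyIntegrable G) {g : R4 → ℂ}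
    (hg : ContDiff ℝ (⊤ : ℕ∞) g) (i0 : Integrable fun x => g x * u x)
    (i1 : Integrable fun x => pderiv j g x * u x) (i2 : Integrable fun x => g x * G x) :
    ∫ x, pderiv j g x * u x = -∫ x, g x * G x := by
  obtain ⟨C, hC0, χ, h1, h2, h3, h4, h5⟩ := exists_cutoff
  have hgd : Continuous (pderiv j g) := (contDiff_pderiv hg).continuous
  have key : ∀ n, ∫ x, (χ n x • (pderiv j g x * u x) + pderiv j (χ n) x • (g x * u x)) =
      -∫ x, χ n x • (g x * G x) := fun n => by
    have := h.complex hu hG (φ := fun x => χ n x • g x) ((h1 n).smul hg) (h2 n).smul_right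
    have e : ∀ x, pderiv j (fun x => χ n x • g x) x =
        χ n x • pderiv j g x + pderiv j (χ n) x • g x :=
      fun x => pderiv_smul ((h1 n).differentiable (by simp) x) (hg.differentiable (by simp) x)
    simpa only [e, add_mul, smul_mul_assoc] using this
  have hχc : ∀ n, Continuous (χ n) := fun n => (h1 n).continuous
  have hχd : ∀ n, Continuous (pderiv j (χ n)) := fun n => (contDiff_pderiv (h1 n)).continuous
  -- The error term ∂_jχ_n · g u vanishes in the limit and is dominated by C |g u|; the
  -- integrability of g u serves this purpose.
  have l1 : Tendsto (fun n => ∫ x, (χ n x • (pderiv j g x * u x) + pderiv j (χ n) x • (g x * u x)))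
      atTop (𝓝 (∫ x, pderiv j g x * u x)) := by
    refine tendsto_integral_of_dominated_convergence
      (fun x => ‖pderiv j g x * u x‖ + C * ‖g x * u x‖) (fun n => ?_) (i1.norm.add (i0.norm.const_mul C))
      (fun n => ?_) ?_
    · exact ((hχc n).aestronglyMeasurable.smul i1.1).add ((hχd n).aestronglyMeasurable.smul i0.1)
    · refine Eventually.of_forall fun x => (norm_add_le _ _).trans (add_le_add ?_ ?_)
      · rw [norm_smul]
        exact mul_le_of_le_one_left (norm_nonneg _) (h3 n x)
      · rw [norm_smul]
        refine mul_le_mul_of_nonneg_right ((h4 n j x).trans ?_) (norm_nonneg _)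
        exact div_le_self hC0 (by linarith [(Nat.cast_nonneg n : (0 : ℝ) ≤ n)])
    · refine Eventually.of_forall fun x => tendsto_const_nhds.congr' ?_
      filter_upwards [h5 x] with n hn
      simp [hn.1, hn.2 j]
  have l2 : Tendsto (fun n => -∫ x, χ n x • (g x * G x)) atTop (𝓝 (-∫ x, g x * G x)) := by
    refine (tendsto_integral_of_dominated_convergence (fun x => ‖g x * G x‖) (fun n => ?_) i2.norm
      (fun n => ?_) ?_).neg
    · exact (hχc n).aestronglyMeasurable.smul i2.1
    · refine Eventually.of_forall fun x => ?_
      rw [norm_smul]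
      exact mul_le_of_le_one_left (norm_nonneg _) (h3 n x)
    · refine Eventually.of_forall fun x => tendsto_const_nhds.congr' ?_
      filter_upwards [h5 x] with n hn
      simp [hn.1]
  exact tendsto_nhds_unique (l1.congr key) l2

/-! ### Mollification -/

open scoped Convolution in
/-- Averaging does not increase `L^p`-norms. -/
lemma eLpNorm_convolution_le {ρ : R4 → ℝ} (hρ : Continuous ρ) (hρ0 : ∀ x, 0 ≤ ρ x)
    (hρ1 : ∫ x, ρ x = 1) {w : R4 → ℂ} {p : ℝ≥0∞} (hp1 : 1 ≤ p) (hp : p ≠ ∞)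
    (hw : AEStronglyMeasurable w volume) :
    eLpNorm (ρ ⋆[ContinuousLinearMap.lsmul ℝ ℝ, volume] w) p volume ≤ eLpNorm w p volume := by
  wlog hsm : StronglyMeasurable w generalizing w
  · have e : (ρ ⋆[ContinuousLinearMap.lsmul ℝ ℝ, volume] w) =
        (ρ ⋆[ContinuousLinearMap.lsmul ℝ ℝ, volume] hw.mk w) :=
      convolution_congr _ ae_eq_rfl hw.ae_eq_mk
    rw [e, eLpNorm_congr_ae hw.ae_eq_mk]
    exact this hw.stronglyMeasurable_mk.aestronglyMeasurable hw.stronglyMeasurable_mk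
  have hp0 : p ≠ 0 := (zero_lt_one.trans_le hp1).ne'
  have hr : 0 < p.toReal := ENNReal.toReal_pos hp0 hp
  have hρm : Measurable fun x => ENNReal.ofReal (ρ x) := hρ.measurable.ennreal_ofReal
  have hρi : Integrable ρ := by
    by_contra h
    rw [integral_undef h] at hρ1
    exact zero_ne_one hρ1
  -- For the probability measure ν = ρ dx, the modulus of the average at x is at most the L¹(ν)-norm
  -- of w(x - ·), hence at most its L^p(ν)-norm. Integrating the p-th power over x and exchanging
  -- the integrals finishes the proof by translation invariance.
  let ν : Measure R4 := volume.withDensity fun x => ENNReal.ofReal (ρ x)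
  have hν1 : ∫⁻ x, ENNReal.ofReal (ρ x) = 1 := by
    rw [← ofReal_integral_eq_lintegral_ofReal hρi (Eventually.of_forall hρ0), hρ1,
      ENNReal.ofReal_one]
  have : IsProbabilityMeasure ν := ⟨by
    rw [withDensity_apply _ MeasurableSet.univ, Measure.restrict_univ, hν1]⟩
  have hmeas : ∀ x, Measurable fun t => w (x - t) := fun x =>
    hsm.measurable.comp (measurable_const.sub measurable_id)
  have hpt : ∀ x, ‖(ρ ⋆[ContinuousLinearMap.lsmul ℝ ℝ, volume] w) x‖ₑ ^ p.toReal ≤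
      ∫⁻ t, ENNReal.ofReal (ρ t) * ‖w (x - t)‖ₑ ^ p.toReal := by
    intro x
    have h1 : ‖(ρ ⋆[ContinuousLinearMap.lsmul ℝ ℝ, volume] w) x‖ₑ ≤
        eLpNorm (fun t => w (x - t)) 1 ν := by
      rw [eLpNorm_one_eq_lintegral_enorm, lintegral_withDensity_eq_lintegral_mul _ hρm
        (hmeas x).enorm]
      refine (enorm_integral_le_lintegral_enorm _).trans (lintegral_mono fun t => ?_)
      simp only [ContinuousLinearMap.lsmul_apply, Pi.mul_apply, enorm_smul]
      rw [Real.enorm_of_nonneg (hρ0 t)]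
    have h2 := h1.trans (eLpNorm_le_eLpNorm_of_exponent_le hp1
      (hmeas x).aestronglyMeasurable)
    rw [eLpNorm_eq_lintegral_rpow_enorm_toReal hp0 hp] at h2
    have h3 := ENNReal.rpow_le_rpow h2 hr.le
    rw [← ENNReal.rpow_mul, one_div, inv_mul_cancel₀ hr.ne', ENNReal.rpow_one,
      lintegral_withDensity_eq_lintegral_mul _ hρm ((hmeas x).enorm.pow_const _)] at h3
    exact h3
  rw [eLpNorm_eq_lintegral_rpow_enorm_toReal hp0 hp, eLpNorm_eq_lintegral_rpow_enorm_toReal hp0 hp]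
  refine ENNReal.rpow_le_rpow ?_ (by positivity)
  calc ∫⁻ x, ‖(ρ ⋆[ContinuousLinearMap.lsmul ℝ ℝ, volume] w) x‖ₑ ^ p.toReal
      ≤ ∫⁻ x, ∫⁻ t, ENNReal.ofReal (ρ t) * ‖w (x - t)‖ₑ ^ p.toReal := lintegral_mono hpt
    _ = ∫⁻ t, ∫⁻ x, ENNReal.ofReal (ρ t) * ‖w (x - t)‖ₑ ^ p.toReal := by
        refine lintegral_lintegral_swap (Measurable.aemeasurable ?_)
        exact (hρm.comp measurable_snd).mul
          (((hsm.measurable.comp (measurable_fst.sub measurable_snd)).enorm).pow_const _)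
    _ = ∫⁻ t, ENNReal.ofReal (ρ t) * ∫⁻ x, ‖w x‖ₑ ^ p.toReal := by
        refine lintegral_congr fun t => ?_
        rw [lintegral_const_mul]
        · congr 1
          exact lintegral_sub_right_eq_self (fun x => ‖w x‖ₑ ^ p.toReal) t
        · exact ((hsm.measurable.comp (measurable_id.sub measurable_const)).enorm).pow_const _
    _ = ∫⁻ x, ‖w x‖ₑ ^ p.toReal := by
        rw [lintegral_mul_const _ hρm, hν1, one_mul]

-- The derivative of the convolution falls on ρ, and y ↦ ρ(x - y) is an admissible test function
-- whose derivative carries the opposite sign.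
open scoped Convolution in
lemma HasWeakPartial.pderiv_convolution {j : Fin 4} {w G : R4 → ℂ} (h : HasWeakPartial j w G)
    (hw : LocallyIntegrable w) {ρ : R4 → ℝ} (hρ : ContDiff ℝ (⊤ : ℕ∞) ρ)
    (hc : HasCompactSupport ρ) (x : R4) :
    pderiv j (ρ ⋆[ContinuousLinearMap.lsmul ℝ ℝ, volume] w) x =
      (ρ ⋆[ContinuousLinearMap.lsmul ℝ ℝ, volume] G) x := by
  have h1 := (hc.hasFDerivAt_convolution_left (ContinuousLinearMap.lsmul ℝ ℝ) (μ := volume)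
    (hρ.of_le (by norm_cast)) hw x).fderiv
  have hcf : HasCompactSupport (fderiv ℝ ρ) := hc.fderiv (𝕜 := ℝ)
  have hcont : Continuous (fderiv ℝ ρ) := hρ.continuous_fderiv (by simp)
  have h2 : pderiv j (ρ ⋆[ContinuousLinearMap.lsmul ℝ ℝ, volume] w) x =
      ∫ t, (pderiv j ρ t) • w (x - t) := by
    rw [pderiv, h1, convolution_def, ContinuousLinearMap.integral_apply]
    · rfl
    · exact (hcf.convolutionExists_left _ hcont hw x)
  have e1 : ∫ t, (pderiv j ρ t) • w (x - t) = ∫ y, (pderiv j ρ (x - y)) • w y := by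
    rw [← integral_sub_left_eq_self _ volume x]
    simp
  have e2 : ∫ t, ρ t • G (x - t) = ∫ y, ρ (x - y) • G y := by
    rw [← integral_sub_left_eq_self _ volume x]
    simp
  have hs : ContDiff ℝ (⊤ : ℕ∞) fun y => ρ (x - y) := hρ.comp (contDiff_const.sub contDiff_id)
  have hcs : HasCompactSupport fun y => ρ (x - y) :=
    hc.comp_homeomorph (Homeomorph.subLeft x)
  have h3 := h _ hs hcs
  have hd : ∀ y, fderiv ℝ (fun y => ρ (x - y)) y = -fderiv ℝ ρ (x - y) := fun y => by
    have := (((hρ.differentiable (by simp) (x - y)).hasFDerivAt).comp y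
      ((hasFDerivAt_id y).const_sub x)).fderiv
    refine this.trans ?_
    ext v
    simp
  rw [h2, e1, convolution_def]
  simp only [ContinuousLinearMap.lsmul_apply]
  rw [e2]
  simp only [hd, neg_smul, neg_apply, integral_neg] at h3
  exact neg_injective h3

/-- Approximation of weakly differentiable functions by test functions. -/
lemma exists_testFunction_approx : ∃ C : ℝ, 0 ≤ C ∧ ∀ (p : ℝ≥0∞), 1 ≤ p → p ≠ ∞ →
    ∀ (w : R4 → ℂ) (G : Fin 4 → R4 → ℂ), MemLp w p → (∀ j, MemLp (G j) p) →
    (∀ j, HasWeakPartial j w (G j)) →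
    ∃ φ : ℕ → R4 → ℂ, (∀ n, ContDiff ℝ (⊤ : ℕ∞) (φ n)) ∧ (∀ n, HasCompactSupport (φ n)) ∧
      (∀ᵐ x, Tendsto (fun n => φ n x) atTop (𝓝 (w x))) ∧
      (∀ n, eLpNorm (φ n) p ≤ eLpNorm w p) ∧
      ∀ n j, eLpNorm (pderiv j (φ n)) p ≤
        eLpNorm (G j) p + ENNReal.ofReal (C / (n + 1)) * eLpNorm w p := by
  obtain ⟨C, hC0, χ, h1, h2, h3, h4, h5⟩ := exists_cutoff
  refine ⟨C, hC0, fun p hp1 hp w G hw hG hwG => ?_⟩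
  have hwl : LocallyIntegrable w := hw.locallyIntegrable hp1
  have hGl : ∀ j, LocallyIntegrable (G j) := fun j => (hG j).locallyIntegrable hp1
  let b : ℕ → ContDiffBump (0 : R4) := fun n =>
    ⟨1 / ((n : ℝ) + 1), 2 / ((n : ℝ) + 1), by positivity, by gcongr; norm_num⟩
  let ρ : ℕ → R4 → ℝ := fun n => (b n).normed volume
  have hρ : ∀ n, ContDiff ℝ (⊤ : ℕ∞) (ρ n) := fun n => (b n).contDiff_normed
  have hρc : ∀ n, HasCompactSupport (ρ n) := fun n => (b n).hasCompactSupport_normed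
  let m : ℕ → (R4 → ℂ) → R4 → ℂ := fun n v =>
    convolution (ρ n) v (ContinuousLinearMap.lsmul ℝ ℝ) volume
  have hm : ∀ n v, AEStronglyMeasurable v volume → eLpNorm (m n v) p ≤ eLpNorm v p := fun n v hv =>
    eLpNorm_convolution_le (hρ n).continuous (fun x => (b n).nonneg_normed x)
      (b n).integral_normed hp1 hp hv
  have hms : ∀ n, ContDiff ℝ (⊤ : ℕ∞) (m n w) := fun n =>
    (hρc n).contDiff_convolution_left _ (hρ n) hwl
  have hmc : ∀ n j, Continuous (m n (G j)) := fun n j =>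
    (hρc n).continuous_convolution_left _ (hρ n).continuous (hGl j)
  refine ⟨fun n x => χ n x • m n w x, fun n => (h1 n).smul (hms n), fun n => (h2 n).smul_right,
    ?_, fun n => ?_, fun n j => ?_⟩
  -- Convergence almost everywhere is Lebesgue differentiation: the inner and outer radii of the
  -- kernels have the bounded ratio 2 and tend to 0. Near a fixed point the cutoff is eventually 1.
  · have hlim : Tendsto (fun n => (b n).rOut) atTop (𝓝 0) := by
      have := (tendsto_one_div_add_atTop_nhds_zero_nat (𝕜 := ℝ)).const_mul 2
      simpa [b, div_eq_mul_inv] using this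
    have := ContDiffBump.ae_convolution_tendsto_right_of_locallyIntegrable (K := 2) (g := w)
      (μ := volume) hlim (Eventually.of_forall fun n => by
        simp only [b]; rw [mul_one_div]) hwl
    filter_upwards [this] with x hx
    refine hx.congr' ?_
    filter_upwards [h5 x] with n hn
    simp [hn.1, m, ρ]
  · refine (eLpNorm_mono fun x => ?_).trans (hm n w hw.1)
    rw [norm_smul]
    exact mul_le_of_le_one_left (norm_nonneg _) (h3 n x)
  -- ∂_j(χ_n (ρ_n * w)) = χ_n (ρ_n * G_j) + ∂_jχ_n (ρ_n * w). Averaging and cutting off do not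
  -- increase the norm of the first term, and the second one is of size C/(n+1).
  · have e : pderiv j (fun x => χ n x • m n w x) =
        (fun x => χ n x • m n (G j) x) + fun x => pderiv j (χ n) x • m n w x := by
      funext x
      rw [pderiv_smul ((h1 n).differentiable (by simp) x) ((hms n).differentiable (by simp) x),
        (hwG j).pderiv_convolution hwl (hρ n) (hρc n) x]
      rfl
    rw [e]
    refine (eLpNorm_add_le ((h1 n).continuous.smul (hmc n j)).aestronglyMeasurable
      ((contDiff_pderiv (h1 n)).continuous.smul (hms n).continuous).aestronglyMeasurable hp1).trans
      (add_le_add ?_ ?_)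
    · refine (eLpNorm_mono fun x => ?_).trans (hm n (G j) (hG j).1)
      change ‖χ n x • m n (G j) x‖ ≤ _
      rw [norm_smul]
      exact mul_le_of_le_one_left (norm_nonneg _) (h3 n x)
    · refine (eLpNorm_le_mul_eLpNorm_of_ae_le_mul (Eventually.of_forall fun x => ?_) p).trans
        (mul_le_mul_right (hm n w hw.1) _)
      change ‖pderiv j (χ n) x • m n w x‖ ≤ _
      rw [norm_smul]
      exact mul_le_mul_of_nonneg_right (h4 n j x) (norm_nonneg _)

/-! ### Sobolev inequalities -/

lemma eLpNorm_fderiv_le_sum {u : R4 → ℂ} (hu : ContDiff ℝ (⊤ : ℕ∞) u) {p : ℝ≥0∞} (hp : 1 ≤ p) :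
    eLpNorm (fderiv ℝ u) p ≤ ∑ j, eLpNorm (pderiv j u) p := by
  have h1 : eLpNorm (fderiv ℝ u) p ≤ eLpNorm (∑ j, fun x => ‖pderiv j u x‖) p := by
    refine eLpNorm_mono fun x => ?_
    refine (norm_fderiv_le_sum u x).trans ?_
    rw [Finset.sum_apply]
    exact le_abs_self _
  have h2 : eLpNorm (∑ j, fun x => ‖pderiv j u x‖) p ≤
      ∑ j, eLpNorm (fun x => ‖pderiv j u x‖) p :=
    eLpNorm_sum_le (fun j _ => (contDiff_pderiv hu).continuous.norm.aestronglyMeasurable) hp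
  simp only [eLpNorm_norm] at h2
  exact h1.trans h2

lemma tendsto_const_mul_sum_add {ι : Type*} [Fintype ι] {K b : ℝ≥0∞} (hK : K ≠ ∞) (C : ℝ)
    {a : ι → ℝ≥0∞} (hb : b ≠ ∞) :
    Tendsto (fun n : ℕ => K * ∑ j, (a j + ENNReal.ofReal (C / (n + 1)) * b)) atTop
      (𝓝 (K * ∑ j, a j)) := by
  refine ENNReal.Tendsto.const_mul (tendsto_finsetSum _ fun j _ => ?_) (Or.inr hK)
  have h0 : Tendsto (fun n : ℕ => C / ((n : ℝ) + 1)) atTop (𝓝 0) := by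
    have := (tendsto_one_div_add_atTop_nhds_zero_nat (𝕜 := ℝ)).const_mul C
    simpa [div_eq_mul_inv] using this
  have h1 := ENNReal.Tendsto.mul_const (ENNReal.tendsto_ofReal h0) (b := b) (Or.inr hb)
  simpa using h1.const_add (a j)

/-- The Sobolev inequality `‖w‖_{L⁴} ≤ C ‖∇w‖_{L²}` in `ℝ⁴`. -/
lemma exists_sobolev : ∃ C : ℝ≥0∞, C ≠ ∞ ∧ ∀ (w : R4 → ℂ) (G : Fin 4 → R4 → ℂ), MemLp w 2 →
    (∀ j, MemLp (G j) 2) → (∀ j, HasWeakPartial j w (G j)) →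
    eLpNorm w 4 ≤ C * ∑ j, eLpNorm (G j) 2 := by
  obtain ⟨C, hC0, happ⟩ := exists_testFunction_approx
  refine ⟨(SNormLESNormFDerivOfEqConst ℂ (volume : Measure R4) 2 : NNReal), ENNReal.coe_ne_top,
    fun w G hw hG hwG => ?_⟩
  set K : NNReal := SNormLESNormFDerivOfEqConst ℂ (volume : Measure R4) 2
  obtain ⟨φ, h1, h2, h3, h4, h5⟩ := happ 2 (by norm_num) (by norm_num) w G hw hG hwG
  have hn : ∀ n, eLpNorm (φ n) 4 ≤
      K * ∑ j, (eLpNorm (G j) 2 + ENNReal.ofReal (C / (n + 1)) * eLpNorm w 2) := fun n => by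
    have := eLpNorm_le_eLpNorm_fderiv_of_eq (volume : Measure R4) (F := ℂ) (u := φ n) (p := 2)
      (p' := 4) ((h1 n).of_le (by norm_cast)) (h2 n) (by norm_num) (by simp)
      (by simp; norm_num)
    simp only [ENNReal.coe_ofNat] at this
    refine this.trans ?_
    refine mul_le_mul_right (((eLpNorm_fderiv_le_sum (h1 n) (by norm_num)).trans
      (Finset.sum_le_sum fun j _ => h5 n j))) _
  have hlim := tendsto_const_mul_sum_add (K := (K : ℝ≥0∞)) ENNReal.coe_ne_top C
    (a := fun j => eLpNorm (G j) 2) hw.eLpNorm_ne_top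
  -- Fatou's lemma passes from the test functions to w; the errors of order 1/(n+1) disappear in the
  -- limit.
  refine (Lp.eLpNorm_lim_le_liminf_eLpNorm
    (fun n => (h1 n).continuous.aestronglyMeasurable) w h3).trans ?_
  rw [← hlim.liminf_eq]
  exact liminf_le_liminf (Eventually.of_forall hn)

/-- One step from the exponent 4m/3 to 4(m+1)/3. The inequality between ‖v‖_{4/3} and ‖∇v‖_1 is
applied to v = u^{m+1}, where |∇v| ≤ (m+1)|u|^m |∇u|. Hölder with exponents 4/3 and 4 produces the
integral of |u|^{4m/3} to the power 3/4, which the outer power 4/3 makes linear. -/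
lemma lintegral_pow_succ_le {u : R4 → ℂ} (hu : ContDiff ℝ (⊤ : ℕ∞) u) (hc : HasCompactSupport u)
    (m : ℕ) :
    ∫⁻ x, ‖u x‖ₑ ^ (4 / 3 * (m + 1 : ℕ) : ℝ) ≤
      (lintegralPowLePowLIntegralFDerivConst (volume : Measure R4) (4 / 3) : ℝ≥0∞) *
        (((m + 1 : ℕ) : ℝ≥0∞) * eLpNorm (fderiv ℝ u) 4) ^ (4 / 3 : ℝ) *
        ∫⁻ x, ‖u x‖ₑ ^ (4 / 3 * m : ℝ) := by
  have hcd : ContDiff ℝ (⊤ : ℕ∞) fun x => u x ^ (m + 1) := hu.pow _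
  have hconj : (Module.finrank ℝ R4 : ℝ).HolderConjugate (4 / 3) := by
    rw [finrank_euclideanSpace_fin, Real.holderConjugate_iff]
    norm_num
  have h1 := lintegral_pow_le_pow_lintegral_fderiv (volume : Measure R4)
    (u := fun x => u x ^ (m + 1)) (hcd.of_le (by norm_cast))
    (hc.comp_left (g := fun z : ℂ => z ^ (m + 1)) (by simp)) hconj
  have hfd : ∀ x, ‖fderiv ℝ (fun x => u x ^ (m + 1)) x‖ₑ ≤
      ((m + 1 : ℕ) : ℝ≥0∞) * (‖u x‖ₑ ^ (m : ℝ) * ‖fderiv ℝ u x‖ₑ) := fun x => by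
    rw [fderiv_fun_pow _ (hu.differentiable (by simp) x), enorm_smul, ← mul_assoc]
    refine mul_le_mul_left ?_ _
    simp only [Nat.add_sub_cancel, nsmul_eq_mul, enorm_mul, enorm_pow, ENNReal.rpow_natCast]
    refine mul_le_mul_left ?_ _
    rw [← ofReal_norm, Complex.norm_natCast, ENNReal.ofReal_natCast]
  have hum : AEMeasurable (fun x => ‖u x‖ₑ ^ (m : ℝ)) volume :=
    (hu.continuous.measurable.enorm.pow_const _).aemeasurable
  have hfm : AEMeasurable (fun x => ‖fderiv ℝ u x‖ₑ) volume :=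
    ((hu.continuous_fderiv (by simp)).measurable.enorm).aemeasurable
  have hH := ENNReal.lintegral_mul_le_Lp_mul_Lq volume (p := 4 / 3) (q := 4)
    (by rw [Real.holderConjugate_iff]; norm_num) hum hfm
  have e4 : eLpNorm (fderiv ℝ u) 4 = (∫⁻ x, ‖fderiv ℝ u x‖ₑ ^ (4 : ℝ)) ^ (1 / 4 : ℝ) := by
    rw [eLpNorm_eq_lintegral_rpow_enorm_toReal (by norm_num) (by norm_num)]
    norm_num
  rw [← e4] at hH
  have h2 : ∫⁻ x, ‖fderiv ℝ (fun x => u x ^ (m + 1)) x‖ₑ ≤ ((m + 1 : ℕ) : ℝ≥0∞) *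
      ((∫⁻ x, ‖u x‖ₑ ^ (4 / 3 * m : ℝ)) ^ (3 / 4 : ℝ) * eLpNorm (fderiv ℝ u) 4) := by
    refine (lintegral_mono hfd).trans ?_
    rw [lintegral_const_mul' _ _ (ENNReal.natCast_ne_top _)]
    refine mul_le_mul_right (hH.trans (le_of_eq ?_)) _
    congr 1
    rw [show (1 / (4 / 3) : ℝ) = 3 / 4 by norm_num]
    congr 1
    refine lintegral_congr fun x => ?_
    rw [← ENNReal.rpow_mul, mul_comm]
  have h3 : ∫⁻ x, ‖u x‖ₑ ^ (4 / 3 * (m + 1 : ℕ) : ℝ) = ∫⁻ x, ‖u x ^ (m + 1)‖ₑ ^ (4 / 3 : ℝ) := by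
    refine lintegral_congr fun x => ?_
    rw [enorm_pow, ← ENNReal.rpow_natCast, ← ENNReal.rpow_mul, mul_comm]
  rw [h3]
  refine h1.trans ?_
  rw [mul_assoc]
  refine mul_le_mul_right ?_ _
  refine (ENNReal.rpow_le_rpow h2 (by norm_num)).trans (le_of_eq ?_)
  rw [mul_left_comm, ENNReal.mul_rpow_of_nonneg _ _ (by norm_num), ← ENNReal.rpow_mul]
  norm_num [mul_comm]

/-- Iteration of `lintegral_pow_succ_le` from m = 3, where the exponent is 4. The number M bounds
all factors m that occur, so that every step costs the same K (M A)^{4/3}. The power 3/(4m), with M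
= m, then leaves a bound linear in m. -/
lemma lintegral_rpow_le_of_testFunction {u : R4 → ℂ} (hu : ContDiff ℝ (⊤ : ℕ∞) u)
    (hc : HasCompactSupport u) {K A : ℝ≥0∞} (hK1 : 1 ≤ K)
    (hK : (lintegralPowLePowLIntegralFDerivConst (volume : Measure R4) (4 / 3) : ℝ≥0∞) ≤ K)
    (hA0 : eLpNorm u 4 ≤ A) (hA1 : eLpNorm (fderiv ℝ u) 4 ≤ A) {M : ℕ} {m : ℕ} (hm : 3 ≤ m)
    (hmM : m ≤ M) :
    ∫⁻ x, ‖u x‖ₑ ^ (4 / 3 * m : ℝ) ≤ (K * ((M : ℝ≥0∞) * A) ^ (4 / 3 : ℝ)) ^ m := by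
  induction m, hm using Nat.le_induction with
  | base =>
    have e4 : ∫⁻ x, ‖u x‖ₑ ^ (4 / 3 * (3 : ℕ) : ℝ) = eLpNorm u 4 ^ (4 : ℝ) := by
      rw [eLpNorm_eq_lintegral_rpow_enorm_toReal (by norm_num) (by norm_num), ← ENNReal.rpow_mul]
      norm_num
    rw [e4]
    have hM1 : (1 : ℝ≥0∞) ≤ M := by exact_mod_cast (by omega : 1 ≤ M)
    have hM : A ≤ (M : ℝ≥0∞) * A := le_mul_of_one_le_left zero_le hM1
    have hAM : eLpNorm u 4 ≤ (M : ℝ≥0∞) * A := hA0.trans hM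
    have h1 : eLpNorm u 4 ^ (4 : ℝ) ≤ ((M : ℝ≥0∞) * A) ^ (4 : ℝ) :=
      ENNReal.rpow_le_rpow hAM (by norm_num)
    have h2 : ((M : ℝ≥0∞) * A) ^ (4 : ℝ) = (((M : ℝ≥0∞) * A) ^ (4 / 3 : ℝ)) ^ 3 := by
      rw [← ENNReal.rpow_natCast, ← ENNReal.rpow_mul]; norm_num
    refine (h1.trans_eq h2).trans ?_
    gcongr
    exact le_mul_of_one_le_left zero_le hK1
  | succ m hm ih =>
    refine (lintegral_pow_succ_le hu hc m).trans ?_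
    rw [pow_succ']
    refine mul_le_mul' (mul_le_mul' hK (ENNReal.rpow_le_rpow (mul_le_mul' ?_ hA1) (by norm_num)))
      (ih (by omega))
    exact_mod_cast hmM

/-- The growth of the `L^p`-norms of a function in `W^{1,4}(ℝ⁴)` is at most linear in `p`. -/
lemma exists_trudinger : ∃ K : ℝ≥0∞, K ≠ ∞ ∧ ∀ (w : R4 → ℂ) (G : Fin 4 → R4 → ℂ), MemLp w 4 →
    (∀ j, MemLp (G j) 4) → (∀ j, HasWeakPartial j w (G j)) → ∀ m : ℕ, 3 ≤ m →
    eLpNorm w (ENNReal.ofReal (4 / 3 * m)) ≤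
      K * ((m : ℝ≥0∞) * (eLpNorm w 4 + ∑ j, eLpNorm (G j) 4)) := by
  obtain ⟨C, hC0, happ⟩ := exists_testFunction_approx
  set K₀ : ℝ≥0∞ := max 1 (lintegralPowLePowLIntegralFDerivConst (volume : Measure R4) (4 / 3))
  have hK₀ : K₀ ≠ ∞ := max_ne_top ENNReal.one_ne_top ENNReal.coe_ne_top
  -- The constant c absorbs the cutoff errors: four derivatives, each with an error of at most C
  -- ‖w‖_4 because C/(n+1) ≤ C.
  set c : ℝ≥0∞ := 1 + 4 * ENNReal.ofReal C
  have hc : c ≠ ∞ := by finiteness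
  refine ⟨K₀ ^ (3 / 4 : ℝ) * c, by finiteness, fun w G hw hG hwG m hm => ?_⟩
  obtain ⟨φ, h1, h2, h3, h4, h5⟩ := happ 4 (by norm_num) (by norm_num) w G hw hG hwG
  set A := eLpNorm w 4 + ∑ j, eLpNorm (G j) 4
  have hwA : eLpNorm w 4 ≤ A := le_self_add
  have hAc : A ≤ c * A := le_mul_of_one_le_left zero_le le_self_add
  have hA0 : ∀ n, eLpNorm (φ n) 4 ≤ c * A := fun n => ((h4 n).trans hwA).trans hAc
  have hA1 : ∀ n, eLpNorm (fderiv ℝ (φ n)) 4 ≤ c * A := fun n => by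
    have h6 : ∀ j, eLpNorm (pderiv j (φ n)) 4 ≤
        eLpNorm (G j) 4 + ENNReal.ofReal C * eLpNorm w 4 := fun j => by
      refine (h5 n j).trans ?_
      gcongr
      exact div_le_self hC0 (by linarith [(Nat.cast_nonneg n : (0 : ℝ) ≤ n)])
    refine (eLpNorm_fderiv_le_sum (h1 n) (by norm_num)).trans
      ((Finset.sum_le_sum fun j _ => h6 j).trans ?_)
    have h7 : ∑ j : Fin 4, (eLpNorm (G j) 4 + ENNReal.ofReal C * eLpNorm w 4) =
        ∑ j, eLpNorm (G j) 4 + 4 * ENNReal.ofReal C * eLpNorm w 4 := by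
      rw [Finset.sum_add_distrib]; simp [mul_assoc]
    rw [h7, show c * A = A + 4 * ENNReal.ofReal C * A by rw [add_mul, one_mul]]
    exact add_le_add le_add_self (mul_le_mul_right hwA _)
  have hm0 : (0 : ℝ) < m := by exact_mod_cast (by omega : 0 < m)
  have hp0 : ENNReal.ofReal (4 / 3 * m) ≠ 0 := by
    rw [ne_eq, ENNReal.ofReal_eq_zero, not_le]; positivity
  have hn : ∀ n, eLpNorm (φ n) (ENNReal.ofReal (4 / 3 * m)) ≤
      K₀ ^ (3 / 4 : ℝ) * c * ((m : ℝ≥0∞) * A) := fun n => by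
    rw [eLpNorm_eq_lintegral_rpow_enorm_toReal hp0 ENNReal.ofReal_ne_top,
      ENNReal.toReal_ofReal (by positivity)]
    have := lintegral_rpow_le_of_testFunction (h1 n) (h2 n) (le_max_left _ _) (le_max_right _ _)
      (hA0 n) (hA1 n) hm le_rfl
    refine (ENNReal.rpow_le_rpow this (by positivity)).trans (le_of_eq ?_)
    rw [← ENNReal.rpow_natCast, ← ENNReal.rpow_mul,
      show (m : ℝ) * (1 / (4 / 3 * m)) = 3 / 4 by field_simp,
      ENNReal.mul_rpow_of_nonneg _ _ (by norm_num), ← ENNReal.rpow_mul]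
    norm_num
    ring
  refine (Lp.eLpNorm_lim_le_liminf_eLpNorm
    (fun n => (h1 n).continuous.aestronglyMeasurable) w h3).trans ?_
  exact (liminf_le_liminf (Eventually.of_forall hn)).trans (by simp)

/-! ### The nonlinearities -/

section NonlinearityProperties

variable {l : ℕ}

/-- Chain rule for R ∘ g = c R with g linear. It transfers the scaling and the gauge invariance of
Re F to its gradient. -/
lemma fderiv_comp_equiv_eq {V : Type*} [NormedAddCommGroup V] [NormedSpace ℝ V]
    {W : Type*} [NormedAddCommGroup W] [NormedSpace ℝ W] {R : V → W}
    (hR : Differentiable ℝ R) (g : V →L[ℝ] V) (c : ℝ) (h : ∀ z, R (g z) = c • R z) (z v : V) :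
    fderiv ℝ R (g z) (g v) = c • fderiv ℝ R z v := by
  have h1 : HasFDerivAt (fun z => R (g z)) ((fderiv ℝ R (g z)).comp g) z :=
    (hR (g z)).hasFDerivAt.comp z g.hasFDerivAt
  have h2 : HasFDerivAt (fun z => c • R z) (c • fderiv ℝ R z) z := (hR z).hasFDerivAt.const_smul c
  rw [show (fun z => R (g z)) = fun z => c • R z from funext h] at h1
  simpa using congrArg (fun L => L v) (h1.unique h2)

namespace IsAdmissible

variable {α γ : Fin l → ℝ} {f : Fin l → (Fin l → ℂ) → ℂ} {F : (Fin l → ℂ) → ℂ}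

lemma differentiable_re (hf : IsAdmissible α γ f F) : Differentiable ℝ fun z => (F z).re :=
  Complex.reCLM.differentiable.comp hf.differentiable_potential

/-- `f k` is the gradient of `Re F` in the variable `z_k`. -/
lemma eq_gradient (hf : IsAdmissible α γ f F) (k : Fin l) (z : Fin l → ℂ) :
    f k z = (fderiv ℝ (fun z => (F z).re) z (Pi.single k 1) : ℂ) +
      Complex.I * (fderiv ℝ (fun z => (F z).re) z (Pi.single k Complex.I) : ℂ) := by
  have h : ∀ v, fderiv ℝ (fun z => (F z).re) z v = (fderiv ℝ F z v).re := fun v => by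
    have := (Complex.reCLM.hasFDerivAt.comp z (hf.differentiable_potential z).hasFDerivAt).fderiv
    exact congrArg (fun L => L v) this
  rw [hf.eq_deriv, dz, dzbar, h, h]
  apply Complex.ext <;> simp <;> ring

/-- Re F has degree three and `f k` is a component of its gradient, which loses one degree. -/
lemma map_real_smul (hf : IsAdmissible α γ f F) {r : ℝ} (hr : 0 < r) (k : Fin l)
    (z : Fin l → ℂ) : f k (r • z) = ((r ^ 2 : ℝ) : ℂ) * f k z := by
  have hF : ∀ z, (F ((r • ContinuousLinearMap.id ℝ (Fin l → ℂ)) z)).re = r ^ 3 • (F z).re :=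
    fun z => by
    have := hf.homogeneous r hr z
    have e : ((r • ContinuousLinearMap.id ℝ (Fin l → ℂ)) z) = fun k => (r : ℂ) * z k := by
      ext k; simp
    rw [e, this, ← Complex.ofReal_pow, Complex.re_ofReal_mul, smul_eq_mul]
  have h : ∀ v, fderiv ℝ (fun z => (F z).re) (r • z) v =
      r ^ 2 * fderiv ℝ (fun z => (F z).re) z v := fun v => by
    have := fderiv_comp_equiv_eq hf.differentiable_re _ _ hF z v
    simp only [smul_apply, ContinuousLinearMap.id_apply, map_smul,
      smul_eq_mul] at this
    refine mul_left_cancel₀ hr.ne' ?_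
    rw [this]
    ring
  rw [hf.eq_gradient, hf.eq_gradient, h, h]
  push_cast
  ring

/-- The gradient of a function invariant under a rotation is equivariant. As only Re F is invariant,
the argument runs in real coordinates: in the k-th variable the directions 1 and i are rotated into
each other. -/
lemma map_gauge (hf : IsAdmissible α γ f F) (θ : ℝ) (k : Fin l) (z : Fin l → ℂ) :
    (f k fun m => Complex.exp (Complex.I * ((α m / γ m * θ : ℝ) : ℂ)) * z m) =
      Complex.exp (Complex.I * ((α k / γ k * θ : ℝ) : ℂ)) * f k z := by
  let g : (Fin l → ℂ) →L[ℝ] (Fin l → ℂ) := ContinuousLinearMap.pi fun m =>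
    Complex.exp (Complex.I * ((α m / γ m * θ : ℝ) : ℂ)) • ContinuousLinearMap.proj (R := ℝ) m
  have hg : ∀ z, g z = fun m => Complex.exp (Complex.I * ((α m / γ m * θ : ℝ) : ℂ)) * z m :=
    fun z => by ext m; simp [g]
  have hR : ∀ z, (F (g z)).re = (1 : ℝ) • (F z).re := fun z => by
    rw [hg, one_smul]
    exact hf.gauge θ z
  have h : ∀ v, fderiv ℝ (fun z => (F z).re) (g z) (g v) = fderiv ℝ (fun z => (F z).re) z v :=
    fun v => by simpa using fderiv_comp_equiv_eq hf.differentiable_re g 1 hR z v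
  set c := Real.cos (α k / γ k * θ)
  set s := Real.sin (α k / γ k * θ)
  have hcs : c ^ 2 + s ^ 2 = 1 := Real.cos_sq_add_sin_sq _
  have hE : Complex.exp (Complex.I * ((α k / γ k * θ : ℝ) : ℂ)) = (c : ℂ) + s * Complex.I := by
    rw [mul_comm, Complex.exp_mul_I, ← Complex.ofReal_cos, ← Complex.ofReal_sin]
  have hgs : ∀ w : ℂ, g (Pi.single k w) = Pi.single k (((c : ℂ) + s * Complex.I) * w) := fun w => by
    rw [hg]
    ext m
    by_cases hm : m = k
    · subst hm; simp only [Pi.single_eq_same]; rw [hE]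
    · simp [hm]
  have e1 : g (Pi.single k 1) =
      c • (Pi.single k 1 : Fin l → ℂ) + s • (Pi.single k Complex.I : Fin l → ℂ) := by
    rw [hgs, ← Pi.single_smul, ← Pi.single_smul, ← Pi.single_add]
    simp
  have e2 : g (Pi.single k Complex.I) =
      -s • (Pi.single k 1 : Fin l → ℂ) + c • (Pi.single k Complex.I : Fin l → ℂ) := by
    rw [hgs, ← Pi.single_smul, ← Pi.single_smul, ← Pi.single_add]
    congr 1
    rw [add_mul, mul_assoc, Complex.I_mul_I]
    simp
    ring
  have h1 := h (Pi.single k 1)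
  have h2 := h (Pi.single k Complex.I)
  rw [e1, map_add, map_smul, map_smul] at h1
  rw [e2, map_add, map_smul, map_smul] at h2
  rw [← hg, hf.eq_gradient, hf.eq_gradient, hE, ← h1, ← h2]
  simp only [smul_eq_mul]
  set a := fderiv ℝ (fun z => (F z).re) (g z) (Pi.single k 1)
  set b := fderiv ℝ (fun z => (F z).re) (g z) (Pi.single k Complex.I)
  apply Complex.ext
  · simp
    linear_combination (-a) * hcs
  · simp
    linear_combination (-b) * hcs

/-- By homogeneity f(2z) = 4 f(z), hence 2 Df(0) = 4 Df(0). -/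
lemma fderiv_zero (hf : IsAdmissible α γ f F) (k : Fin l) : fderiv ℝ (f k) 0 = 0 := by
  have h : ∀ z, f k (((2 : ℝ) • ContinuousLinearMap.id ℝ (Fin l → ℂ)) z) =
      (2 ^ 2 : ℝ) • f k z := fun z => by
    have := hf.map_real_smul two_pos k z
    simpa using this
  ext v
  have := fderiv_comp_equiv_eq (hf.differentiable k) _ _ h 0 v
  simp only [smul_apply, ContinuousLinearMap.id_apply, map_smul,
    smul_zero] at this
  have h2 : ((2 : ℝ) ^ 2 - 2) • fderiv ℝ (f k) 0 v = 0 := by rw [sub_smul, this, sub_self]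
  simpa using (smul_eq_zero.1 h2).resolve_left (by norm_num)

/-- The derivatives are Lipschitz and vanish at 0, so they grow at most linearly. Real directional
derivatives are recovered from ∂_x = ∂_z + ∂_z̄ and ∂_y = i(∂_z - ∂_z̄). -/
lemma exists_norm_fderiv_le (hf : IsAdmissible α γ f F) :
    ∃ C : ℝ, 0 ≤ C ∧ ∀ k z, ‖fderiv ℝ (f k) z‖ ≤ C * ‖z‖ := by
  obtain ⟨C, hC, h⟩ := hf.lipschitz_deriv
  refine ⟨l * (2 * (2 * (C * l))), by positivity, fun k z => ?_⟩
  have hsum : ∑ j, ‖z j - (0 : Fin l → ℂ) j‖ ≤ l * ‖z‖ := by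
    refine (Finset.sum_le_card_nsmul _ _ ‖z‖ fun j _ => ?_).trans_eq (by simp)
    simpa using norm_le_pi_norm z j
  have hdz : ∀ m, ‖dz m (f k) z‖ ≤ C * l * ‖z‖ := fun m => by
    have h0 : dz m (f k) 0 = 0 := by simp [dz, hf.fderiv_zero]
    have := (h k m z 0).1
    rw [h0, sub_zero] at this
    rw [mul_assoc]
    exact this.trans (mul_le_mul_of_nonneg_left hsum hC.le)
  have hdzb : ∀ m, ‖dzbar m (f k) z‖ ≤ C * l * ‖z‖ := fun m => by
    have h0 : dzbar m (f k) 0 = 0 := by simp [dzbar, hf.fderiv_zero]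
    have := (h k m z 0).2
    rw [h0, sub_zero] at this
    rw [mul_assoc]
    exact this.trans (mul_le_mul_of_nonneg_left hsum hC.le)
  have h1 : ∀ m, ‖fderiv ℝ (f k) z (Pi.single m 1)‖ ≤ 2 * (C * l * ‖z‖) := fun m => by
    have e : fderiv ℝ (f k) z (Pi.single m 1) = dz m (f k) z + dzbar m (f k) z := by
      rw [dz, dzbar]; ring
    rw [e]
    linarith [norm_add_le (dz m (f k) z) (dzbar m (f k) z), hdz m, hdzb m]
  have h2 : ∀ m, ‖fderiv ℝ (f k) z (Pi.single m Complex.I)‖ ≤ 2 * (C * l * ‖z‖) := fun m => by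
    have e : fderiv ℝ (f k) z (Pi.single m Complex.I) =
        Complex.I * (dz m (f k) z - dzbar m (f k) z) := by
      rw [dz, dzbar]
      linear_combination (fderiv ℝ (f k) z (Pi.single m Complex.I)) * Complex.I_sq
    rw [e, norm_mul, Complex.norm_I, one_mul]
    linarith [norm_sub_le (dz m (f k) z) (dzbar m (f k) z), hdz m, hdzb m]
  refine ContinuousLinearMap.opNorm_le_bound _ (by positivity) fun v => ?_
  have hv : v = ∑ m, ((v m).re • (Pi.single m 1 : Fin l → ℂ) +
      (v m).im • (Pi.single m Complex.I : Fin l → ℂ)) := by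
    ext i
    simp [Finset.sum_apply, Pi.single_apply, Finset.sum_add_distrib]
  conv_lhs => rw [hv]
  rw [map_sum]
  refine (norm_sum_le _ _).trans ?_
  refine (Finset.sum_le_card_nsmul _ _ (2 * (2 * (C * l * ‖z‖)) * ‖v‖) fun m _ => ?_).trans_eq
    (by simp; ring)
  rw [map_add, map_smul, map_smul]
  refine (norm_add_le _ _).trans ?_
  rw [norm_smul, norm_smul]
  have hvm := norm_le_pi_norm v m
  have r1 : ‖(v m).re‖ ≤ ‖v‖ := (Complex.abs_re_le_norm _).trans hvm
  have r2 : ‖(v m).im‖ ≤ ‖v‖ := (Complex.abs_im_le_norm _).trans hvm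
  have p1 := mul_le_mul r1 (h1 m) (norm_nonneg _) (norm_nonneg v)
  have p2 := mul_le_mul r2 (h2 m) (norm_nonneg _) (norm_nonneg v)
  linarith

/-- The nonlinearities are locally Lipschitz, with quadratic growth. -/
lemma exists_lipschitz (hf : IsAdmissible α γ f F) :
    ∃ C : ℝ, 0 ≤ C ∧ ∀ k z z', ‖f k z - f k z'‖ ≤ C * (‖z‖ + ‖z'‖) * ‖z - z'‖ := by
  obtain ⟨C, hC, h⟩ := hf.exists_norm_fderiv_le
  refine ⟨C, hC, fun k z z' => ?_⟩
  have hs : Convex ℝ (Metric.closedBall (0 : Fin l → ℂ) (‖z‖ + ‖z'‖)) := convex_closedBall _ _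
  refine hs.norm_image_sub_le_of_norm_fderiv_le (𝕜 := ℝ) (fun x _ => hf.differentiable k x)
    (fun x hx => (h k x).trans ?_) ?_ ?_
  · exact mul_le_mul_of_nonneg_left (mem_closedBall_zero_iff.1 hx) hC
  · simp
  · simp

lemma exists_norm_le (hf : IsAdmissible α γ f F) :
    ∃ C : ℝ, 0 ≤ C ∧ ∀ k z, ‖f k z‖ ≤ C * ‖z‖ ^ 2 := by
  obtain ⟨C, hC, h⟩ := hf.exists_lipschitz
  refine ⟨C, hC, fun k z => ?_⟩
  have := h k z 0
  simp only [hf.map_zero, sub_zero, norm_zero, add_zero] at this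
  exact this.trans_eq (by ring)

lemma continuous (hf : IsAdmissible α γ f F) (k : Fin l) : Continuous (f k) :=
  (hf.differentiable k).continuous

end IsAdmissible

end NonlinearityProperties

/-! ### Exponential decay of the solutions of the elliptic system -/

lemma eLpNorm_two_le_ofReal {V : Type*} [NormedAddCommGroup V] {w : R4 → V} (hw : MemLp w 2)
    {B : ℝ} (h : ∫ x, ‖w x‖ ^ 2 ≤ B) : eLpNorm w 2 ≤ ENNReal.ofReal (Real.sqrt B) := by
  rw [hw.eLpNorm_eq_integral_rpow_norm (by norm_num) (by norm_num)]
  refine ENNReal.ofReal_le_ofReal ?_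
  rw [Real.sqrt_eq_rpow]
  norm_num
  exact Real.rpow_le_rpow (integral_nonneg fun x => by positivity) h (by norm_num)

/-- The Sobolev inequality for real functions. -/
lemma exists_sobolev_real : ∃ C : ℝ, 0 ≤ C ∧ ∀ (w : R4 → ℝ) (G : Fin 4 → R4 → ℝ), MemLp w 2 →
    (∀ j, MemLp (G j) 2) → (∀ j, HasWeakPartial j w (G j)) →
    MemLp w 4 ∧ ∫ x, w x ^ 4 ≤ (C * ∑ j, ∫ x, G j x ^ 2) ^ 2 := by
  obtain ⟨C, hC, h⟩ := exists_sobolev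
  refine ⟨C.toReal ^ 2 * 4, by positivity, fun w G hw hG hwG => ?_⟩
  have h1 := h (fun x => (w x : ℂ)) (fun j x => (G j x : ℂ)) hw.ofReal (fun j => (hG j).ofReal)
    fun j => (hwG j).ofReal (locallyIntegrable_of_memLp_two hw)
      (locallyIntegrable_of_memLp_two (hG j))
  have e1 : ∀ (g : R4 → ℝ) (p : ℝ≥0∞), eLpNorm (fun x => (g x : ℂ)) p = eLpNorm g p := fun g p =>
    eLpNorm_congr_norm_ae (Eventually.of_forall fun x => by simp)
  simp only [e1] at h1
  have e2 : ∀ j, eLpNorm (G j) 2 = ENNReal.ofReal (Real.sqrt (∫ x, G j x ^ 2)) := fun j => by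
    rw [(hG j).eLpNorm_eq_integral_rpow_norm (by norm_num) (by norm_num), Real.sqrt_eq_rpow]
    norm_num
  simp only [e2] at h1
  rw [← ENNReal.ofReal_sum_of_nonneg (fun _ _ => Real.sqrt_nonneg _), ← ENNReal.ofReal_toReal hC,
    ← ENNReal.ofReal_mul ENNReal.toReal_nonneg] at h1
  have hw4 : MemLp w 4 := ⟨hw.1, h1.trans_lt ENNReal.ofReal_lt_top⟩
  refine ⟨hw4, ?_⟩
  rw [hw4.eLpNorm_eq_integral_rpow_norm (by norm_num) (by norm_num),
    ENNReal.ofReal_le_ofReal_iff (by positivity)] at h1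
  have h0 : 0 ≤ ∫ x, w x ^ 4 := integral_nonneg fun x => by positivity
  have e3 : ∫ x, ‖w x‖ ^ (ENNReal.toReal 4) = ∫ x, w x ^ 4 := by
    refine integral_congr_ae (Eventually.of_forall fun x => ?_)
    have : ‖w x‖ ^ (4 : ℝ) = ‖w x‖ ^ (4 : ℕ) := by exact_mod_cast Real.rpow_natCast ‖w x‖ 4
    simp only [ENNReal.toReal_ofNat]
    rw [this, Real.norm_eq_abs, Even.pow_abs (by decide)]
  rw [e3] at h1
  have h4 : ((∫ x, w x ^ 4) ^ (ENNReal.toReal 4)⁻¹) ^ 4 = ∫ x, w x ^ 4 := by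
    rw [← Real.rpow_natCast, ← Real.rpow_mul h0]
    norm_num
  have hcs : (∑ j, Real.sqrt (∫ x, G j x ^ 2)) ^ 2 ≤ 4 * ∑ j, ∫ x, G j x ^ 2 := by
    refine (sq_sum_le_card_mul_sum_sq (s := Finset.univ)).trans_eq ?_
    simp only [Finset.card_univ, Fintype.card_fin]
    push_cast
    congr 1
    exact Finset.sum_congr rfl fun j _ => Real.sq_sqrt (integral_nonneg fun x => by positivity)
  have hS : 0 ≤ ∑ j, Real.sqrt (∫ x, G j x ^ 2) := Finset.sum_nonneg fun _ _ => Real.sqrt_nonneg _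
  calc ∫ x, w x ^ 4 ≤ (C.toReal * ∑ j, Real.sqrt (∫ x, G j x ^ 2)) ^ 4 := by
        rw [← h4]
        exact pow_le_pow_left₀ (Real.rpow_nonneg h0 _) h1 4
    _ = (C.toReal ^ 2 * (∑ j, Real.sqrt (∫ x, G j x ^ 2)) ^ 2) ^ 2 := by ring
    _ ≤ (C.toReal ^ 2 * (4 * ∑ j, ∫ x, G j x ^ 2)) ^ 2 := by gcongr
    _ = _ := by ring

/-! ### Weighted energy estimates -/

section Elliptic

variable {l : ℕ}

lemma memLp_smul_of_bounded {V : Type*} [NormedAddCommGroup V] [NormedSpace ℝ V] {η : R4 → ℝ}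
    (hη : Continuous η) {M : ℝ} (hM : ∀ x, |η x| ≤ M) {u : R4 → V} {p : ℝ≥0∞} (hu : MemLp u p) :
    MemLp (fun x => η x • u x) p := by
  refine hu.of_le_mul (c := M) (hη.aestronglyMeasurable.smul hu.1) (Eventually.of_forall fun x => ?_)
  rw [norm_smul]
  exact mul_le_mul_of_nonneg_right (hM x) (norm_nonneg _)

/-- The weak gradient of `η ψ`. -/
def weightedPartial (η : R4 → ℝ) (j : Fin 4) (u : R4 → ℝ) (x : R4) : ℝ :=
  η x * weakPartial j u x + pderiv j η x * u x

lemma MemH1.hasWeakPartial_weighted {u : R4 → ℝ} (hu : MemH1 u) {η : R4 → ℝ}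
    (hη : ContDiff ℝ (⊤ : ℕ∞) η) (j : Fin 4) :
    HasWeakPartial j (fun x => η x * u x) (weightedPartial η j u) :=
  (hu.hasWeakPartial j).smul (locallyIntegrable_of_memLp_two hu.1)
    (locallyIntegrable_of_memLp_two (hu.memLp_weakPartial j)) hη

lemma MemH1.memLp_weightedPartial {u : R4 → ℝ} (hu : MemH1 u) {η : R4 → ℝ}
    (hη : ContDiff ℝ (⊤ : ℕ∞) η) {M : ℝ} (hM : ∀ x, |η x| ≤ M) {j : Fin 4}
    (hM' : ∀ x, |pderiv j η x| ≤ M) : MemLp (weightedPartial η j u) 2 :=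
  (memLp_smul_of_bounded hη.continuous hM (hu.memLp_weakPartial j)).add
    (memLp_smul_of_bounded (contDiff_pderiv hη).continuous hM' hu.1)

/-- The weighted energy inequality. -/
lemma weighted_energy_le {γ b : Fin l → ℝ} {f : Fin l → (Fin l → ℂ) → ℂ} (hγ : ∀ k, 0 < γ k)
    {ψ : Fin l → R4 → ℝ} (hψ : ψ ∈ nontrivialSolutions γ b f) {η : R4 → ℝ}
    (hη : ContDiff ℝ (⊤ : ℕ∞) η) {M : ℝ} (hM : ∀ x, |η x| ≤ M) {δ : ℝ} (hδ : 0 ≤ δ)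
    (hδη : ∀ j x, |pderiv j η x| ≤ δ * |η x|) (k : Fin l) :
    γ k * (∑ j, ∫ x, weightedPartial η j (ψ k) x ^ 2) + b k * (∫ x, (η x * ψ k x) ^ 2) ≤
      (∫ x, ‖f k fun m => (ψ m x : ℂ)‖ * (η x ^ 2 * |ψ k x|)) +
        4 * γ k * δ ^ 2 * ∫ x, (η x * ψ k x) ^ 2 := by
  obtain ⟨hH1, -, hweak⟩ := hψ
  have hu := hH1 k
  have hM0 : 0 ≤ M := (abs_nonneg _).trans (hM 0)
  have hη2 : ContDiff ℝ (⊤ : ℕ∞) fun x => η x ^ 2 := hη.pow 2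
  have hη2M : ∀ x, |η x ^ 2| ≤ M ^ 2 := fun x => by
    rw [abs_pow]; exact pow_le_pow_left₀ (abs_nonneg _) (hM x) 2
  have hdη2 : ∀ j x, pderiv j (fun x => η x ^ 2) x = 2 * η x * pderiv j η x := fun j x => by
    simp [pderiv, fderiv_fun_pow _ (hη.differentiable (by simp) x)]
  have hdηM : ∀ j x, |pderiv j η x| ≤ δ * M := fun j x =>
    (hδη j x).trans (mul_le_mul_of_nonneg_left (hM x) hδ)
  have hdη2M : ∀ j x, |pderiv j (fun x => η x ^ 2) x| ≤ 2 * M * (δ * M) := fun j x => by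
    rw [hdη2, abs_mul, abs_mul, abs_two]
    have := hM x
    have := hdηM j x
    gcongr
  set g : R4 → ℝ := fun x => η x ^ 2 * ψ k x
  have hgw : ∀ j, HasWeakPartial j g (weightedPartial (fun x => η x ^ 2) j (ψ k)) := fun j =>
    hu.hasWeakPartial_weighted hη2 j
  have hgL : ∀ j, MemLp (weightedPartial (fun x => η x ^ 2) j (ψ k)) 2 := fun j =>
    hu.memLp_weightedPartial hη2 (M := max (M ^ 2) (2 * M * (δ * M)))
      (fun x => (hη2M x).trans (le_max_left _ _)) (fun x => (hdη2M j x).trans (le_max_right _ _))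
  have hg : MemH1 g := ⟨memLp_smul_of_bounded hη2.continuous hη2M hu.1, fun j => ⟨_, hgL j, hgw j⟩⟩
  have hae : ∀ j, weakPartial j g =ᵐ[volume] weightedPartial (fun x => η x ^ 2) j (ψ k) :=
    fun j => (hgw j).weakPartial_ae_eq (hgL j)
  have hdu : ∀ j, MemLp (fun x => pderiv j η x * ψ k x) 2 := fun j =>
    memLp_smul_of_bounded (contDiff_pderiv hη).continuous (hdηM j) hu.1
  have hWp : ∀ j, MemLp (weightedPartial η j (ψ k)) 2 := fun j =>
    hu.memLp_weightedPartial hη (M := max M (δ * M)) (fun x => (hM x).trans (le_max_left _ _))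
      (fun x => (hdηM j x).trans (le_max_right _ _))
  have hηu : MemLp (fun x => η x * ψ k x) 2 := memLp_smul_of_bounded hη.continuous hM hu.1
  -- The test function is η²ψ, for which ∂_jψ ∂_j(η²ψ) = (∂_j(ηψ))² - (∂_jη ψ)². Summed over the
  -- four directions, the negative term is at most 4δ² times the integral of (ηψ)².
  have e1 : ∫ x, ∑ j, weakPartial j (ψ k) x * weakPartial j g x =
      (∑ j, ∫ x, weightedPartial η j (ψ k) x ^ 2) - ∑ j, ∫ x, (pderiv j η x * ψ k x) ^ 2 := by
    have hi : ∀ j, Integrable fun x => weakPartial j (ψ k) x * weakPartial j g x := fun j =>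
      (hu.memLp_weakPartial j).integrable_mul (hg.memLp_weakPartial j)
    rw [integral_finsetSum _ fun j _ => hi j, ← Finset.sum_sub_distrib]
    refine Finset.sum_congr rfl fun j _ => ?_
    rw [← integral_sub (hWp j).integrable_sq (hdu j).integrable_sq]
    refine integral_congr_ae ((hae j).mono fun x hx => ?_)
    simp only [hx, weightedPartial, hdη2]
    ring
  have e2 : ∫ x, ψ k x * g x = ∫ x, (η x * ψ k x) ^ 2 :=
    integral_congr_ae (Eventually.of_forall fun x => by simp only [g]; ring)
  have key := hweak g hg k
  have h1 : γ k * (∫ x, ∑ j, weakPartial j (ψ k) x * weakPartial j g x) +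
      b k * ∫ x, ψ k x * g x ≤ ∫ x, ‖f k fun m => (ψ m x : ℂ)‖ * (η x ^ 2 * |ψ k x|) := by
    have h2 := norm_integral_le_integral_norm (μ := volume)
      fun x => f k (fun m => (ψ m x : ℂ)) * (g x : ℂ)
    rw [← key, Complex.norm_real] at h2
    refine (le_abs_self _).trans (h2.trans_eq ?_)
    refine integral_congr_ae (Eventually.of_forall fun x => ?_)
    simp only [norm_mul, Complex.norm_real, g, Real.norm_eq_abs, abs_pow, sq_abs]
  rw [e1, e2] at h1
  have h3 : ∑ j, ∫ x, (pderiv j η x * ψ k x) ^ 2 ≤ 4 * δ ^ 2 * ∫ x, (η x * ψ k x) ^ 2 := by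
    refine (Finset.sum_le_card_nsmul _ _ (δ ^ 2 * ∫ x, (η x * ψ k x) ^ 2) fun j _ => ?_).trans_eq
      (by simp; ring)
    rw [← integral_const_mul]
    refine integral_mono (hdu j).integrable_sq (hηu.integrable_sq.const_mul _) fun x => ?_
    simp only [mul_pow]
    rw [← mul_assoc, ← mul_pow δ]
    refine mul_le_mul_of_nonneg_right ?_ (sq_nonneg _)
    rw [← sq_abs, ← sq_abs (δ * η x), abs_mul, abs_of_nonneg hδ]
    exact pow_le_pow_left₀ (abs_nonneg _) (hδη j x) 2
  have h4 := mul_le_mul_of_nonneg_left h3 (hγ k).le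
  nlinarith [h1, h4]

lemma integral_mul_le_sqrt_mul_sqrt {u v : R4 → ℝ} (hu : MemLp u 2) (hv : MemLp v 2)
    (hu0 : ∀ x, 0 ≤ u x) (hv0 : ∀ x, 0 ≤ v x) :
    ∫ x, u x * v x ≤ Real.sqrt (∫ x, u x ^ 2) * Real.sqrt (∫ x, v x ^ 2) := by
  have := integral_mul_le_Lp_mul_Lq_of_nonneg (μ := volume) (p := 2) (q := 2)
    (by rw [Real.holderConjugate_iff]; norm_num) (Eventually.of_forall hu0)
    (Eventually.of_forall hv0) (by simpa using hu) (by simpa using hv)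
  simpa [Real.sqrt_eq_rpow] using this

/-- The length of `ψ(x)`. -/
def vecNorm (ψ : Fin l → R4 → ℝ) (x : R4) : ℝ := ‖fun m => (ψ m x : ℂ)‖

lemma vecNorm_nonneg (ψ : Fin l → R4 → ℝ) (x : R4) : 0 ≤ vecNorm ψ x := norm_nonneg _

lemma abs_le_vecNorm (ψ : Fin l → R4 → ℝ) (k : Fin l) (x : R4) : |ψ k x| ≤ vecNorm ψ x := by
  simpa [vecNorm] using norm_le_pi_norm (fun m => (ψ m x : ℂ)) k

lemma vecNorm_pow_le (ψ : Fin l → R4 → ℝ) {n : ℕ} (hn : n ≠ 0) (x : R4) :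
    vecNorm ψ x ^ n ≤ ∑ m, |ψ m x| ^ n := by
  have h0 : 0 ≤ ∑ m, |ψ m x| ^ n := Finset.sum_nonneg fun _ _ => by positivity
  have h1 : vecNorm ψ x ≤ (∑ m, |ψ m x| ^ n) ^ (n : ℝ)⁻¹ := by
    refine (pi_norm_le_iff_of_nonneg (Real.rpow_nonneg h0 _)).2 fun m => ?_
    rw [Complex.norm_real, Real.norm_eq_abs]
    refine (Real.le_rpow_inv_iff_of_pos (abs_nonneg _) h0 (by positivity)).2 ?_
    rw [Real.rpow_natCast]
    exact Finset.single_le_sum (f := fun m => |ψ m x| ^ n) (fun _ _ => by positivity)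
      (Finset.mem_univ m)
  calc vecNorm ψ x ^ n ≤ ((∑ m, |ψ m x| ^ n) ^ (n : ℝ)⁻¹) ^ n :=
        pow_le_pow_left₀ (vecNorm_nonneg _ _) h1 n
    _ = _ := by rw [← Real.rpow_natCast, ← Real.rpow_mul h0, inv_mul_cancel₀ (by positivity),
        Real.rpow_one]

lemma memLp_vecNorm {ψ : Fin l → R4 → ℝ} {p : ℝ≥0∞} (h : ∀ k, MemLp (ψ k) p) :
    MemLp (vecNorm ψ) p := by
  have hm : AEMeasurable (fun x => fun m => (ψ m x : ℂ)) volume :=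
    aemeasurable_pi_lambda _ fun m => (Complex.measurable_ofReal.comp_aemeasurable
      (h m).1.aemeasurable)
  have hs : MemLp (fun x => ∑ m, |ψ m x|) p :=
    memLp_finsetSum _ fun m _ => (h m).norm
  refine hs.of_le hm.norm.aestronglyMeasurable (Eventually.of_forall fun x => ?_)
  rw [Real.norm_of_nonneg (vecNorm_nonneg _ _)]
  exact (by simpa using vecNorm_pow_le ψ one_ne_zero x : vecNorm ψ x ≤ _).trans (le_abs_self _)

lemma exists_pos_le {ι : Type*} [Fintype ι] {a : ι → ℝ} (ha : ∀ i, 0 < a i) :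
    ∃ c : ℝ, 0 < c ∧ ∀ i, c ≤ a i := by
  have h0 : 0 ≤ ∑ i, (a i)⁻¹ := Finset.sum_nonneg fun i _ => (inv_pos.2 (ha i)).le
  refine ⟨(1 + ∑ i, (a i)⁻¹)⁻¹, by positivity, fun i => inv_le_of_inv_le₀ (ha i) ?_⟩
  have := Finset.single_le_sum (f := fun i => (a i)⁻¹) (fun i _ => (inv_pos.2 (ha i)).le)
    (Finset.mem_univ i)
  linarith

lemma exists_integral_compl_ball_lt {N : R4 → ℝ} (hN : Integrable N) {ε : ℝ} (hε : 0 < ε) :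
    ∃ R : ℝ, ∫ x in (Metric.ball (0 : R4) R)ᶜ, N x < ε := by
  have h : Tendsto (fun n : ℕ => ∫ x in (Metric.ball (0 : R4) n)ᶜ, N x) atTop
      (𝓝 (∫ x in ⋂ n : ℕ, (Metric.ball (0 : R4) n)ᶜ, N x)) := by
    refine tendsto_setIntegral_of_antitone (fun n => Metric.isOpen_ball.measurableSet.compl)
      (fun m n hmn => compl_subset_compl.2 (Metric.ball_subset_ball (by exact_mod_cast hmn)))
      ⟨0, hN.integrableOn⟩
  have he : (⋂ n : ℕ, (Metric.ball (0 : R4) n)ᶜ) = ∅ := by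
    rw [← compl_iUnion, Metric.iUnion_ball_nat, compl_univ]
  rw [he] at h
  simp only [Measure.restrict_empty, integral_zero_measure] at h
  obtain ⟨n, hn⟩ := (h.eventually_lt_const hε).exists
  exact ⟨n, hn⟩

/-- Weighted `H¹`-bounds for the solutions, which depend only on the size of the weight on a fixed
ball. -/
lemma exists_weighted_bound {γ b : Fin l → ℝ} {f : Fin l → (Fin l → ℂ) → ℂ} (hγ : ∀ k, 0 < γ k)
    (hb : ∀ k, 0 < b k) (hfC : ∃ C : ℝ, 0 ≤ C ∧ ∀ k z, ‖f k z‖ ≤ C * ‖z‖ ^ 2)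
    {ψ : Fin l → R4 → ℝ} (hψ : ψ ∈ nontrivialSolutions γ b f) :
    ∃ R B : ℝ, ∀ (η : R4 → ℝ) (M δ Λ : ℝ), ContDiff ℝ (⊤ : ℕ∞) η → (∀ x, |η x| ≤ M) → 0 ≤ δ →
      (∀ j x, |pderiv j η x| ≤ δ * |η x|) → (∀ k, 8 * γ k * δ ^ 2 ≤ b k) →
      (∀ x, ‖x‖ < R → |η x| ≤ Λ) → ∀ k, ∫ x, (η x * ψ k x) ^ 2 ≤ B * Λ ^ 2 ∧
        ∀ j, ∫ x, weightedPartial η j (ψ k) x ^ 2 ≤ B * Λ ^ 2 := by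
  obtain ⟨C, hC, hfC⟩ := hfC
  obtain ⟨S, hS, hsob⟩ := exists_sobolev_real
  have hH := hψ.1
  obtain ⟨c₁, hc₁, hc₁γ⟩ := exists_pos_le hγ
  obtain ⟨c₂, hc₂, hc₂b⟩ := exists_pos_le hb
  set N := vecNorm ψ
  have hN0 : ∀ x, 0 ≤ N x := vecNorm_nonneg ψ
  have hN2 : MemLp N 2 := memLp_vecNorm fun k => (hH k).1
  have hψ4 : ∀ k, MemLp (ψ k) 4 := fun k => (hsob (ψ k) (fun j => weakPartial j (ψ k)) (hH k).1
    (hH k).memLp_weakPartial (hH k).hasWeakPartial).1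
  have hN4 : MemLp N 4 := memLp_vecNorm hψ4
  have hNsq : MemLp (fun x => N x ^ 2) 2 := by
    have := hN4.norm_rpow_div 2
    norm_num at this
    have e : (4 / 2 : ℝ≥0∞) = 2 := by
      rw [show (4 : ℝ≥0∞) = 2 * 2 by norm_num, ENNReal.mul_div_cancel_right (by norm_num)
        (by norm_num)]
    rw [e] at this
    refine this.congr_norm (hN2.1.pow 2) (Eventually.of_forall fun x => ?_)
    simp
  -- Outside this ball the mass of ψ is so small that the far part of the nonlinear terms, summed
  -- over the components, is at most half of c₁ D, with D the weighted gradient energy, and can be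
  -- absorbed. The summand 1 only keeps the denominator positive.
  obtain ⟨R, hR⟩ := exists_integral_compl_ball_lt hN2.integrable_sq
    (ε := (c₁ / (2 * (l * C * S + 1))) ^ 2) (by positivity)
  set P₀ := ∫ x, N x * N x ^ 2
  have hP₀ : 0 ≤ P₀ := integral_nonneg fun x => by have := hN0 x; positivity
  set B₀ := l * C * P₀
  have hB₀ : 0 ≤ B₀ := by positivity
  refine ⟨R, 2 * B₀ * (1 / c₁ + 1 / c₂), fun η M δ Λ hη hM hδ hδη hδb hΛ => ?_⟩
  have hdηM : ∀ j x, |pderiv j η x| ≤ δ * M := fun j x =>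
    (hδη j x).trans (mul_le_mul_of_nonneg_left (hM x) hδ)
  have hWp : ∀ k j, MemLp (weightedPartial η j (ψ k)) 2 := fun k j =>
    (hH k).memLp_weightedPartial hη (M := max M (δ * M)) (fun x => (hM x).trans (le_max_left _ _))
      (fun x => (hdηM j x).trans (le_max_right _ _))
  have hηu : ∀ k, MemLp (fun x => η x * ψ k x) 2 := fun k =>
    memLp_smul_of_bounded hη.continuous hM (hH k).1
  set d : Fin l → ℝ := fun k => ∑ j, ∫ x, weightedPartial η j (ψ k) x ^ 2
  set q : Fin l → ℝ := fun k => ∫ x, (η x * ψ k x) ^ 2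
  have hdj : ∀ k j, 0 ≤ ∫ x, weightedPartial η j (ψ k) x ^ 2 := fun k j =>
    integral_nonneg fun x => sq_nonneg _
  have hd : ∀ k, 0 ≤ d k := fun k => Finset.sum_nonneg fun j _ => hdj k j
  have hq : ∀ k, 0 ≤ q k := fun k => integral_nonneg fun x => sq_nonneg _
  set D := ∑ k, d k
  have hD : 0 ≤ D := Finset.sum_nonneg fun k _ => hd k
  have hs4 : ∀ k, MemLp (fun x => η x * ψ k x) 4 ∧ ∫ x, (η x * ψ k x) ^ 4 ≤ (S * d k) ^ 2 :=
    fun k => hsob _ (fun j => weightedPartial η j (ψ k)) (hηu k) (hWp k)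
      ((hH k).hasWeakPartial_weighted hη)
  have hηN : MemLp (fun x => η x ^ 2 * N x ^ 2) 2 :=
    memLp_smul_of_bounded (hη.continuous.pow 2) (M := M ^ 2) (fun x => by
      rw [Pi.pow_apply, abs_pow]; exact pow_le_pow_left₀ (abs_nonneg _) (hM x) 2) hNsq
  set P := ∫ x, N x * (η x ^ 2 * N x ^ 2)
  have hPi : Integrable fun x => N x * (η x ^ 2 * N x ^ 2) := hN2.integrable_mul hηN
  -- the energy inequality
  have henergy : ∀ k, γ k * d k + b k * q k ≤ C * P + b k / 2 * q k := fun k => by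
    have h1 := weighted_energy_le hγ hψ hη hM hδ hδη k
    have h2 : ∫ x, ‖f k fun m => (ψ m x : ℂ)‖ * (η x ^ 2 * |ψ k x|) ≤ C * P := by
      rw [← integral_const_mul]
      refine integral_mono_of_nonneg (Eventually.of_forall fun x => by positivity)
        (hPi.const_mul C) (Eventually.of_forall fun x => ?_)
      have h3 : ‖f k fun m => (ψ m x : ℂ)‖ ≤ C * N x ^ 2 := hfC k _
      have h4 : |ψ k x| ≤ N x := abs_le_vecNorm ψ k x
      calc ‖f k fun m => (ψ m x : ℂ)‖ * (η x ^ 2 * |ψ k x|) ≤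
            (C * N x ^ 2) * (η x ^ 2 * N x) := by gcongr
        _ = _ := by ring
    -- The condition 8γδ² ≤ b turns the error 4γδ² q into at most half of the mass term b q.
    have h5 := mul_le_mul_of_nonneg_right (hδb k) (hq k)
    have h6 : γ k * d k + b k * q k ≤ C * P + 4 * γ k * δ ^ 2 * q k :=
      h1.trans (add_le_add h2 le_rfl)
    linarith
  -- the splitting of `P`
  have hPle : P ≤ Λ ^ 2 * P₀ + c₁ / (2 * (l * C * S + 1)) * (S * D) := by
    set A := Metric.ball (0 : R4) R
    have hA : MeasurableSet A := Metric.isOpen_ball.measurableSet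
    have h1 : P = (∫ x in A, N x * (η x ^ 2 * N x ^ 2)) + ∫ x in Aᶜ, N x * (η x ^ 2 * N x ^ 2) :=
      (integral_add_compl hA hPi).symm
    have h0i : Integrable fun x => N x * N x ^ 2 := hN2.integrable_mul hNsq
    have h2 : ∫ x in A, N x * (η x ^ 2 * N x ^ 2) ≤ Λ ^ 2 * P₀ := by
      rw [← integral_const_mul]
      refine (setIntegral_mono_on hPi.integrableOn (h0i.const_mul (Λ ^ 2)).integrableOn hA
        fun x hx => ?_).trans (setIntegral_le_integral (h0i.const_mul (Λ ^ 2))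
          (Eventually.of_forall fun x => ?_))
      · have h3 : η x ^ 2 ≤ Λ ^ 2 := by
          rw [← sq_abs]
          exact pow_le_pow_left₀ (abs_nonneg _) (hΛ x (mem_ball_zero_iff.1 hx)) 2
        have := hN0 x
        calc N x * (η x ^ 2 * N x ^ 2) ≤ N x * (Λ ^ 2 * N x ^ 2) := by gcongr
          _ = _ := by ring
      · have := hN0 x
        positivity
    -- Far part: by Cauchy–Schwarz the small L²-norm of N outside the ball is set against the
    -- L²-norm of η²N², which the Sobolev inequality for the ηψ_k bounds by S D.
    have h3 : ∫ x in Aᶜ, N x * (η x ^ 2 * N x ^ 2) ≤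
        Real.sqrt (∫ x in Aᶜ, N x ^ 2) * Real.sqrt (∫ x, (η x ^ 2 * N x ^ 2) ^ 2) := by
      have h4 := integral_mul_le_sqrt_mul_sqrt (hN2.indicator hA.compl) hηN
        (fun x => indicator_nonneg (fun x _ => hN0 x) x) (fun x => by have := hN0 x; positivity)
      have e1 : ∫ x, Aᶜ.indicator N x * (η x ^ 2 * N x ^ 2) =
          ∫ x in Aᶜ, N x * (η x ^ 2 * N x ^ 2) := by
        rw [← integral_indicator hA.compl]
        refine integral_congr_ae (Eventually.of_forall fun x => ?_)
        by_cases hx : x ∈ Aᶜ <;> simp [hx]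
      have e2 : ∫ x, Aᶜ.indicator N x ^ 2 = ∫ x in Aᶜ, N x ^ 2 := by
        rw [← integral_indicator hA.compl]
        refine integral_congr_ae (Eventually.of_forall fun x => ?_)
        by_cases hx : x ∈ Aᶜ <;> simp [hx]
      rwa [e1, e2] at h4
    have h5 : Real.sqrt (∫ x in Aᶜ, N x ^ 2) ≤ c₁ / (2 * (l * C * S + 1)) := by
      refine (Real.sqrt_le_sqrt hR.le).trans_eq (Real.sqrt_sq (by positivity))
    have h6 : ∫ x, (η x ^ 2 * N x ^ 2) ^ 2 ≤ (S * D) ^ 2 := by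
      have hi4 : ∀ k, Integrable fun x => (η x * ψ k x) ^ 4 := fun k => by
        have := (hs4 k).1.integrable_norm_pow (p := 4) (by norm_num)
        refine this.congr (Eventually.of_forall fun x => ?_)
        simp only [Real.norm_eq_abs]
        exact Even.pow_abs (by decide) _
      have h7 : ∫ x, (η x ^ 2 * N x ^ 2) ^ 2 ≤ ∫ x, ∑ k, (η x * ψ k x) ^ 4 := by
        refine integral_mono_of_nonneg (Eventually.of_forall fun x => sq_nonneg _)
          (integrable_finsetSum _ fun k _ => hi4 k) (Eventually.of_forall fun x => ?_)
        have h8 := mul_le_mul_of_nonneg_left (vecNorm_pow_le ψ (n := 4) (by norm_num) x)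
          (by positivity : 0 ≤ η x ^ 4)
        rw [Finset.mul_sum] at h8
        calc (η x ^ 2 * N x ^ 2) ^ 2 = η x ^ 4 * N x ^ 4 := by ring
          _ ≤ _ := h8
          _ = _ := Finset.sum_congr rfl fun k _ => by
            rw [Even.pow_abs (by decide), mul_pow]
      refine h7.trans ?_
      rw [integral_finsetSum _ fun k _ => hi4 k]
      refine (Finset.sum_le_sum fun k _ => (hs4 k).2).trans ?_
      have h9 : ∑ k, (S * d k) ^ 2 ≤ (∑ k, S * d k) ^ 2 :=
        Finset.sum_sq_le_sq_sum_of_nonneg fun k _ => mul_nonneg hS (hd k)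
      rwa [← Finset.mul_sum] at h9
    have h10 : Real.sqrt (∫ x, (η x ^ 2 * N x ^ 2) ^ 2) ≤ S * D :=
      (Real.sqrt_le_sqrt h6).trans_eq (Real.sqrt_sq (by positivity))
    have h11 := mul_le_mul h5 h10 (Real.sqrt_nonneg _) (by positivity)
    rw [h1]
    exact add_le_add h2 (h3.trans h11)
  have hsum : c₁ * D + c₂ / 2 * ∑ k, q k ≤ l * (C * P) := by
    have h1 : ∀ k, c₁ * d k + c₂ / 2 * q k ≤ C * P := fun k => by
      have := henergy k
      have := mul_le_mul_of_nonneg_right (hc₁γ k) (hd k)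
      have := mul_le_mul_of_nonneg_right (hc₂b k) (hq k)
      linarith
    have h2 := Finset.sum_le_card_nsmul Finset.univ (fun k => c₁ * d k + c₂ / 2 * q k) (C * P)
      fun k _ => h1 k
    rw [Finset.sum_add_distrib, ← Finset.mul_sum, ← Finset.mul_sum] at h2
    simpa using h2
  have hfin : c₁ / 2 * D + c₂ / 2 * ∑ k, q k ≤ B₀ * Λ ^ 2 := by
    have h1 := mul_le_mul_of_nonneg_left hPle (by positivity : (0 : ℝ) ≤ l * C)
    have h2 : l * C * (c₁ / (2 * (l * C * S + 1)) * (S * D)) ≤ c₁ / 2 * D := by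
      have h3 : l * C * S / (l * C * S + 1) ≤ 1 := by
        rw [div_le_one (by positivity)]; linarith
      calc l * C * (c₁ / (2 * (l * C * S + 1)) * (S * D)) =
            (l * C * S / (l * C * S + 1)) * (c₁ / 2 * D) := by field_simp
        _ ≤ 1 * (c₁ / 2 * D) := mul_le_mul_of_nonneg_right h3 (by positivity)
        _ = _ := one_mul _
    have h4 : l * C * (Λ ^ 2 * P₀) = B₀ * Λ ^ 2 := by simp only [B₀]; ring
    linarith [hsum, h1, h2, h4]
  have hqs : 0 ≤ ∑ k, q k := Finset.sum_nonneg fun k _ => hq k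
  have hX : 0 ≤ B₀ * Λ ^ 2 := by positivity
  intro k
  have h1 : q k ≤ ∑ k, q k := Finset.single_le_sum (fun k _ => hq k) (Finset.mem_univ k)
  have h2 : d k ≤ D := Finset.single_le_sum (fun k _ => hd k) (Finset.mem_univ k)
  have e : 2 * B₀ * (1 / c₁ + 1 / c₂) * Λ ^ 2 =
      2 / c₁ * (B₀ * Λ ^ 2) + 2 / c₂ * (B₀ * Λ ^ 2) := by ring
  have p1 : 0 ≤ 2 / c₁ * (B₀ * Λ ^ 2) := by positivity
  have p2 : 0 ≤ 2 / c₂ * (B₀ * Λ ^ 2) := by positivity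
  rw [e]
  constructor
  · have h3 : c₂ / 2 * q k ≤ B₀ * Λ ^ 2 :=
      (mul_le_mul_of_nonneg_left h1 (by positivity)).trans
        ((le_add_of_nonneg_left (by positivity)).trans hfin)
    have h4 : q k ≤ 2 / c₂ * (B₀ * Λ ^ 2) := by
      have := mul_le_mul_of_nonneg_left h3 (by positivity : 0 ≤ 2 / c₂)
      rwa [← mul_assoc, show 2 / c₂ * (c₂ / 2) = 1 by field_simp, one_mul] at this
    linarith
  · intro j
    have h0 : ∫ x, weightedPartial η j (ψ k) x ^ 2 ≤ d k :=
      Finset.single_le_sum (f := fun j => ∫ x, weightedPartial η j (ψ k) x ^ 2)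
        (fun j _ => hdj k j) (Finset.mem_univ j)
    have h3 : c₁ / 2 * D ≤ B₀ * Λ ^ 2 := (le_add_of_nonneg_right (by positivity)).trans hfin
    have h4 : D ≤ 2 / c₁ * (B₀ * Λ ^ 2) := by
      have := mul_le_mul_of_nonneg_left h3 (by positivity : 0 ≤ 2 / c₁)
      rwa [← mul_assoc, show 2 / c₁ * (c₁ / 2) = 1 by field_simp, one_mul] at this
    linarith

end Elliptic

/-! ### Exponential weights and exponential decay -/

section ExpDecay

/-- The weight `exp(δ ⟨x⟩ / (1 + ε ⟨x⟩))`, with `⟨x⟩ = (1 + |x|²)^{1/2}`. -/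
def expWeight (δ ε : ℝ) (x : R4) : ℝ :=
  Real.exp (δ * (Real.sqrt (1 + ‖x‖ ^ 2) / (1 + ε * Real.sqrt (1 + ‖x‖ ^ 2))))

lemma expWeight_pos (δ ε : ℝ) (x : R4) : 0 < expWeight δ ε x := Real.exp_pos _

lemma one_le_sqrt_one_add (x : R4) : 1 ≤ Real.sqrt (1 + ‖x‖ ^ 2) :=
  Real.one_le_sqrt.2 (by nlinarith [sq_nonneg ‖x‖])

lemma contDiff_sqrt_one_add : ContDiff ℝ (⊤ : ℕ∞) fun x : R4 => Real.sqrt (1 + ‖x‖ ^ 2) :=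
  (contDiff_const.add (contDiff_norm_sq ℝ)).sqrt fun x => by positivity

lemma contDiff_expWeight (δ : ℝ) {ε : ℝ} (hε : 0 ≤ ε) : ContDiff ℝ (⊤ : ℕ∞) (expWeight δ ε) := by
  refine (contDiff_const.mul (contDiff_sqrt_one_add.div
    (contDiff_const.add (contDiff_const.mul contDiff_sqrt_one_add)) fun x => ?_)).exp
  positivity

/-- The profile s/(1+εs) has derivative 1/(1+εs)² ≤ 1, and |∂_j⟨x⟩| = |x_j|/⟨x⟩ ≤ 1; the bound is
therefore uniform in ε. -/
lemma abs_pderiv_expWeight_le {δ ε : ℝ} (hδ : 0 ≤ δ) (hε : 0 ≤ ε) (j : Fin 4) (x : R4) :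
    |pderiv j (expWeight δ ε) x| ≤ δ * |expWeight δ ε x| := by
  set J := Real.sqrt (1 + ‖x‖ ^ 2)
  have hJ1 : 1 ≤ J := one_le_sqrt_one_add x
  have hJ : HasFDerivAt (fun x : R4 => Real.sqrt (1 + ‖x‖ ^ 2))
      ((1 / (2 * J)) • (2 • (innerSL ℝ x))) x :=
    ((hasStrictFDerivAt_norm_sq x).hasFDerivAt.const_add 1).sqrt (by positivity)
  have hΦ : HasDerivAt (fun s : ℝ => Real.exp (δ * (s / (1 + ε * s))))
      (Real.exp (δ * (J / (1 + ε * J))) * (δ * ((1 * (1 + ε * J) - J * (ε * 1)) / (1 + ε * J) ^ 2)))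
      J := by
    have h1 : HasDerivAt (fun s : ℝ => 1 + ε * s) (ε * 1) J :=
      ((hasDerivAt_id J).const_mul ε).const_add 1
    exact (((hasDerivAt_id J).div h1 (by positivity)).const_mul δ).exp
  have hd := (hΦ.comp_hasFDerivAt x hJ).fderiv
  have e : pderiv j (expWeight δ ε) x = expWeight δ ε x * (δ * (1 / (1 + ε * J) ^ 2 * (x j / J))) := by
    have e0 : pderiv j (expWeight δ ε) x = fderiv ℝ ((fun s : ℝ =>
      Real.exp (δ * (s / (1 + ε * s)))) ∘ fun x : R4 => Real.sqrt (1 + ‖x‖ ^ 2)) x (unitVec j) := rfl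
    rw [e0, hd]
    simp only [smul_apply, innerSL_apply_apply, smul_eq_mul, nsmul_eq_mul,
      EuclideanSpace.inner_single_right, expWeight]
    simp only [J]
    field_simp
    simp
  have hxJ : |x j / J| ≤ 1 := by
    rw [abs_div, abs_of_pos (by linarith : 0 < J), div_le_one (by linarith)]
    refine (PiLp.norm_apply_le x j).trans (Real.le_sqrt_of_sq_le (by linarith))
  have hεJ : |1 / (1 + ε * J) ^ 2| ≤ 1 := by
    rw [abs_of_nonneg (by positivity), div_le_one (by positivity)]
    exact one_le_pow₀ (by nlinarith)
  rw [e, abs_mul, abs_mul, abs_mul, abs_of_nonneg hδ, mul_comm]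
  refine mul_le_mul_of_nonneg_right ?_ (abs_nonneg _)
  refine mul_le_of_le_one_right hδ (mul_le_one₀ hεJ (abs_nonneg _) hxJ)

lemma expWeight_le_exp {δ ε : ℝ} (hδ : 0 ≤ δ) (hε : 0 ≤ ε) (x : R4) :
    expWeight δ ε x ≤ Real.exp (δ * Real.sqrt (1 + ‖x‖ ^ 2)) := by
  refine Real.exp_le_exp.2 (mul_le_mul_of_nonneg_left (div_le_self (Real.sqrt_nonneg _) ?_) hδ)
  have := mul_nonneg hε (Real.sqrt_nonneg (1 + ‖x‖ ^ 2))
  linarith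

lemma expWeight_le_of_pos {δ ε : ℝ} (hδ : 0 ≤ δ) (hε : 0 < ε) (x : R4) :
    expWeight δ ε x ≤ Real.exp (δ * (1 / ε)) := by
  refine Real.exp_le_exp.2 (mul_le_mul_of_nonneg_left ?_ hδ)
  have := one_le_sqrt_one_add x
  rw [div_le_div_iff₀ (by positivity) hε]
  linarith

lemma tendsto_expWeight (δ : ℝ) (x : R4) :
    Tendsto (fun n : ℕ => expWeight δ (1 / ((n : ℝ) + 1)) x) atTop (𝓝 (expWeight δ 0 x)) := by
  have h := tendsto_one_div_add_atTop_nhds_zero_nat (𝕜 := ℝ)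
  refine (Real.continuous_exp.tendsto _).comp (Tendsto.const_mul δ ?_)
  refine tendsto_const_nhds.div ((h.mul_const _).const_add 1) (by simp)

/-- Exponential decay in the sense of `L²`. -/
def HasExpDecay {V : Type*} [NormedAddCommGroup V] [NormedSpace ℝ V] (g : R4 → V) : Prop :=
  ∃ δ : ℝ, 0 < δ ∧ MemLp (fun x => expWeight δ 0 x • g x) 2

/-- Fatou's lemma, used to pass from the bounded weights with ε > 0 to the exponential weight with ε
= 0. -/
lemma memLp_of_tendsto_of_bound {u : ℕ → R4 → ℝ} {v : R4 → ℝ} {B : ℝ} (hu : ∀ n, MemLp (u n) 2)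
    (hB : ∀ n, ∫ x, u n x ^ 2 ≤ B) (h : ∀ x, Tendsto (fun n => u n x) atTop (𝓝 (v x))) :
    MemLp v 2 := by
  refine ⟨aestronglyMeasurable_of_tendsto_ae atTop (fun n => (hu n).1) (Eventually.of_forall h),
    ?_⟩
  refine (Lp.eLpNorm_lim_le_liminf_eLpNorm (fun n => (hu n).1) v
    (Eventually.of_forall h)).trans_lt ?_
  have hn : ∀ n, eLpNorm (u n) 2 ≤ ENNReal.ofReal (Real.sqrt B) := fun n =>
    eLpNorm_two_le_ofReal (hu n) (by simpa using hB n)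
  refine ((liminf_le_liminf (Eventually.of_forall hn)).trans (by simp)).trans_lt
    (ENNReal.ofReal_lt_top (r := Real.sqrt B))

/-- The solutions of the elliptic system and their gradients decay exponentially. -/
lemma hasExpDecay_of_mem_nontrivialSolutions {l : ℕ} {γ b : Fin l → ℝ}
    {f : Fin l → (Fin l → ℂ) → ℂ} (hγ : ∀ k, 0 < γ k) (hb : ∀ k, 0 < b k)
    (hfC : ∃ C : ℝ, 0 ≤ C ∧ ∀ k z, ‖f k z‖ ≤ C * ‖z‖ ^ 2)
    {ψ : Fin l → R4 → ℝ} (hψ : ψ ∈ nontrivialSolutions γ b f) (k : Fin l) :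
    HasExpDecay (ψ k) ∧ ∀ j, HasExpDecay (weakPartial j (ψ k)) := by
  obtain ⟨R, B, h⟩ := exists_weighted_bound hγ hb hfC hψ
  have hH := hψ.1 k
  obtain ⟨c, hc, hcb⟩ := exists_pos_le (a := fun k => b k / (8 * γ k)) fun k => by
    have := hγ k; have := hb k; positivity
  set δ := Real.sqrt c
  have hδ : 0 < δ := Real.sqrt_pos.2 hc
  have hδb : ∀ k, 8 * γ k * δ ^ 2 ≤ b k := fun k => by
    have h8 : 0 < 8 * γ k := by have := hγ k; positivity
    rw [Real.sq_sqrt hc.le, ← le_div_iff₀' h8]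
    exact hcb k
  set ε : ℕ → ℝ := fun n => 1 / ((n : ℝ) + 1)
  have hε : ∀ n, 0 < ε n := fun n => by positivity
  set η : ℕ → R4 → ℝ := fun n => expWeight δ (ε n)
  have hη : ∀ n, ContDiff ℝ (⊤ : ℕ∞) (η n) := fun n => contDiff_expWeight δ (hε n).le
  have hM : ∀ n x, |η n x| ≤ Real.exp (δ * (1 / ε n)) := fun n x => by
    rw [abs_of_pos (expWeight_pos _ _ _)]
    exact expWeight_le_of_pos hδ.le (hε n) x
  have hηd : ∀ n j x, |pderiv j (η n) x| ≤ δ * |η n x| := fun n j x =>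
    abs_pderiv_expWeight_le hδ.le (hε n).le j x
  -- On the ball of radius R the weights are bounded independently of ε, so that the weighted bounds
  -- are uniform in n.
  have hbd := fun n => h (η n) _ δ (Real.exp (δ * Real.sqrt (1 + R ^ 2))) (hη n) (hM n) hδ.le
    (hηd n) hδb (fun x hx => by
      rw [abs_of_pos (expWeight_pos _ _ _)]
      refine (expWeight_le_exp hδ.le (hε n).le x).trans ?_
      gcongr) k
  set B' := B * Real.exp (δ * Real.sqrt (1 + R ^ 2)) ^ 2
  have hd' : ∀ n j x, |pderiv j (η n) x| ≤ δ * Real.exp (δ * (1 / ε n)) := fun n j x =>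
    (hηd n j x).trans (mul_le_mul_of_nonneg_left (hM n x) hδ.le)
  have hu : ∀ n, MemLp (fun x => η n x * ψ k x) 2 := fun n =>
    memLp_smul_of_bounded (hη n).continuous (hM n) hH.1
  refine ⟨⟨δ, hδ, memLp_of_tendsto_of_bound (u := fun n x => η n x * ψ k x) hu
    (fun n => (hbd n).1) fun x => (tendsto_expWeight δ x).mul_const _⟩, fun j => ⟨δ, hδ, ?_⟩⟩
  have hG : ∀ n, MemLp (fun x => η n x * weakPartial j (ψ k) x) 2 := fun n =>
    memLp_smul_of_bounded (hη n).continuous (hM n) (hH.memLp_weakPartial j)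
  have hdu : ∀ n, MemLp (fun x => pderiv j (η n) x * ψ k x) 2 := fun n =>
    memLp_smul_of_bounded (contDiff_pderiv (hη n)).continuous (hd' n j) hH.1
  have hW : ∀ n, MemLp (weightedPartial (η n) j (ψ k)) 2 := fun n => (hG n).add (hdu n)
  -- Here η ∂_jψ = ∂_j(ηψ) - ∂_jη ψ, so its square is at most twice the sum of the two squares, and
  -- (∂_jη ψ)² ≤ δ² (ηψ)².
  refine memLp_of_tendsto_of_bound (u := fun n x => η n x * weakPartial j (ψ k) x)
    (B := 2 * B' + 2 * (δ ^ 2 * B')) hG (fun n => ?_)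
    fun x => (tendsto_expWeight δ x).mul_const _
  have i1 := (hW n).integrable_sq
  have i2 := (hu n).integrable_sq
  calc ∫ x, (η n x * weakPartial j (ψ k) x) ^ 2
      ≤ ∫ x, (2 * weightedPartial (η n) j (ψ k) x ^ 2 +
          2 * (δ ^ 2 * (η n x * ψ k x) ^ 2)) := by
        refine integral_mono (hG n).integrable_sq
          ((i1.const_mul 2).add ((i2.const_mul (δ ^ 2)).const_mul 2)) fun x => ?_
        have h1 : (pderiv j (η n) x * ψ k x) ^ 2 ≤ δ ^ 2 * (η n x * ψ k x) ^ 2 := by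
          rw [mul_pow, mul_pow, ← mul_assoc, ← mul_pow δ]
          refine mul_le_mul_of_nonneg_right ?_ (sq_nonneg (ψ k x))
          rw [← sq_abs, ← sq_abs (δ * η n x), abs_mul δ, abs_of_pos hδ]
          exact pow_le_pow_left₀ (abs_nonneg _) (hηd n j x) 2
        change (η n x * weakPartial j (ψ k) x) ^ 2 ≤ 2 * weightedPartial (η n) j (ψ k) x ^ 2 +
          2 * (δ ^ 2 * (η n x * ψ k x) ^ 2)
        have h2 : η n x * weakPartial j (ψ k) x =
            weightedPartial (η n) j (ψ k) x - pderiv j (η n) x * ψ k x := by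
          simp [weightedPartial]
        rw [h2]
        nlinarith [sq_nonneg (weightedPartial (η n) j (ψ k) x + pderiv j (η n) x * ψ k x)]
    _ = 2 * (∫ x, weightedPartial (η n) j (ψ k) x ^ 2) +
          2 * (δ ^ 2 * ∫ x, (η n x * ψ k x) ^ 2) := by
        rw [integral_add (i1.const_mul 2) ((i2.const_mul (δ ^ 2)).const_mul 2), integral_const_mul,
          integral_const_mul, integral_const_mul]
    _ ≤ _ := by
        have := (hbd n).1
        have := (hbd n).2 j
        gcongr

/-- The inequality s^m/m! ≤ e^s at s = δ(1+|x|)/2, combined with (1+|x|)/2 ≤ ⟨x⟩. -/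
lemma exists_one_add_norm_pow_le {δ : ℝ} (hδ : 0 < δ) (m : ℕ) :
    ∃ K : ℝ, 0 ≤ K ∧ ∀ x : R4, (1 + ‖x‖) ^ m ≤ K * expWeight δ 0 x := by
  refine ⟨m.factorial * (2 / δ) ^ m, by positivity, fun x => ?_⟩
  have h1 := Real.pow_div_factorial_le_exp (δ / 2 * (1 + ‖x‖)) (by positivity) m
  have h2 : Real.exp (δ / 2 * (1 + ‖x‖)) ≤ expWeight δ 0 x := by
    rw [expWeight]
    refine Real.exp_le_exp.2 ?_
    have h3 := one_le_sqrt_one_add x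
    have h4 : ‖x‖ ≤ Real.sqrt (1 + ‖x‖ ^ 2) := Real.le_sqrt_of_sq_le (by linarith)
    simp only [zero_mul, add_zero, div_one]
    nlinarith
  have h3 := h1.trans h2
  rw [div_le_iff₀ (by positivity), mul_pow] at h3
  calc (1 + ‖x‖) ^ m = (2 / δ) ^ m * ((δ / 2) ^ m * (1 + ‖x‖) ^ m) := by
        rw [← mul_assoc, ← mul_pow, show 2 / δ * (δ / 2) = 1 by field_simp, one_pow, one_mul]
    _ ≤ (2 / δ) ^ m * (expWeight δ 0 x * m.factorial) := by gcongr
    _ = _ := by ring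

/-- The squared function decays with exponent 6, more than the dimension 4. By Cauchy–Schwarz this
factor pays for integrability in `HasExpDecay.mul`. -/
lemma memLp_one_add_norm_inv : MemLp (fun x : R4 => ((1 + ‖x‖) ^ 3)⁻¹) 2 := by
  have hc : Continuous fun x : R4 => ((1 + ‖x‖) ^ 3)⁻¹ :=
    ((continuous_const.add continuous_norm).pow 3).inv₀ fun x => (by positivity : (0 : ℝ) < (1 + ‖x‖) ^ 3).ne'
  rw [memLp_two_iff_integrable_sq hc.aestronglyMeasurable]
  have := integrable_one_add_norm (E := R4) (μ := volume) (r := 6) (by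
    rw [finrank_euclideanSpace_fin]; norm_num)
  refine this.congr (Eventually.of_forall fun x => ?_)
  have h : (0 : ℝ) < 1 + ‖x‖ := by positivity
  simp only
  rw [Real.rpow_neg h.le, inv_pow, ← pow_mul]
  congr 1
  exact_mod_cast Real.rpow_natCast (1 + ‖x‖) 6

namespace HasExpDecay

variable {g : R4 → ℂ}

lemma ofReal {g : R4 → ℝ} (hg : HasExpDecay g) : HasExpDecay fun x => (g x : ℂ) := by
  obtain ⟨δ, hδ, h⟩ := hg
  refine ⟨δ, hδ, ?_⟩
  have := h.ofReal (K := ℂ)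
  simpa using this

lemma aestronglyMeasurable (hg : HasExpDecay g) : AEStronglyMeasurable g volume := by
  obtain ⟨δ, -, h⟩ := hg
  have hc : Continuous (expWeight δ 0) := (contDiff_expWeight δ le_rfl).continuous
  have h2 := (hc.inv₀ fun x => (expWeight_pos δ 0 x).ne').aestronglyMeasurable.smul h.1
    (μ := volume)
  refine h2.congr (Eventually.of_forall fun x => ?_)
  change (expWeight δ 0 x)⁻¹ • expWeight δ 0 x • g x = g x
  rw [smul_smul, inv_mul_cancel₀ (expWeight_pos δ 0 x).ne', one_smul]

/-- A function with exponential decay remains in `L¹ ∩ L²` after multiplication by a function of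
polynomial growth. -/
lemma mul (hg : HasExpDecay g) {a : R4 → ℂ} (ha : Continuous a) {C : ℝ} {m : ℕ}
    (hC : ∀ x, ‖a x‖ ≤ C * (1 + ‖x‖) ^ m) :
    Integrable (fun x => a x * g x) ∧ MemLp (fun x => a x * g x) 2 := by
  have hgm := hg.aestronglyMeasurable
  obtain ⟨δ, hδ, h⟩ := hg
  -- Three powers more than the growth of a, so that the square integrable factor (1+|x|)⁻³ is left
  -- over.
  obtain ⟨K, hK, hKx⟩ := exists_one_add_norm_pow_le hδ (m + 3)
  have hC0 : 0 ≤ C := by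
    have := (norm_nonneg _).trans (hC 0)
    simpa using this
  have hb : ∀ x, ‖a x * g x‖ ≤ (C * K) * (‖((1 + ‖x‖) ^ 3)⁻¹‖ * ‖expWeight δ 0 x • g x‖) :=
    fun x => by
    have hx : (0 : ℝ) < (1 + ‖x‖) ^ 3 := by positivity
    have h1 : (1 + ‖x‖) ^ m ≤ K * (((1 + ‖x‖) ^ 3)⁻¹ * expWeight δ 0 x) := by
      have := hKx x
      rw [pow_add, ← le_div_iff₀ hx] at this
      refine this.trans_eq ?_
      rw [div_eq_mul_inv]
      ring
    rw [norm_mul, norm_smul, Real.norm_of_nonneg (expWeight_pos δ 0 x).le,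
      Real.norm_of_nonneg (by positivity)]
    calc ‖a x‖ * ‖g x‖ ≤ C * (K * (((1 + ‖x‖) ^ 3)⁻¹ * expWeight δ 0 x)) * ‖g x‖ := by
          gcongr
          exact (hC x).trans (mul_le_mul_of_nonneg_left h1 hC0)
      _ = _ := by ring
  have hmeas : AEStronglyMeasurable (fun x => a x * g x) volume := ha.aestronglyMeasurable.mul hgm
  refine ⟨?_, ?_⟩
  · refine Integrable.mono' (g := fun x => (C * K) * (‖((1 + ‖x‖) ^ 3)⁻¹‖ *
      ‖expWeight δ 0 x • g x‖)) ?_ hmeas (Eventually.of_forall hb)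
    exact (memLp_one_add_norm_inv.norm.integrable_mul h.norm).const_mul _
  · refine h.of_le_mul (c := C * K) hmeas (Eventually.of_forall fun x => (hb x).trans ?_)
    refine mul_le_mul_of_nonneg_left (mul_le_of_le_one_left (norm_nonneg _) ?_) (by positivity)
    rw [Real.norm_of_nonneg (by positivity)]
    exact inv_le_one_of_one_le₀ (one_le_pow₀ (by linarith [norm_nonneg x]))

end HasExpDecay

end ExpDecay

/-! ### The Fourier transform on `L²` and weak derivatives -/

section Fourier

open FourierTransform SchwartzMap
open scoped LineDeriv

/-- The complex Schwartz function given by a real test function. -/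
def schwartzOfTest {φ : R4 → ℝ} (hφ : ContDiff ℝ (⊤ : ℕ∞) φ) (hc : HasCompactSupport φ) :
    𝓢(R4, ℂ) :=
  HasCompactSupport.toSchwartzMap (f := fun x => (φ x : ℂ))
    (hc.comp_left (g := Complex.ofReal) rfl) (Complex.ofRealCLM.contDiff.comp hφ)

lemma schwartzOfTest_apply {φ : R4 → ℝ} (hφ : ContDiff ℝ (⊤ : ℕ∞) φ) (hc : HasCompactSupport φ)
    (x : R4) : schwartzOfTest hφ hc x = (φ x : ℂ) := rfl

/-- On L² the Fourier transform agrees with that of tempered distributions, which is defined by this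
duality with Schwartz functions. -/
lemma integral_fourier_mul_coe (u : Lp ℂ 2 (volume : Measure R4)) (X : 𝓢(R4, ℂ)) :
    ∫ x, (𝓕 X) x * u x = ∫ ξ, X ξ * (𝓕 u : Lp ℂ 2 (volume : Measure R4)) ξ := by
  have h := congrArg (fun T => T X) (Lp.fourier_toTemperedDistribution_eq u)
  simpa [TemperedDistribution.fourier_apply] using h

/-- On `L¹ ∩ L²`, the Fourier transform of `L²` is given by the Fourier integral. -/
lemma coeFn_fourier_toLp {g : R4 → ℂ} (h1 : Integrable g) (h2 : MemLp g 2) :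
    (𝓕 (h2.toLp g) : Lp ℂ 2 (volume : Measure R4)) =ᵐ[volume] 𝓕 g := by
  have hcont : Continuous (𝓕 g) :=
    VectorFourier.fourierIntegral_continuous Real.continuous_fourierChar continuous_inner h1
  -- Both sides are locally integrable and pair in the same way with test functions: by duality for
  -- the transform on L², by Fubini for the Fourier integral.
  refine ae_eq_of_integral_contDiff_smul_eq
    (locallyIntegrable_of_memLp_two (Lp.memLp _)) hcont.locallyIntegrable fun φ hφ hc => ?_
  have e1 := integral_fourier_mul_coe (h2.toLp g) (schwartzOfTest hφ hc)
  have e2 : ∫ x, (𝓕 (schwartzOfTest hφ hc)) x * (h2.toLp g) x =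
      ∫ x, (𝓕 (schwartzOfTest hφ hc)) x * g x :=
    integral_congr_ae (h2.coeFn_toLp.mono fun x hx => by simp only [hx])
  have e3 : ∫ x, (𝓕 (schwartzOfTest hφ hc)) x * g x = ∫ ξ, (schwartzOfTest hφ hc) ξ * 𝓕 g ξ := by
    have := VectorFourier.integral_fourierIntegral_smul_eq_flip (μ := (volume : Measure R4))
      (ν := (volume : Measure R4)) (L := innerₗ R4) Real.continuous_fourierChar
      continuous_inner (schwartzOfTest hφ hc).integrable h1
    simp only [flip_innerₗ, smul_eq_mul] at this
    rw [SchwartzMap.fourier_coe]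
    exact this
  rw [e2, e3] at e1
  simpa [schwartzOfTest_apply] using e1.symm

/-- A function of `L²` is weakly differentiable if its Fourier transform decays. -/
lemma hasWeakPartial_of_fourier {j : Fin 4} {u H : Lp ℂ 2 (volume : Measure R4)}
    (h : (𝓕 H : Lp ℂ 2 (volume : Measure R4)) =ᵐ[volume]
      fun ξ => (2 * Real.pi * Complex.I) * ξ j * (𝓕 u : Lp ℂ 2 (volume : Measure R4)) ξ) :
    HasWeakPartial j u H := by
  intro φ hφ hc
  set Φ := schwartzOfTest hφ hc
  set X : 𝓢(R4, ℂ) := 𝓕⁻ Φ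
  have hX : 𝓕 X = Φ := fourier_fourierInv_eq Φ
  have e1 := integral_fourier_mul_coe H X
  -- The test function is Φ = 𝓕 X with X Schwartz, so that differentiating it multiplies X by -2πi
  -- ξ_j. By duality this factor moves to 𝓕 u.
  have hd : ∂_{unitVec j} Φ =
      𝓕 (-(2 * Real.pi * Complex.I) • smulLeftCLM ℂ (inner ℝ · (unitVec j)) X) := by
    rw [← hX, lineDerivOp_fourier_eq]
  have e2 := integral_fourier_mul_coe u
    (-(2 * Real.pi * Complex.I) • smulLeftCLM ℂ (inner ℝ · (unitVec j)) X)
  rw [← hd] at e2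
  rw [hX] at e1
  have hdx : ∀ x, (∂_{unitVec j} Φ) x = ((pderiv j φ x : ℝ) : ℂ) := fun x => by
    rw [SchwartzMap.lineDerivOp_apply_eq_fderiv]
    have := (Complex.ofRealCLM.hasFDerivAt.comp x
      (hφ.differentiable (by simp) x).hasFDerivAt).fderiv
    exact congrArg (fun L => L (unitVec j)) this
  have hg : (fun x : R4 => inner ℝ x (unitVec j)).HasTemperateGrowth := by fun_prop
  have e3 : ∫ x, (fderiv ℝ φ x (EuclideanSpace.single j (1 : ℝ))) • u x =
      ∫ x, (∂_{unitVec j} Φ) x * u x :=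
    integral_congr_ae (Eventually.of_forall fun x => by
      simp only [hdx, Complex.real_smul, pderiv])
  have e4 : ∫ x, φ x • H x = ∫ x, Φ x * H x :=
    integral_congr_ae (Eventually.of_forall fun x => by
      simp only [Φ, schwartzOfTest_apply, Complex.real_smul])
  rw [e3, e4, e1, e2, ← integral_neg]
  refine integral_congr_ae (h.mono fun ξ hξ => ?_)
  have e5 : inner ℝ ξ (unitVec j) = ξ j := by simp [unitVec, EuclideanSpace.inner_single_right]
  simp only [hξ, smul_apply, smulLeftCLM_apply_apply hg, e5, Complex.real_smul,
    smul_eq_mul]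
  ring

end Fourier

/-! ### Quadratic phases -/

/-- The function `exp(i (c |x|² + ⟨x, v⟩))`. -/
def quadPhase (c : ℝ) (v x : R4) : ℂ :=
  Complex.exp (((c * ‖x‖ ^ 2 + inner ℝ x v : ℝ) : ℂ) * Complex.I)

lemma norm_quadPhase (c : ℝ) (v x : R4) : ‖quadPhase c v x‖ = 1 :=
  Complex.norm_exp_ofReal_mul_I _

lemma contDiff_quadPhase (c : ℝ) (v : R4) : ContDiff ℝ (⊤ : ℕ∞) (quadPhase c v) := by
  have h : ContDiff ℝ (⊤ : ℕ∞) fun x : R4 => c * ‖x‖ ^ 2 + inner ℝ x v :=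
    (contDiff_const.mul (contDiff_norm_sq ℝ)).add (contDiff_id.inner ℝ contDiff_const)
  exact ((Complex.ofRealCLM.contDiff.comp h).mul contDiff_const).cexp

lemma pderiv_quadPhase (c : ℝ) (v : R4) (j : Fin 4) (x : R4) :
    pderiv j (quadPhase c v) x = ((2 * c * x j + v j : ℝ) : ℂ) * Complex.I * quadPhase c v x := by
  have h : HasFDerivAt (fun x : R4 => c * ‖x‖ ^ 2 + inner ℝ x v)
      (c • (2 • innerSL ℝ x) + (innerSL ℝ).flip v) x :=
    ((hasStrictFDerivAt_norm_sq x).hasFDerivAt.const_mul c).add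
      (((innerSL ℝ).flip v).hasFDerivAt)
  have h2 := (((Complex.ofRealCLM.hasFDerivAt.comp x h).mul_const Complex.I).cexp).fderiv
  refine (congrArg (fun L => L (unitVec j)) h2).trans ?_
  have e1 : inner ℝ x (unitVec j) = x j := by simp [unitVec, EuclideanSpace.inner_single_right]
  have e2 : inner ℝ (unitVec j) v = v j := by simp [unitVec, EuclideanSpace.inner_single_left]
  simp only [quadPhase, smul_apply, add_apply, ContinuousLinearMap.comp_apply,
    ContinuousLinearMap.flip_apply, innerSL_apply_apply, e1, e2, Complex.ofRealCLM_apply,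
    Function.comp_apply, smul_eq_mul, nsmul_eq_mul]
  push_cast
  ring

lemma pderiv_pderiv_quadPhase (c : ℝ) (v : R4) (j : Fin 4) (x : R4) :
    pderiv j (pderiv j (quadPhase c v)) x =
      (2 * c * Complex.I - ((2 * c * x j + v j : ℝ) : ℂ) ^ 2) * quadPhase c v x := by
  have e : pderiv j (quadPhase c v) =
      fun x => (((2 * c * x j + v j : ℝ) : ℂ) * Complex.I) * quadPhase c v x :=
    funext fun x => pderiv_quadPhase c v j x
  have hl : HasFDerivAt (fun x : R4 => ((2 * c * x j + v j : ℝ) : ℂ) * Complex.I)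
      (Complex.I • (Complex.ofRealCLM.comp ((2 * c) • EuclideanSpace.proj j))) x := by
    have h1 : HasFDerivAt (fun x : R4 => 2 * c * x j + v j)
        ((2 * c) • (EuclideanSpace.proj j : R4 →L[ℝ] ℝ)) x :=
      (((EuclideanSpace.proj j : R4 →L[ℝ] ℝ).hasFDerivAt).const_mul (2 * c)).add_const _
    have h2 := (Complex.ofRealCLM.hasFDerivAt.comp x h1).mul_const Complex.I
    exact h2
  have hd : pderiv j (fun x : R4 => ((2 * c * x j + v j : ℝ) : ℂ) * Complex.I) x =
      2 * c * Complex.I := by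
    refine (congrArg (fun L => L (unitVec j)) hl.fderiv).trans ?_
    simp
    ring
  rw [e, pderiv_mul hl.differentiableAt ((contDiff_quadPhase c v).differentiable (by simp) x), hd,
    pderiv_quadPhase]
  linear_combination ((2 * c * x j + v j : ℝ) : ℂ) ^ 2 * quadPhase c v x * Complex.I_sq

lemma norm_affine_le (c : ℝ) (v : R4) (j : Fin 4) (x : R4) :
    ‖((2 * c * x j + v j : ℝ) : ℂ)‖ ≤ (2 * |c| + ‖v‖) * (1 + ‖x‖) := by
  rw [Complex.norm_real]
  have h1 := PiLp.norm_apply_le x j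
  have h2 := PiLp.norm_apply_le v j
  rw [Real.norm_eq_abs] at h1 h2 ⊢
  have h3 : |2 * c * x j| = 2 * |c| * |x j| := by rw [abs_mul, abs_mul, abs_two]
  have h4 := abs_add_le (2 * c * x j) (v j)
  have h5 := mul_le_mul_of_nonneg_left h1 (by positivity : 0 ≤ 2 * |c|)
  nlinarith [norm_nonneg x, norm_nonneg v, abs_nonneg c, mul_nonneg (norm_nonneg v) (norm_nonneg x)]

/-- An identity for a weak divergence, tested against a smooth function that need not have compact
support. -/
lemma integral_sum_pderiv_mul_eq {G : Fin 4 → R4 → ℂ} {H : R4 → ℂ}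
    (h : ∀ φ : R4 → ℝ, ContDiff ℝ (⊤ : ℕ∞) φ → HasCompactSupport φ →
      ∑ j, ∫ x, pderiv j φ x • G j x = ∫ x, φ x • H x)
    (hG : ∀ j, LocallyIntegrable (G j)) (hH : LocallyIntegrable H) {g : R4 → ℂ}
    (hg : ContDiff ℝ (⊤ : ℕ∞) g) (i0 : ∀ j, Integrable fun x => g x * G j x)
    (i1 : ∀ j, Integrable fun x => pderiv j g x * G j x) (i2 : Integrable fun x => g x * H x) :
    ∑ j, ∫ x, pderiv j g x * G j x = ∫ x, g x * H x := by
  have hcx : ∀ φ : R4 → ℂ, ContDiff ℝ (⊤ : ℕ∞) φ → HasCompactSupport φ →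
      ∑ j, ∫ x, pderiv j φ x * G j x = ∫ x, φ x * H x := fun φ hφ hc => by
    have d : ∀ x, DifferentiableAt ℝ φ x := fun x => hφ.differentiable (by simp) x
    have k1 := h _ (Complex.reCLM.contDiff.comp hφ) (hc.comp_left (g := Complex.re) rfl)
    have k2 := h _ (Complex.imCLM.contDiff.comp hφ) (hc.comp_left (g := Complex.im) rfl)
    have e1 : ∀ j x, pderiv j (Complex.reCLM ∘ φ) x = (pderiv j φ x).re := fun j x =>
      pderiv_re (d x)
    have e2 : ∀ j x, pderiv j (Complex.imCLM ∘ φ) x = (pderiv j φ x).im := fun j x =>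
      pderiv_im (d x)
    simp only [e1] at k1
    simp only [e2] at k2
    rw [integral_mul_eq_re_add_im hφ.continuous hc hH]
    have e3 : ∀ j, ∫ x, pderiv j φ x * G j x = (∫ x, (pderiv j φ x).re • G j x) +
        Complex.I * ∫ x, (pderiv j φ x).im • G j x := fun j =>
      integral_mul_eq_re_add_im (contDiff_pderiv hφ).continuous (hasCompactSupport_pderiv hc) (hG j)
    simp only [e3, Finset.sum_add_distrib, ← Finset.mul_sum, k1, k2]
    rfl
  obtain ⟨C, hC0, χ, h1, h2, h3, h4, h5⟩ := exists_cutoff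
  have hgd : ∀ j, Continuous (pderiv j g) := fun j => (contDiff_pderiv hg).continuous
  have key : ∀ n, ∑ j, ∫ x, (χ n x • (pderiv j g x * G j x) + pderiv j (χ n) x • (g x * G j x)) =
      ∫ x, χ n x • (g x * H x) := fun n => by
    have := hcx (fun x => χ n x • g x) ((h1 n).smul hg) (h2 n).smul_right
    have e : ∀ j x, pderiv j (fun x => χ n x • g x) x =
        χ n x • pderiv j g x + pderiv j (χ n) x • g x :=
      fun j x => pderiv_smul ((h1 n).differentiable (by simp) x) (hg.differentiable (by simp) x)
    simpa only [e, add_mul, smul_mul_assoc] using this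
  have hχc : ∀ n, Continuous (χ n) := fun n => (h1 n).continuous
  have hχd : ∀ n j, Continuous (pderiv j (χ n)) := fun n j => (contDiff_pderiv (h1 n)).continuous
  have l1 : Tendsto (fun n => ∑ j, ∫ x, (χ n x • (pderiv j g x * G j x) +
      pderiv j (χ n) x • (g x * G j x))) atTop (𝓝 (∑ j, ∫ x, pderiv j g x * G j x)) := by
    refine tendsto_finsetSum _ fun j _ => ?_
    refine tendsto_integral_of_dominated_convergence
      (fun x => ‖pderiv j g x * G j x‖ + C * ‖g x * G j x‖) (fun n => ?_)
      ((i1 j).norm.add ((i0 j).norm.const_mul C)) (fun n => ?_) ?_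
    · exact ((hχc n).aestronglyMeasurable.smul (i1 j).1).add
        ((hχd n j).aestronglyMeasurable.smul (i0 j).1)
    · refine Eventually.of_forall fun x => (norm_add_le _ _).trans (add_le_add ?_ ?_)
      · rw [norm_smul]
        exact mul_le_of_le_one_left (norm_nonneg _) (h3 n x)
      · rw [norm_smul]
        refine mul_le_mul_of_nonneg_right ((h4 n j x).trans ?_) (norm_nonneg _)
        exact div_le_self hC0 (by linarith [(Nat.cast_nonneg n : (0 : ℝ) ≤ n)])
    · refine Eventually.of_forall fun x => tendsto_const_nhds.congr' ?_
      filter_upwards [h5 x] with n hn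
      simp [hn.1, hn.2 j]
  have l2 : Tendsto (fun n => ∫ x, χ n x • (g x * H x)) atTop (𝓝 (∫ x, g x * H x)) := by
    refine tendsto_integral_of_dominated_convergence (fun x => ‖g x * H x‖) (fun n => ?_) i2.norm
      (fun n => ?_) ?_
    · exact (hχc n).aestronglyMeasurable.smul i2.1
    · refine Eventually.of_forall fun x => ?_
      rw [norm_smul]
      exact mul_le_of_le_one_left (norm_nonneg _) (h3 n x)
    · refine Eventually.of_forall fun x => tendsto_const_nhds.congr' ?_
      filter_upwards [h5 x] with n hn
      simp [hn.1]
  exact tendsto_nhds_unique (l1.congr key) l2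

lemma memLp_testFunction {V : Type*} [NormedAddCommGroup V] {φ : R4 → V} (hφ : Continuous φ)
    (hc : HasCompactSupport φ) (p : ℝ≥0∞) : MemLp φ p :=
  hφ.memLp_of_hasCompactSupport hc

lemma hasWeakPartial_testFunction {φ : R4 → ℝ} (hφ : ContDiff ℝ (⊤ : ℕ∞) φ)
    (hc : HasCompactSupport φ) (j : Fin 4) : HasWeakPartial j φ (pderiv j φ) := by
  intro η hη hηc
  have hd : Continuous (pderiv j φ) := (contDiff_pderiv hφ).continuous
  have hd' : Continuous (pderiv j η) := (contDiff_pderiv hη).continuous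
  have h := integral_smul_fderiv_eq_neg_fderiv_smul_of_integrable (𝕜 := ℝ) (μ := volume)
    (f := η) (g := φ) (v := unitVec j)
    ((hd'.smul hφ.continuous).integrable_of_hasCompactSupport hc.smul_left)
    ((hη.continuous.smul hd).integrable_of_hasCompactSupport hηc.smul_right)
    ((hη.continuous.smul hφ.continuous).integrable_of_hasCompactSupport hηc.smul_right)
    (fun x _ => hη.differentiable (by simp) x) (fun x _ => hφ.differentiable (by simp) x)
  exact (neg_eq_iff_eq_neg.2 h).symm

lemma memH1_testFunction {φ : R4 → ℝ} (hφ : ContDiff ℝ (⊤ : ℕ∞) φ)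
    (hc : HasCompactSupport φ) : MemH1 φ :=
  ⟨memLp_testFunction hφ.continuous hc 2, fun j => ⟨pderiv j φ,
    memLp_testFunction (contDiff_pderiv hφ).continuous (hasCompactSupport_pderiv hc) 2,
    hasWeakPartial_testFunction hφ hc j⟩⟩

/-! ### The source term -/

section Source

variable {l : ℕ}

variable {α γ : Fin l → ℝ} {f : Fin l → (Fin l → ℂ) → ℂ} {F : (Fin l → ℂ) → ℂ}

lemma IsAdmissible.aestronglyMeasurable_source (hf : IsAdmissible α γ f F) {u : Fin l → R4 → ℂ}
    (h : ∀ m, AEStronglyMeasurable (u m) volume) (k : Fin l) :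
    AEStronglyMeasurable (fun x => f k fun m => u m x) volume :=
  (hf.continuous k).comp_aestronglyMeasurable
    (aemeasurable_pi_lambda _ fun m => (h m).aemeasurable).aestronglyMeasurable

lemma IsAdmissible.memLp_source (hf : IsAdmissible α γ f F) {u : Fin l → R4 → ℂ}
    (h : ∀ m, MemLp (u m) 4) (k : Fin l) : MemLp (fun x => f k fun m => u m x) 2 := by
  obtain ⟨C, hC, hb⟩ := hf.exists_norm_le
  have hv := (MemLp.of_eval h : MemLp (fun x m => u m x) _ _).norm
  have : ENNReal.HolderTriple 4 4 2 := ⟨by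
    rw [← two_mul, show (4 : ℝ≥0∞) = 2 * 2 by norm_num, ENNReal.mul_inv (by simp) (by simp),
      ← mul_assoc, ENNReal.mul_inv_cancel (by simp) (by simp), one_mul]⟩
  have hv2 : MemLp (fun x => ‖fun m => u m x‖ * ‖fun m => u m x‖) 2 := hv.mul hv
  refine hv2.of_le_mul (c := C) (hf.aestronglyMeasurable_source (fun m => (h m).1) k)
    (Eventually.of_forall fun x => (hb k _).trans_eq ?_)
  rw [norm_mul, norm_norm, sq]

lemma IsAdmissible.integrable_source (hf : IsAdmissible α γ f F) {u : Fin l → R4 → ℂ}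
    (h : ∀ m, MemLp (u m) 2) (k : Fin l) : Integrable (fun x => f k fun m => u m x) := by
  obtain ⟨C, hC, hb⟩ := hf.exists_norm_le
  have hv := (MemLp.of_eval h : MemLp (fun x m => u m x) _ _).norm
  have hv2 : Integrable (fun x => ‖fun m => u m x‖ * ‖fun m => u m x‖) := hv.integrable_mul hv
  refine (hv2.const_mul C).mono' (hf.aestronglyMeasurable_source (fun m => (h m).1) k)
    (Eventually.of_forall fun x => (hb k _).trans_eq ?_)
  rw [sq]

end Source

/-! ### The elliptic system -/

section Elliptic

variable {l : ℕ} {γ b : Fin l → ℝ} {f : Fin l → (Fin l → ℂ) → ℂ} {ψ : Fin l → R4 → ℝ}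

/-- The equation -γΔψ = f(ψ) - bψ as a complex distributional identity in divergence form, the shape
needed for `integral_sum_pderiv_mul_eq`. -/
lemma weak_form_testFunction (hψ : ψ ∈ nontrivialSolutions γ b f)
    (hs : ∀ k, Integrable fun x => f k fun m => (ψ m x : ℂ)) (k : Fin l) {φ : R4 → ℝ}
    (hφ : ContDiff ℝ (⊤ : ℕ∞) φ) (hc : HasCompactSupport φ) :
    ∑ j, ∫ x, pderiv j φ x • ((γ k : ℂ) * ((weakPartial j (ψ k) x : ℝ) : ℂ)) =
      ∫ x, φ x • ((f k fun m => (ψ m x : ℂ)) - (b k : ℂ) * (ψ k x : ℂ)) := by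
  have h := hψ.2.2 φ (memH1_testFunction hφ hc) k
  have hH := hψ.1 k
  have hL := fun j => locallyIntegrable_of_memLp_two (hH.memLp_weakPartial j)
  have e1 : (∫ x, ∑ j, weakPartial j (ψ k) x * weakPartial j φ x) =
      ∑ j, ∫ x, pderiv j φ x • weakPartial j (ψ k) x := by
    rw [← integral_finsetSum]
    · refine integral_congr_ae ?_
      have : ∀ j, weakPartial j φ =ᵐ[volume] pderiv j φ := fun j =>
        (hasWeakPartial_testFunction hφ hc j).weakPartial_ae_eq
          (memLp_testFunction (contDiff_pderiv hφ).continuous (hasCompactSupport_pderiv hc) 2)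
      filter_upwards [ae_all_iff.2 this] with x hx
      exact Finset.sum_congr rfl fun j _ => by rw [hx j, smul_eq_mul, mul_comm]
    · exact fun j _ => integrable_smul_of_hasCompactSupport (contDiff_pderiv hφ).continuous
        (hasCompactSupport_pderiv hc) (hL j)
  have i1 : Integrable fun x => φ x • (f k fun m => (ψ m x : ℂ)) :=
    integrable_smul_of_hasCompactSupport hφ.continuous hc (hs k).locallyIntegrable
  have i2 : Integrable fun x => ((φ x • ψ k x : ℝ) : ℂ) :=
    (integrable_smul_of_hasCompactSupport hφ.continuous hc
      (locallyIntegrable_of_memLp_two hH.1)).ofReal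
  have e2 : ∫ x, φ x • ((f k fun m => (ψ m x : ℂ)) - (b k : ℂ) * (ψ k x : ℂ)) =
      (∫ x, (f k fun m => (ψ m x : ℂ)) * (φ x : ℂ)) - b k * ((∫ x, ψ k x * φ x : ℝ) : ℂ) := by
    rw [← integral_complex_ofReal, ← integral_const_mul, ← integral_sub]
    · refine integral_congr_ae (Eventually.of_forall fun x => ?_)
      simp only [Complex.real_smul]
      push_cast
      ring
    · simpa only [Complex.real_smul, mul_comm] using i1
    · refine Integrable.const_mul ?_ _
      simpa only [smul_eq_mul, mul_comm] using i2
  have e3 : ∀ j, ∫ x, pderiv j φ x • ((γ k : ℂ) * ((weakPartial j (ψ k) x : ℝ) : ℂ)) =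
      γ k * ((∫ x, pderiv j φ x • weakPartial j (ψ k) x : ℝ) : ℂ) := fun j => by
    rw [← integral_complex_ofReal, ← integral_const_mul]
    refine integral_congr_ae (Eventually.of_forall fun x => ?_)
    simp only [Complex.real_smul, smul_eq_mul]
    push_cast
    ring
  rw [e2, ← h, e1]
  simp only [e3]
  push_cast
  rw [Finset.mul_sum]
  ring

variable {α : Fin l → ℝ} {F : (Fin l → ℂ) → ℂ}

lemma norm_pderiv_quadPhase_le (c : ℝ) (v : R4) (j : Fin 4) (x : R4) :
    ‖pderiv j (quadPhase c v) x‖ ≤ (2 * |c| + ‖v‖) * (1 + ‖x‖) ^ 1 := by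
  rw [pderiv_quadPhase, norm_mul, norm_mul, norm_quadPhase, Complex.norm_I, mul_one, mul_one, pow_one]
  exact norm_affine_le c v j x

lemma norm_pderiv_pderiv_quadPhase_le (c : ℝ) (v : R4) (j : Fin 4) (x : R4) :
    ‖pderiv j (pderiv j (quadPhase c v)) x‖ ≤
      (2 * |c| + (2 * |c| + ‖v‖) ^ 2) * (1 + ‖x‖) ^ 2 := by
  rw [pderiv_pderiv_quadPhase, norm_mul, norm_quadPhase, mul_one]
  refine (norm_sub_le _ _).trans ?_
  have h1 : ‖2 * (c : ℂ) * Complex.I‖ = 2 * |c| := by simp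
  have h2 := pow_le_pow_left₀ (norm_nonneg _) (norm_affine_le c v j x) 2
  rw [norm_pow, h1]
  rw [mul_pow] at h2
  have h3 : 1 ≤ (1 + ‖x‖) ^ 2 := one_le_pow₀ (by linarith [norm_nonneg x])
  nlinarith [abs_nonneg c]

lemma integrable_source_of_mem (hf : IsAdmissible α γ f F) (hψ : ψ ∈ nontrivialSolutions γ b f)
    (k : Fin l) : Integrable fun x => f k fun m => (ψ m x : ℂ) :=
  hf.integrable_source (fun m => (hψ.1 m).1.ofReal) k

lemma memLp_four_of_mem (hψ : ψ ∈ nontrivialSolutions γ b f)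
    (k : Fin l) : MemLp (fun x => (ψ k x : ℂ)) 4 := by
  obtain ⟨C, hC, h⟩ := exists_sobolev_real
  exact (h (ψ k) (fun j => weakPartial j (ψ k)) (hψ.1 k).1 (hψ.1 k).memLp_weakPartial
    (hψ.1 k).hasWeakPartial).1.ofReal

lemma memLp_source_of_mem (hf : IsAdmissible α γ f F) (hψ : ψ ∈ nontrivialSolutions γ b f)
    (k : Fin l) : MemLp (fun x => f k fun m => (ψ m x : ℂ)) 2 :=
  hf.memLp_source (fun m => memLp_four_of_mem hψ m) k

lemma hasWeakPartial_ofReal_of_mem (hψ : ψ ∈ nontrivialSolutions γ b f)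
    (k : Fin l) (j : Fin 4) :
    HasWeakPartial j (fun x => (ψ k x : ℂ)) (fun x => ((weakPartial j (ψ k) x : ℝ) : ℂ)) :=
  ((hψ.1 k).hasWeakPartial j).ofReal (locallyIntegrable_of_memLp_two (hψ.1 k).1)
    (locallyIntegrable_of_memLp_two ((hψ.1 k).memLp_weakPartial j))

/-- The elliptic equation is tested against g = `quadPhase c v`, which is allowed because
exponential decay of ψ and ∇ψ beats the polynomial growth of the derivatives of g. A second
integration by parts puts the whole Laplacian on g, and -Δg = (∑ (2c x_j + v_j)² - 8ic) g, where 8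
is twice the dimension. The case c = 0 is the equation on the Fourier side; the lens transform needs
c ≠ 0. -/
lemma integral_quadPhase_mul (hf : IsAdmissible α γ f F) (hγ : ∀ k, 0 < γ k) (hb : ∀ k, 0 < b k) (hψ : ψ ∈ nontrivialSolutions γ b f)
    (k : Fin l) (c : ℝ) (v : R4) :
    ∫ x, (((γ k * (∑ j, (2 * c * x j + v j) ^ 2) + b k : ℝ) : ℂ) - 8 * γ k * c * Complex.I) *
      (quadPhase c v x * (ψ k x : ℂ)) = ∫ x, quadPhase c v x * f k fun m => (ψ m x : ℂ) := by
  obtain ⟨hE, hEj⟩ := hasExpDecay_of_mem_nontrivialSolutions hγ hb hf.exists_norm_le hψ k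
  have hg := contDiff_quadPhase c v
  have hs := integrable_source_of_mem hf hψ
  have hsmul : ∀ {h : R4 → ℂ}, Integrable h → Integrable fun x => quadPhase c v x * h x :=
    fun hh => hh.bdd_mul (c := 1) hg.continuous.aestronglyMeasurable
      (Eventually.of_forall fun x => (norm_quadPhase c v x).le)
  have hb0 : ∀ x, ‖quadPhase c v x‖ ≤ 1 * (1 + ‖x‖) ^ 0 := fun x => by simp [norm_quadPhase]
  have i0 : Integrable fun x => quadPhase c v x * (ψ k x : ℂ) :=
    (hE.ofReal.mul hg.continuous hb0).1
  have i1 : ∀ j, Integrable fun x => pderiv j (quadPhase c v) x * (ψ k x : ℂ) := fun j =>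
    (hE.ofReal.mul (contDiff_pderiv hg).continuous (norm_pderiv_quadPhase_le c v j)).1
  have i2 : ∀ j, Integrable fun x => pderiv j (pderiv j (quadPhase c v)) x * (ψ k x : ℂ) :=
    fun j => (hE.ofReal.mul (contDiff_pderiv (contDiff_pderiv hg)).continuous
      (norm_pderiv_pderiv_quadPhase_le c v j)).1
  have j0 : ∀ j, Integrable fun x => quadPhase c v x * ((weakPartial j (ψ k) x : ℝ) : ℂ) :=
    fun j => ((hEj j).ofReal.mul hg.continuous hb0).1
  have j1 : ∀ j, Integrable fun x =>
      pderiv j (quadPhase c v) x * ((weakPartial j (ψ k) x : ℝ) : ℂ) := fun j =>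
    ((hEj j).ofReal.mul (contDiff_pderiv hg).continuous (norm_pderiv_quadPhase_le c v j)).1
  have hu : LocallyIntegrable fun x => (ψ k x : ℂ) :=
    locallyIntegrable_of_memLp_two (hψ.1 k).1.ofReal
  have hG : ∀ j, LocallyIntegrable fun x => ((weakPartial j (ψ k) x : ℝ) : ℂ) := fun j =>
    locallyIntegrable_of_memLp_two ((hψ.1 k).memLp_weakPartial j).ofReal
  have k1 := integral_sum_pderiv_mul_eq
    (fun φ hφ hc => weak_form_testFunction hψ hs k hφ hc)
    (fun j => locallyIntegrable_of_memLp_two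
      (((hψ.1 k).memLp_weakPartial j).ofReal.const_mul (γ k : ℂ)))
    ((hs k).locallyIntegrable.sub (locallyIntegrable_of_memLp_two
      ((hψ.1 k).1.ofReal.const_mul (b k : ℂ)))) hg
    (fun j => by simpa only [mul_left_comm] using (j0 j).const_mul (γ k : ℂ))
    (fun j => by simpa only [mul_left_comm] using (j1 j).const_mul (γ k : ℂ))
    (by
      refine ((hsmul (hs k)).sub (i0.const_mul (b k : ℂ))).congr (Eventually.of_forall fun x => ?_)
      simp only [Pi.sub_apply]
      ring)
  have k2 : ∀ j, ∫ x, pderiv j (pderiv j (quadPhase c v)) x * (ψ k x : ℂ) =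
      -∫ x, pderiv j (quadPhase c v) x * ((weakPartial j (ψ k) x : ℝ) : ℂ) := fun j =>
    (hasWeakPartial_ofReal_of_mem hψ k j).integral_eq hu (hG j) (contDiff_pderiv hg)
      (i1 j) (i2 j) (j1 j)
  have k3 : ∫ x, quadPhase c v x * ((f k fun m => (ψ m x : ℂ)) - (b k : ℂ) * (ψ k x : ℂ)) =
      (∫ x, quadPhase c v x * f k fun m => (ψ m x : ℂ)) -
        b k * ∫ x, quadPhase c v x * (ψ k x : ℂ) := by
    rw [← integral_const_mul, ← integral_sub (hsmul (hs k)) (i0.const_mul _)]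
    exact integral_congr_ae (Eventually.of_forall fun x => by ring)
  have k4 : ∀ j, ∫ x, pderiv j (quadPhase c v) x * ((γ k : ℂ) * ((weakPartial j (ψ k) x : ℝ) : ℂ)) =
      -∫ x, (γ k : ℂ) * (pderiv j (pderiv j (quadPhase c v)) x * (ψ k x : ℂ)) := fun j => by
    rw [integral_const_mul, k2, mul_neg, neg_neg, ← integral_const_mul]
    exact integral_congr_ae (Eventually.of_forall fun x => by ring)
  rw [k3] at k1
  simp only [k4] at k1
  rw [← add_eq_of_eq_sub k1, Finset.sum_neg_distrib, add_comm,
    ← integral_finsetSum _ fun j _ => (i2 j).const_mul (γ k : ℂ), ← integral_const_mul,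
    ← sub_eq_add_neg, ← integral_sub (i0.const_mul _)
      (integrable_finsetSum _ fun j _ => (i2 j).const_mul (γ k : ℂ))]
  refine integral_congr_ae (Eventually.of_forall fun x => ?_)
  simp only [pderiv_pderiv_quadPhase, Fin.sum_univ_four]
  push_cast
  ring

open FourierTransform

lemma fourier_eq_integral_quadPhase (g : R4 → ℂ) (ξ : R4) :
    𝓕 g ξ = ∫ x, quadPhase 0 (-(2 * Real.pi) • ξ) x * g x := by
  rw [Real.fourier_eq']
  refine integral_congr_ae (Eventually.of_forall fun x => ?_)
  simp only [quadPhase, smul_eq_mul, inner_smul_right, zero_mul, zero_add]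
  push_cast
  ring_nf

lemma fourier_source_of_mem (hf : IsAdmissible α γ f F) (hγ : ∀ k, 0 < γ k) (hb : ∀ k, 0 < b k)
    (hψ : ψ ∈ nontrivialSolutions γ b f) (k : Fin l) (ξ : R4) :
    𝓕 (fun x => f k fun m => (ψ m x : ℂ)) ξ =
      ((γ k * (2 * Real.pi * ‖ξ‖) ^ 2 + b k : ℝ) : ℂ) * 𝓕 (fun x => (ψ k x : ℂ)) ξ := by
  rw [fourier_eq_integral_quadPhase, ← integral_quadPhase_mul hf hγ hb hψ,
    fourier_eq_integral_quadPhase, ← integral_const_mul]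
  refine integral_congr_ae (Eventually.of_forall fun x => ?_)
  simp only [mul_zero, zero_mul, zero_add, Complex.ofReal_zero, sub_zero]
  congr 2
  rw [mul_pow, EuclideanSpace.norm_sq_eq]
  simp only [Fin.sum_univ_four, Real.norm_eq_abs, sq_abs, PiLp.smul_apply, smul_eq_mul]
  ring

lemma fourier_weakPartial_of_mem (hf : IsAdmissible α γ f F) (hγ : ∀ k, 0 < γ k)
    (hb : ∀ k, 0 < b k) (hψ : ψ ∈ nontrivialSolutions γ b f) (k : Fin l) (j : Fin 4) (ξ : R4) :
    𝓕 (fun x => ((weakPartial j (ψ k) x : ℝ) : ℂ)) ξ =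
      (2 * Real.pi * Complex.I) * ξ j * 𝓕 (fun x => (ψ k x : ℂ)) ξ := by
  obtain ⟨hE, hEj⟩ := hasExpDecay_of_mem_nontrivialSolutions hγ hb hf.exists_norm_le hψ k
  set v := -(2 * Real.pi) • ξ
  have hg := contDiff_quadPhase 0 v
  have hb0 : ∀ x, ‖quadPhase 0 v x‖ ≤ 1 * (1 + ‖x‖) ^ 0 := fun x => by simp [norm_quadPhase]
  have h := (hasWeakPartial_ofReal_of_mem hψ k j).integral_eq
    (locallyIntegrable_of_memLp_two (hψ.1 k).1.ofReal)
    (locallyIntegrable_of_memLp_two ((hψ.1 k).memLp_weakPartial j).ofReal) hg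
    (hE.ofReal.mul hg.continuous hb0).1
    (hE.ofReal.mul (contDiff_pderiv hg).continuous (norm_pderiv_quadPhase_le 0 v j)).1
    ((hEj j).ofReal.mul hg.continuous hb0).1
  rw [fourier_eq_integral_quadPhase, fourier_eq_integral_quadPhase, ← integral_const_mul,
    neg_eq_iff_eq_neg.1 h.symm, ← integral_neg]
  refine integral_congr_ae (Eventually.of_forall fun x => ?_)
  simp only [pderiv_quadPhase, v, PiLp.smul_apply, smul_eq_mul]
  push_cast
  ring

lemma integrable_of_mem (hf : IsAdmissible α γ f F) (hγ : ∀ k, 0 < γ k)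
    (hb : ∀ k, 0 < b k) (hψ : ψ ∈ nontrivialSolutions γ b f) (k : Fin l) :
    Integrable fun x => (ψ k x : ℂ) := by
  have := ((hasExpDecay_of_mem_nontrivialSolutions hγ hb hf.exists_norm_le hψ k).1.ofReal.mul
    (a := 1) (C := 1) (m := 0) continuous_one fun x => by simp).1
  simpa using this

lemma integrable_weakPartial_of_mem (hf : IsAdmissible α γ f F) (hγ : ∀ k, 0 < γ k)
    (hb : ∀ k, 0 < b k) (hψ : ψ ∈ nontrivialSolutions γ b f) (k : Fin l) (j : Fin 4) :
    Integrable fun x => ((weakPartial j (ψ k) x : ℝ) : ℂ) := by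
  have := (((hasExpDecay_of_mem_nontrivialSolutions hγ hb hf.exists_norm_le hψ k).2 j).ofReal.mul
    (a := 1) (C := 1) (m := 0) continuous_one fun x => by simp).1
  simpa using this

/-- The gradient of a weak solution belongs to `L⁴`. -/
lemma memLp_four_weakPartial_of_mem (hf : IsAdmissible α γ f F) (hγ : ∀ k, 0 < γ k)
    (hb : ∀ k, 0 < b k) (hψ : ψ ∈ nontrivialSolutions γ b f) (k : Fin l) (i : Fin 4) :
    MemLp (fun x => ((weakPartial i (ψ k) x : ℝ) : ℂ)) 4 := by
  set G : R4 → ℂ := fun x => ((weakPartial i (ψ k) x : ℝ) : ℂ)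
  have hG2 : MemLp G 2 := ((hψ.1 k).memLp_weakPartial i).ofReal
  have hG1 : Integrable G := integrable_weakPartial_of_mem hf hγ hb hψ k i
  have hs1 := integrable_source_of_mem hf hψ k
  have hs2 := memLp_source_of_mem hf hψ k
  set s : R4 → ℂ := fun x => f k fun m => (ψ m x : ℂ)
  have hFs : MemLp (𝓕 s) 2 := (memLp_congr_ae (coeFn_fourier_toLp hs1 hs2)).1 (Lp.memLp (𝓕 (hs2.toLp s)))
  have hcont : ∀ {g : R4 → ℂ}, Integrable g → Continuous (𝓕 g) := fun hg =>
    VectorFourier.fourierIntegral_continuous Real.continuous_fourierChar continuous_inner hg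
  -- Up to the constant 1/γ, |2πξ_j · 2πξ_i · 𝓕ψ| is at most (γ|2πξ|² + b)|𝓕ψ| = |𝓕 s|, which is
  -- square integrable. Thus the second derivatives of ψ lie in L², and the Sobolev inequality
  -- applies to the gradient.
  have hH : ∀ j : Fin 4, MemLp (fun ξ : R4 => (2 * Real.pi * Complex.I) * ξ j * 𝓕 G ξ) 2 := by
    intro j
    refine hFs.of_le_mul (c := (γ k)⁻¹) ?_ (Eventually.of_forall fun ξ => ?_)
    · refine Continuous.aestronglyMeasurable ?_
      have : Continuous (𝓕 G) := hcont hG1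
      fun_prop
    · rw [fourier_source_of_mem hf hγ hb hψ k ξ, fourier_weakPartial_of_mem hf hγ hb hψ k i ξ]
      have h1 := PiLp.norm_apply_le ξ j
      have h2 := PiLp.norm_apply_le ξ i
      have h3 : 0 < γ k * (2 * Real.pi * ‖ξ‖) ^ 2 + b k := by
        have := hb k; have := hγ k; positivity
      simp only [norm_mul, Complex.norm_real, Complex.norm_I, mul_one, Complex.norm_ofNat,
        Real.norm_of_nonneg Real.pi_pos.le, Real.norm_of_nonneg h3.le]
      have h4 : 2 * Real.pi * ‖ξ j‖ * (2 * Real.pi * ‖ξ i‖) ≤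
          (γ k)⁻¹ * (γ k * (2 * Real.pi * ‖ξ‖) ^ 2 + b k) := by
        rw [← mul_le_mul_iff_right₀ (hγ k), mul_inv_cancel_left₀ (hγ k).ne']
        calc γ k * (2 * Real.pi * ‖ξ j‖ * (2 * Real.pi * ‖ξ i‖)) ≤
            γ k * (2 * Real.pi * ‖ξ‖ * (2 * Real.pi * ‖ξ‖)) := by
              have := (hγ k).le
              have := Real.pi_pos.le
              gcongr
          _ ≤ _ := by nlinarith [hb k]
      simpa only [mul_assoc] using
        mul_le_mul_of_nonneg_right h4 (norm_nonneg (𝓕 (fun x => (ψ k x : ℂ)) ξ))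
  have hw : ∀ j, ∃ H : R4 → ℂ, MemLp H 2 ∧ HasWeakPartial j G H := fun j => by
    refine ⟨(𝓕⁻ ((hH j).toLp _) : Lp ℂ 2 (volume : Measure R4)),
      Lp.memLp _, ?_⟩
    refine (hasWeakPartial_of_fourier (u := hG2.toLp G) ?_).congr hG2.coeFn_toLp (ae_eq_refl _)
    rw [FourierTransform.fourier_fourierInv_eq]
    filter_upwards [(hH j).coeFn_toLp, coeFn_fourier_toLp hG1 hG2] with ξ h1 h2
    rw [h1, h2]
  choose H hH2 hHw using hw
  obtain ⟨C, hC, h⟩ := exists_sobolev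
  refine ⟨hG2.1, (h G H hG2 hH2 hHw).trans_lt ?_⟩
  exact ENNReal.mul_lt_top hC.lt_top (ENNReal.sum_lt_top.2 fun j _ => (hH2 j).2)

lemma contDiff_coord (i : Fin 4) : ContDiff ℝ (⊤ : ℕ∞) fun x : R4 => (x i : ℂ) :=
  Complex.ofRealCLM.contDiff.comp (EuclideanSpace.proj i : R4 →L[ℝ] ℝ).contDiff

lemma pderiv_coord (i j : Fin 4) (x : R4) :
    pderiv j (fun x : R4 => (x i : ℂ)) x = if i = j then 1 else 0 := by
  have h : HasFDerivAt (fun x : R4 => (x i : ℂ))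
      (Complex.ofRealCLM.comp (EuclideanSpace.proj i : R4 →L[ℝ] ℝ)) x :=
    (Complex.ofRealCLM.comp (EuclideanSpace.proj i : R4 →L[ℝ] ℝ)).hasFDerivAt
  refine (congrArg (fun L => L (unitVec j)) h.fderiv).trans ?_
  simp [unitVec, apply_ite]

lemma norm_coord_le (i : Fin 4) (x : R4) : ‖(x i : ℂ)‖ ≤ 1 * (1 + ‖x‖) ^ 1 := by
  have := PiLp.norm_apply_le x i
  rw [Complex.norm_real]
  linarith

lemma memLp_two_coord_mul_of_mem (hf : IsAdmissible α γ f F) (hγ : ∀ k, 0 < γ k)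
    (hb : ∀ k, 0 < b k) (hψ : ψ ∈ nontrivialSolutions γ b f) (k : Fin l) (i : Fin 4) :
    MemLp (fun x => (x i : ℂ) * (ψ k x : ℂ)) 2 :=
  ((hasExpDecay_of_mem_nontrivialSolutions hγ hb hf.exists_norm_le hψ k).1.ofReal.mul
    (contDiff_coord i).continuous (norm_coord_le i)).2

/-- The moments `x_j ψ` of a weak solution belong to `L⁴`. -/
lemma memLp_four_coord_mul_of_mem (hf : IsAdmissible α γ f F) (hγ : ∀ k, 0 < γ k)
    (hb : ∀ k, 0 < b k) (hψ : ψ ∈ nontrivialSolutions γ b f) (k : Fin l) (i : Fin 4) :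
    MemLp (fun x => (x i : ℂ) * (ψ k x : ℂ)) 4 := by
  obtain ⟨hE, hEj⟩ := hasExpDecay_of_mem_nontrivialSolutions hγ hb hf.exists_norm_le hψ k
  have h2 := memLp_two_coord_mul_of_mem hf hγ hb hψ k i
  obtain ⟨C, hC, h⟩ := exists_sobolev
  have hw := fun j => (hasWeakPartial_ofReal_of_mem hψ k j).mul
    (locallyIntegrable_of_memLp_two (hψ.1 k).1.ofReal)
    (locallyIntegrable_of_memLp_two ((hψ.1 k).memLp_weakPartial j).ofReal) (contDiff_coord i)
  have hm : ∀ j, MemLp (fun x => (x i : ℂ) * ((weakPartial j (ψ k) x : ℝ) : ℂ) +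
      pderiv j (fun x : R4 => (x i : ℂ)) x * (ψ k x : ℂ)) 2 := fun j => by
    refine ((hEj j).ofReal.mul (contDiff_coord i).continuous (norm_coord_le i)).2.add ?_
    simp only [pderiv_coord]
    exact (hψ.1 k).1.ofReal.const_mul _
  refine ⟨h2.1, (h _ _ h2 hm hw).trans_lt ?_⟩
  exact ENNReal.mul_lt_top hC.lt_top (ENNReal.sum_lt_top.2 fun j _ => (hm j).2)

end Elliptic

/-- The Hilbert space `L²(ℝ⁴; ℂ)`. -/
abbrev L2 : Type := Lp ℂ 2 (volume : Measure R4)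

/-! ### Classes of square integrable functions -/

section ToL2

lemma toL2_eq {u : R4 → ℂ} (h : MemLp u 2) : toL2 u = h.toLp u := by
  rw [toL2, dif_pos h]

lemma coeFn_toL2 {u : R4 → ℂ} (h : MemLp u 2) : toL2 u =ᵐ[volume] u := by
  rw [toL2_eq h]
  exact h.coeFn_toLp

lemma toL2_congr {u v : R4 → ℂ} (h : u =ᵐ[volume] v) : toL2 u = toL2 v := by
  by_cases hu : MemLp u 2
  · rw [toL2_eq hu, toL2_eq ((memLp_congr_ae h).1 hu)]
    exact MemLp.toLp_congr _ _ h
  · rw [toL2, toL2, dif_neg hu, dif_neg fun hv => hu ((memLp_congr_ae h).2 hv)]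

lemma toL2_coeFn (g : L2) : toL2 g = g := by
  rw [toL2_eq (Lp.memLp g), Lp.toLp_coeFn]

lemma toL2_add {u v : R4 → ℂ} (hu : MemLp u 2) (hv : MemLp v 2) :
    toL2 (fun x => u x + v x) = toL2 u + toL2 v := by
  rw [toL2_eq hu, toL2_eq hv, ← MemLp.toLp_add]
  exact toL2_eq (hu.add hv)

lemma toL2_sub {u v : R4 → ℂ} (hu : MemLp u 2) (hv : MemLp v 2) :
    toL2 (fun x => u x - v x) = toL2 u - toL2 v := by
  rw [toL2_eq hu, toL2_eq hv, ← MemLp.toLp_sub]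
  exact toL2_eq (hu.sub hv)

lemma toL2_const_mul {u : R4 → ℂ} (hu : MemLp u 2) (c : ℂ) :
    toL2 (fun x => c * u x) = c • toL2 u := by
  rw [toL2_eq hu, ← MemLp.toLp_const_smul]
  exact toL2_eq (hu.const_mul c)

lemma ae_eq_of_toL2_eq {u v : R4 → ℂ} (hu : MemLp u 2) (hv : MemLp v 2) (h : toL2 u = toL2 v) :
    u =ᵐ[volume] v := by
  have := coeFn_toL2 hu
  rw [h] at this
  exact this.symm.trans (coeFn_toL2 hv)

lemma enorm_toL2 {u : R4 → ℂ} (hu : MemLp u 2) : ‖toL2 u‖ₑ = eLpNorm u 2 := by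
  rw [toL2_eq hu, Lp.enorm_toLp]

lemma norm_toL2_sq {u : R4 → ℂ} (hu : MemLp u 2) : ‖toL2 u‖ ^ 2 = ∫ x, ‖u x‖ ^ 2 := by
  have h0 : 0 ≤ ∫ x, ‖u x‖ ^ 2 := integral_nonneg fun x => by positivity
  rw [toL2_eq hu, Lp.norm_toLp, hu.eLpNorm_eq_integral_rpow_norm (by norm_num) (by norm_num),
    ENNReal.toReal_ofReal (Real.rpow_nonneg (integral_nonneg fun x => by positivity) _)]
  simp only [ENNReal.toReal_ofNat, Real.rpow_ofNat]
  rw [← Real.rpow_natCast, ← Real.rpow_mul h0]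
  norm_num

/-- Dominated convergence in `L²`. -/
lemma tendsto_toL2_of_dominated {ι : Type*} {L : Filter ι} [L.IsCountablyGenerated]
    {u : ι → R4 → ℂ} {v : R4 → ℂ} {B : R4 → ℝ} (hB : MemLp B 2) (hu : ∀ᶠ i in L, MemLp (u i) 2)
    (hv : MemLp v 2) (hb : ∀ᶠ i in L, ∀ᵐ x, ‖u i x‖ ≤ B x) (hvb : ∀ᵐ x, ‖v x‖ ≤ B x)
    (hlim : ∀ᵐ x, Tendsto (fun i => u i x) L (𝓝 (v x))) :
    Tendsto (fun i => toL2 (u i)) L (𝓝 (toL2 v)) := by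
  have h : Tendsto (fun i => ∫ x, ‖u i x - v x‖ ^ 2) L (𝓝 (∫ _ : R4, (0 : ℝ))) := by
    refine tendsto_integral_filter_of_dominated_convergence (fun x => (2 * B x) ^ 2) ?_ ?_ ?_ ?_
    · exact hu.mono fun i hi => ((hi.1.sub hv.1).norm.pow 2)
    · filter_upwards [hb] with i hi
      filter_upwards [hi, hvb] with x h1 h2
      rw [norm_pow, norm_norm]
      refine pow_le_pow_left₀ (norm_nonneg _) ((norm_sub_le _ _).trans ?_) 2
      linarith
    · exact (hB.const_mul 2).integrable_sq
    · filter_upwards [hlim] with x hx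
      simpa using ((hx.sub_const (v x)).norm.pow 2)
  rw [integral_zero] at h
  rw [tendsto_iff_norm_sub_tendsto_zero]
  have h2 := h.sqrt
  rw [Real.sqrt_zero] at h2
  refine h2.congr' (hu.mono fun i hi => ?_)
  change Real.sqrt (∫ x, ‖(u i - v) x‖ ^ 2) = _
  rw [← norm_toL2_sq (hi.sub hv), Real.sqrt_sq (norm_nonneg _)]
  exact congrArg _ (toL2_sub hi hv)

end ToL2

/-! ### The Schrödinger group -/

section Propagator

open FourierTransform

variable (a c b : ℝ)

lemma norm_schrodingerSymbol (t : ℝ) (ξ : R4) : ‖schrodingerSymbol a c b t ξ‖ = 1 :=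
  Complex.norm_exp_ofReal_mul_I _

lemma schrodingerSymbol_add (s t : ℝ) (ξ : R4) :
    schrodingerSymbol a c b (s + t) ξ = schrodingerSymbol a c b s ξ * schrodingerSymbol a c b t ξ := by
  rw [schrodingerSymbol, schrodingerSymbol, schrodingerSymbol, ← Complex.exp_add]
  congr 1
  push_cast
  ring

lemma schrodingerSymbol_zero (ξ : R4) : schrodingerSymbol a c b 0 ξ = 1 := by
  simp [schrodingerSymbol]

lemma continuous_schrodingerSymbol_time (ξ : R4) :
    Continuous fun t => schrodingerSymbol a c b t ξ := by
  unfold schrodingerSymbol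
  fun_prop

lemma fourier_propagator (t : ℝ) (g : L2) :
    (𝓕 (propagator a c b t g) : L2) =ᵐ[volume]
      fun ξ => schrodingerSymbol a c b t ξ * (𝓕 g : L2) ξ := by
  rw [propagator, fourier_fourierInv_eq]
  filter_upwards [Lp.coeFn_lpSMul (r := 2) ((memLp_schrodingerSymbol a c b t).toLp _) (𝓕 g : L2),
    (memLp_schrodingerSymbol a c b t).coeFn_toLp] with ξ h1 h2
  rw [h1, Pi.smul_apply', h2, smul_eq_mul]

lemma fourier_injective {g h : L2} (e : (𝓕 g : L2) =ᵐ[volume] (𝓕 h : L2)) : g = h :=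
  (Lp.fourierTransformₗᵢ R4 ℂ).injective (Lp.ext e)

lemma norm_propagator (t : ℝ) (g : L2) : ‖propagator a c b t g‖ = ‖g‖ := by
  rw [← Lp.norm_fourier_eq, ← Lp.norm_fourier_eq g, Lp.norm_def, Lp.norm_def]
  congr 1
  refine eLpNorm_congr_norm_ae ?_
  filter_upwards [fourier_propagator a c b t g] with ξ h
  rw [h, norm_mul, norm_schrodingerSymbol, one_mul]

/-- The Schrödinger group as a linear isometry. -/
def propagatorLI (t : ℝ) : L2 →ₗᵢ[ℂ] L2 where
  toFun := propagator a c b t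
  map_add' g h := by
    refine fourier_injective ?_
    rw [FourierTransform.fourier_add]
    filter_upwards [fourier_propagator a c b t g, fourier_propagator a c b t h,
      fourier_propagator a c b t (g + h), Lp.coeFn_add (𝓕 (propagator a c b t g) : L2)
        (𝓕 (propagator a c b t h)), Lp.coeFn_add (𝓕 g : L2) (𝓕 h)] with ξ h1 h2 h3 h4 h5
    rw [h3, h4, Pi.add_apply, h1, h2, FourierTransform.fourier_add, h5, Pi.add_apply, mul_add]
  map_smul' z g := by
    refine fourier_injective ?_
    rw [RingHom.id_apply, FourierTransform.fourier_smul]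
    filter_upwards [fourier_propagator a c b t g, fourier_propagator a c b t (z • g),
      Lp.coeFn_smul z (𝓕 (propagator a c b t g) : L2), Lp.coeFn_smul z (𝓕 g : L2)]
      with ξ h1 h2 h3 h4
    rw [h2, h3, Pi.smul_apply, h1, FourierTransform.fourier_smul, h4, Pi.smul_apply, smul_eq_mul,
      smul_eq_mul, mul_left_comm]
  norm_map' := norm_propagator a c b t

lemma propagatorLI_apply (t : ℝ) (g : L2) : propagatorLI a c b t g = propagator a c b t g := rfl

lemma propagator_zero (g : L2) : propagator a c b 0 g = g := by
  refine fourier_injective ?_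
  filter_upwards [fourier_propagator a c b 0 g] with ξ h
  rw [h, schrodingerSymbol_zero, one_mul]

lemma propagator_propagator (s t : ℝ) (g : L2) :
    propagator a c b s (propagator a c b t g) = propagator a c b (s + t) g := by
  refine fourier_injective ?_
  filter_upwards [fourier_propagator a c b s (propagator a c b t g), fourier_propagator a c b t g,
    fourier_propagator a c b (s + t) g] with ξ h1 h2 h3
  rw [h1, h2, h3, schrodingerSymbol_add, mul_assoc]

/-- The symbols have modulus one and are continuous in t, so that dominated convergence on the
Fourier side gives strong continuity. -/
lemma continuous_propagator (g : L2) : Continuous fun t => propagator a c b t g := by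
  have h : ∀ t, MemLp (fun ξ => schrodingerSymbol a c b t ξ * (𝓕 g : L2) ξ) 2 := fun t =>
    (memLp_congr_ae (fourier_propagator a c b t g)).1 (Lp.memLp _)
  have e : ∀ t, (𝓕 (propagator a c b t g) : L2) =
      toL2 (fun ξ => schrodingerSymbol a c b t ξ * (𝓕 g : L2) ξ) := fun t => by
    rw [← toL2_congr (fourier_propagator a c b t g), toL2_coeFn]
  have hb : ∀ t ξ, ‖schrodingerSymbol a c b t ξ * (𝓕 g : L2) ξ‖ ≤ ‖(𝓕 g : L2) ξ‖ := fun t ξ => by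
    rw [norm_mul, norm_schrodingerSymbol, one_mul]
  have hc : Continuous fun t => (𝓕 (propagator a c b t g) : L2) := by
    rw [continuous_iff_continuousAt]
    intro t₀
    simp only [ContinuousAt, e]
    refine tendsto_toL2_of_dominated (Lp.memLp (𝓕 g : L2)).norm (Eventually.of_forall h) (h t₀)
      (Eventually.of_forall fun t => Eventually.of_forall (hb t)) (Eventually.of_forall (hb t₀))
      (Eventually.of_forall fun ξ => ?_)
    exact ((continuous_schrodingerSymbol_time a c b ξ).tendsto t₀).mul_const _
  exact ((Lp.fourierTransformₗᵢ R4 ℂ).symm.continuous.comp hc).congr fun t =>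
    (Lp.fourierTransformₗᵢ R4 ℂ).symm_apply_apply _

/-- Strong continuity at the fixed vector G(s), and the isometry property for the difference G(r) -
G(s). -/
lemma continuousOn_propagator {J : Set ℝ} {τ : ℝ → ℝ} {G : ℝ → L2} (hτ : ContinuousOn τ J)
    (hG : ContinuousOn G J) : ContinuousOn (fun s => propagator a c b (τ s) (G s)) J := by
  intro s hs
  have h1 : Tendsto (fun r => propagator a c b (τ r) (G s)) (𝓝[J] s)
      (𝓝 (propagator a c b (τ s) (G s))) :=
    ((continuous_propagator a c b (G s)).tendsto _).comp (hτ s hs)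
  have h2 : Tendsto (fun r => propagator a c b (τ r) (G r) - propagator a c b (τ r) (G s)) (𝓝[J] s)
      (𝓝 0) := by
    rw [tendsto_zero_iff_norm_tendsto_zero]
    have := tendsto_iff_norm_sub_tendsto_zero.1 (hG s hs)
    refine this.congr fun r => ?_
    rw [← propagatorLI_apply, ← propagatorLI_apply, ← map_sub, LinearIsometry.norm_map]
  have h3 := h2.add h1
  simp only [sub_add_cancel, zero_add] at h3
  exact h3

end Propagator

/-! ### Dilations -/

section Dilation

lemma HasWeakPartial.comp_smul {V : Type*} [NormedAddCommGroup V] [NormedSpace ℝ V] {j : Fin 4}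
    {u G : R4 → V} (h : HasWeakPartial j u G) {c : ℝ} (hc : c ≠ 0) :
    HasWeakPartial j (fun x => u (c • x)) (fun x => c • G (c • x)) := by
  intro φ hφ hφc
  have hd := h (fun y => φ (c⁻¹ • y)) (hφ.comp (contDiff_const_smul _))
    (hφc.comp_homeomorph (Homeomorph.smulOfNeZero c⁻¹ (inv_ne_zero hc)))
  have e1 : ∀ y, fderiv ℝ (fun y => φ (c⁻¹ • y)) y (unitVec j) =
      c⁻¹ * pderiv j φ (c⁻¹ • y) := fun y => by
    rw [fderiv_comp_smul]
    simp [pderiv]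
  change ∫ y, (fderiv ℝ (fun y => φ (c⁻¹ • y)) y (unitVec j)) • u y = _ at hd
  change ∫ x, pderiv j φ x • u (c • x) = _
  simp only [e1] at hd
  have k1 := Measure.integral_comp_smul (volume : Measure R4)
    (fun y => pderiv j φ (c⁻¹ • y) • u y) c
  have k2 := Measure.integral_comp_smul (volume : Measure R4)
    (fun y => φ (c⁻¹ • y) • G y) c
  simp only [inv_smul_smul₀ hc] at k1 k2
  have k3 : ∫ x, φ x • c • G (c • x) = c • ∫ x, φ x • G (c • x) := by
    rw [← integral_smul]
    exact integral_congr_ae (Eventually.of_forall fun x => smul_comm _ _ _)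
  have k4 : ∫ y, pderiv j φ (c⁻¹ • y) • u y = -(c • ∫ y, φ (c⁻¹ • y) • G y) := by
    rw [← smul_neg, ← hd, ← integral_smul]
    refine integral_congr_ae (Eventually.of_forall fun y => ?_)
    simp only [smul_smul, mul_inv_cancel_left₀ hc]
  rw [k1, k3, k2, k4, smul_neg, smul_comm]

lemma map_smul_volume {c : ℝ} (hc : 0 < c) :
    Measure.map (fun x : R4 => c • x) volume = ENNReal.ofReal ((c ^ 4)⁻¹) • volume := by
  rw [Measure.map_addHaar_smul _ hc.ne', finrank_euclideanSpace, Fintype.card_fin,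
    abs_of_pos (by positivity)]

lemma memLp_comp_smul {V : Type*} [NormedAddCommGroup V] {g : R4 → V} {p : ℝ≥0∞} (hg : MemLp g p)
    {c : ℝ} (hc : 0 < c) : MemLp (fun x => g (c • x)) p := by
  have h : MemLp g p (Measure.map (fun x : R4 => c • x) volume) := by
    rw [map_smul_volume hc]
    exact hg.smul_measure ENNReal.ofReal_ne_top
  exact (memLp_map_measure_iff h.1 (by fun_prop)).1 h

/-- The Jacobian c⁻⁴ of the dilation of ℝ⁴ enters the L⁴-norm through its fourth root. -/
lemma eLpNorm_comp_smul {V : Type*} [NormedAddCommGroup V] {g : R4 → V}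
    (hg : AEStronglyMeasurable g volume) {c : ℝ} (hc : 0 < c) :
    eLpNorm (fun x => g (c • x)) 4 = ENNReal.ofReal c⁻¹ * eLpNorm g 4 := by
  have h : AEStronglyMeasurable g (Measure.map (fun x : R4 => c • x) volume) := by
    rw [map_smul_volume hc]
    exact hg.smul_measure _
  have e := eLpNorm_map_measure (p := 4) h (by fun_prop)
  rw [map_smul_volume hc, eLpNorm_smul_measure_of_ne_top (by norm_num)] at e
  refine e.symm.trans ?_
  rw [smul_eq_mul, ENNReal.ofReal_rpow_of_pos (by positivity)]
  congr 2
  rw [← inv_pow, ← Real.rpow_natCast, ← Real.rpow_mul (by positivity)]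
  norm_num

end Dilation

/-! ### The lens transform -/

section Lens

/-- The real phase `-|x|²/(4(T-t)) + t/(T(T-t)) - σ t`. -/
def lensAngle (σ T t : ℝ) (x : R4) : ℝ :=
  -‖x‖ ^ 2 / (4 * (T - t)) + t / (T * (T - t)) - σ * t

/-- The function `(T-t)⁻² e^{i κ θ(x)} g(x/(T-t))`, with the phase `θ` of `lensAngle`. -/
def lens (κ σ T t : ℝ) (g : R4 → ℂ) (x : R4) : ℂ :=
  ((((T - t) ^ 2)⁻¹ : ℝ) : ℂ) * Complex.exp (Complex.I * ((κ * lensAngle σ T t x : ℝ) : ℂ)) *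
    g ((T - t)⁻¹ • x)

variable {κ σ T t : ℝ} {g : R4 → ℂ}

lemma norm_lens (x : R4) : ‖lens κ σ T t g x‖ = ((T - t) ^ 2)⁻¹ * ‖g ((T - t)⁻¹ • x)‖ := by
  rw [lens, norm_mul, norm_mul, mul_comm Complex.I, Complex.norm_exp_ofReal_mul_I, mul_one,
    Complex.norm_real, Real.norm_of_nonneg (by positivity)]

lemma contDiff_lens_one : ContDiff ℝ (⊤ : ℕ∞) (lens κ σ T t 1) := by
  have h : ContDiff ℝ (⊤ : ℕ∞) fun x => κ * lensAngle σ T t x := by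
    unfold lensAngle
    exact contDiff_const.mul (((((contDiff_norm_sq ℝ).neg).div_const _).add contDiff_const).sub
      contDiff_const)
  exact ((contDiff_const.mul (contDiff_const.mul (Complex.ofRealCLM.contDiff.comp h)).cexp)).mul
    contDiff_const

lemma lens_eq_mul (x : R4) : lens κ σ T t g x = lens κ σ T t 1 x * g ((T - t)⁻¹ • x) := by
  simp [lens]

lemma lens_one_eq_quadPhase (x : R4) : lens κ σ T t 1 x =
    ((((T - t) ^ 2)⁻¹ : ℝ) : ℂ) *
      Complex.exp (Complex.I * ((κ * (t / (T * (T - t)) - σ * t) : ℝ) : ℂ)) *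
      quadPhase (-κ / (4 * (T - t))) 0 x := by
  rw [lens, quadPhase, lensAngle, mul_assoc, mul_assoc, ← Complex.exp_add, Pi.one_apply, mul_one,
    inner_zero_right]
  congr 2
  push_cast
  ring

lemma pderiv_lens_one (ht : t < T) (j : Fin 4) (x : R4) :
    pderiv j (lens κ σ T t 1) x =
      -(κ / 2 * Complex.I) * ((((T - t)⁻¹ • x) j : ℝ) : ℂ) * lens κ σ T t 1 x := by
  have e : lens κ σ T t 1 = fun x => ((((T - t) ^ 2)⁻¹ : ℝ) : ℂ) *
      Complex.exp (Complex.I * ((κ * (t / (T * (T - t)) - σ * t) : ℝ) : ℂ)) *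
      quadPhase (-κ / (4 * (T - t))) 0 x := funext lens_one_eq_quadPhase
  have hq : (T - t : ℂ) ≠ 0 := by
    rw [← Complex.ofReal_sub]
    exact Complex.ofReal_ne_zero.2 (sub_pos.2 ht).ne'
  have h0 : pderiv j (fun _ : R4 => ((((T - t) ^ 2)⁻¹ : ℝ) : ℂ) *
      Complex.exp (Complex.I * ((κ * (t / (T * (T - t)) - σ * t) : ℝ) : ℂ))) x = 0 := by
    simp [pderiv]
  rw [e, pderiv_mul (differentiableAt_const _)
    ((contDiff_quadPhase _ _).differentiable (by simp) x), pderiv_quadPhase, h0]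
  simp only [PiLp.smul_apply, smul_eq_mul, PiLp.zero_apply]
  push_cast
  field_simp
  ring

lemma memLp_lens (ht : t < T) {p : ℝ≥0∞} (hg : MemLp g p) : MemLp (lens κ σ T t g) p := by
  have hq : 0 < T - t := sub_pos.2 ht
  have h := memLp_comp_smul hg (inv_pos.2 hq)
  refine h.of_le_mul (c := ((T - t) ^ 2)⁻¹) ?_ (Eventually.of_forall fun x => (norm_lens x).le)
  exact (contDiff_lens_one.continuous.aestronglyMeasurable.mul h.1).congr
    (Eventually.of_forall fun x => (lens_eq_mul x).symm)

/-- The squared amplitude (T-t)⁻⁴ cancels the Jacobian (T-t)⁴. This is the L²-criticality of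
dimension four, responsible for the conservation of charge along the transform. -/
lemma integral_norm_lens_sq (ht : t < T) (g : R4 → ℂ) :
    ∫ x, ‖lens κ σ T t g x‖ ^ 2 = ∫ x, ‖g x‖ ^ 2 := by
  have hq : 0 < T - t := sub_pos.2 ht
  simp only [norm_lens, mul_pow]
  rw [integral_const_mul, Measure.integral_comp_smul (volume : Measure R4) (fun x => ‖g x‖ ^ 2),
    finrank_euclideanSpace, Fintype.card_fin, abs_of_pos (by positivity), smul_eq_mul, ← mul_assoc]
  have : (((T - t) ^ 2)⁻¹) ^ 2 * (((T - t)⁻¹) ^ 4)⁻¹ = 1 := by field_simp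
  rw [this, one_mul]

lemma eLpNorm_lens (ht : t < T) (hg : AEStronglyMeasurable g volume) :
    eLpNorm (lens κ σ T t g) 4 = ENNReal.ofReal (T - t)⁻¹ * eLpNorm g 4 := by
  have hq : 0 < T - t := sub_pos.2 ht
  have e : eLpNorm (lens κ σ T t g) 4 =
      eLpNorm (fun x => ((((T - t) ^ 2)⁻¹ : ℝ) : ℂ) * g ((T - t)⁻¹ • x)) 4 := by
    refine eLpNorm_congr_norm_ae (Eventually.of_forall fun x => ?_)
    rw [norm_lens, norm_mul, Complex.norm_real, Real.norm_of_nonneg (by positivity)]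
  have e2 := eLpNorm_const_smul ((((T - t) ^ 2)⁻¹ : ℝ) : ℂ) (fun x => g ((T - t)⁻¹ • x)) 4
    (volume : Measure R4)
  have e3 : ‖((((T - t) ^ 2)⁻¹ : ℝ) : ℂ)‖ₑ = ENNReal.ofReal ((T - t) ^ 2)⁻¹ := by
    rw [← ofReal_norm, Complex.norm_real, Real.norm_of_nonneg (by positivity)]
  refine e.trans (e2.trans ?_)
  rw [eLpNorm_comp_smul hg (inv_pos.2 hq), e3, ← mul_assoc, ← ENNReal.ofReal_mul (by positivity)]
  congr 2
  field_simp

lemma lens_sub (g g' : R4 → ℂ) (x : R4) :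
    lens κ σ T t (fun x => g x - g' x) x = lens κ σ T t g x - lens κ σ T t g' x := by
  simp only [lens]
  ring

lemma norm_toL2_lens (ht : t < T) (hg : MemLp g 2) :
    ‖toL2 (lens κ σ T t g)‖ = ‖toL2 g‖ := by
  rw [← sq_eq_sq₀ (norm_nonneg _) (norm_nonneg _), norm_toL2_sq (memLp_lens ht hg),
    norm_toL2_sq hg, integral_norm_lens_sq ht]

lemma continuousAt_lens_time (hT : 0 < T) (ht : t < T) (hg : Continuous g) (x : R4) :
    ContinuousAt (fun s => lens κ σ T s g x) t := by
  have hq : T - t ≠ 0 := (sub_pos.2 ht).ne'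
  have h1 : ContinuousAt (fun s : ℝ => T - s) t := by fun_prop
  have h2 : ContinuousAt (fun s => lensAngle σ T s x) t := by
    unfold lensAngle
    exact ((continuousAt_const.div (continuousAt_const.mul h1) (by simpa using hq)).add
      (continuousAt_id.div (continuousAt_const.mul h1) (mul_ne_zero hT.ne' hq))).sub
      (continuousAt_const.mul continuousAt_id)
  have h3 : ContinuousAt (fun s : ℝ => ((((T - s) ^ 2)⁻¹ : ℝ) : ℂ)) t :=
    Complex.continuous_ofReal.continuousAt.comp ((h1.pow 2).inv₀ (pow_ne_zero 2 hq))
  have h4 : ContinuousAt (fun s : ℝ => g ((T - s)⁻¹ • x)) t :=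
    hg.continuousAt.comp ((h1.inv₀ hq).smul continuousAt_const)
  have h5 : ContinuousAt (fun s : ℝ =>
      Complex.exp (Complex.I * ((κ * lensAngle σ T s x : ℝ) : ℂ))) t :=
    Complex.continuous_exp.continuousAt.comp (continuousAt_const.mul
      (Complex.continuous_ofReal.continuousAt.comp (continuousAt_const.mul h2)))
  exact (h3.mul h5).mul h4

/-- For s near t, with T-s between q/2 and 2q where q = T-t, all the functions live on one ball and
under one bound, so that dominated convergence applies. -/
lemma tendsto_toL2_lens_of_hasCompactSupport (hT : 0 < T) (ht : t < T) (hg : Continuous g)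
    (hgc : HasCompactSupport g) :
    Tendsto (fun s => toL2 (lens κ σ T s g)) (𝓝 t) (𝓝 (toL2 (lens κ σ T t g))) := by
  obtain ⟨M, hM⟩ := hgc.exists_bound_of_continuous hg
  obtain ⟨R, hR⟩ := hgc.isCompact.isBounded.subset_closedBall 0
  have hg2 : MemLp g 2 := hg.memLp_of_hasCompactSupport hgc
  have hM0 : 0 ≤ M := (norm_nonneg _).trans (hM 0)
  set q := T - t
  have hq : 0 < q := sub_pos.2 ht
  let B : R4 → ℝ := (Metric.closedBall (0 : R4) (2 * q * R)).indicator fun _ => ((q / 2) ^ 2)⁻¹ * M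
  have hB : MemLp B 2 := memLp_indicator_const 2 Metric.isClosed_closedBall.measurableSet _
    (Or.inr (measure_closedBall_lt_top).ne)
  have hev : ∀ᶠ s in 𝓝 t, q / 2 < T - s ∧ T - s < 2 * q := by
    have h1 : Tendsto (fun s => T - s) (𝓝 t) (𝓝 q) := (continuous_const.sub continuous_id).tendsto t
    exact (h1.eventually_const_lt (by linarith)).and (h1.eventually_lt_const (by linarith))
  have hb : ∀ s, q / 2 < T - s ∧ T - s < 2 * q → ∀ x, ‖lens κ σ T s g x‖ ≤ B x := fun s hs x => by
    have hs0 : 0 < T - s := by linarith [hs.1]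
    rw [norm_lens]
    by_cases hx : g ((T - s)⁻¹ • x) = 0
    · rw [hx, norm_zero, mul_zero]
      exact indicator_nonneg (fun _ _ => by positivity) _
    · have h1 : (T - s)⁻¹ • x ∈ Metric.closedBall (0 : R4) R := hR (subset_tsupport _ hx)
      rw [mem_closedBall_zero_iff, norm_smul, Real.norm_of_nonneg (by positivity),
        inv_mul_le_iff₀ hs0] at h1
      have hx0 := norm_nonneg x
      have hR0 : 0 ≤ R := by
        by_contra h
        push Not at h
        nlinarith
      have h2 : x ∈ Metric.closedBall (0 : R4) (2 * q * R) := by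
        rw [mem_closedBall_zero_iff]
        exact h1.trans (mul_le_mul_of_nonneg_right hs.2.le hR0)
      simp only [B, indicator_of_mem h2]
      have := hs.1.le
      have := hM ((T - s)⁻¹ • x)
      gcongr
  refine tendsto_toL2_of_dominated hB ?_ (memLp_lens ht hg2) ?_
    (Eventually.of_forall (hb t ⟨by linarith, by linarith⟩))
    (Eventually.of_forall fun x => (continuousAt_lens_time hT ht hg x).tendsto)
  · exact hev.mono fun s hs => memLp_lens (by linarith [hs.1]) hg2
  · exact hev.mono fun s hs => Eventually.of_forall (hb s hs)

/-- For each t the transform is linear and isometric on L², so continuity in t extends from the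
dense class of continuous functions with compact support. -/
lemma continuousOn_toL2_lens (hT : 0 < T) (hg : MemLp g 2) :
    ContinuousOn (fun t => toL2 (lens κ σ T t g)) (Iio T) := by
  intro t ht
  refine ContinuousAt.continuousWithinAt ?_
  rw [ContinuousAt, Metric.tendsto_nhds]
  intro ε hε
  obtain ⟨g', hgc, hgg, hg'c, hg'⟩ := hg.exists_hasCompactSupport_eLpNorm_sub_le (by norm_num)
    (ε := ENNReal.ofReal (ε / 4)) (by simpa using hε)
  have hd : ∀ s < T, dist (toL2 (lens κ σ T s g)) (toL2 (lens κ σ T s g')) ≤ ε / 4 := fun s hs => by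
    rw [dist_eq_norm, ← toL2_sub (memLp_lens hs hg) (memLp_lens hs hg')]
    have e : (fun x => lens κ σ T s g x - lens κ σ T s g' x) = lens κ σ T s (g - g') :=
      funext fun x => (lens_sub g g' x).symm
    rw [e, norm_toL2_lens hs (hg.sub hg'), toL2_eq (hg.sub hg'), Lp.norm_toLp]
    exact ENNReal.toReal_le_of_le_ofReal (by positivity) hgg
  filter_upwards [Metric.tendsto_nhds.1
    (tendsto_toL2_lens_of_hasCompactSupport (κ := κ) (σ := σ) hT ht hg'c hgc) (ε / 4) (by positivity),
    Iio_mem_nhds ht] with s h1 h2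
  have h3 := hd s h2
  have h4 := hd t ht
  rw [dist_comm] at h4
  have h5 := dist_triangle4 (toL2 (lens κ σ T s g)) (toL2 (lens κ σ T s g'))
    (toL2 (lens κ σ T t g')) (toL2 (lens κ σ T t g))
  linarith

/-- The weak derivatives of a lens transform. -/
lemma HasWeakPartial.lens {j : Fin 4} {G : R4 → ℂ} (h : HasWeakPartial j g G) (ht : t < T)
    (hg : MemLp g 2) (hG : MemLp G 2) :
    HasWeakPartial j (lens κ σ T t g) fun x => ((T - t)⁻¹ : ℝ) * lens κ σ T t G x +
      -(κ / 2 * Complex.I) * lens κ σ T t (fun y => (y j : ℂ) * g y) x := by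
  have hq : 0 < T - t := sub_pos.2 ht
  have h1 := (h.comp_smul (inv_pos.2 hq).ne').mul
    (locallyIntegrable_of_memLp_two (memLp_comp_smul hg (inv_pos.2 hq)))
    (locallyIntegrable_of_memLp_two ((memLp_comp_smul hG (inv_pos.2 hq)).const_smul (T - t)⁻¹))
    (contDiff_lens_one (κ := κ) (σ := σ) (T := T) (t := t))
  refine h1.congr (Eventually.of_forall fun x => (lens_eq_mul x).symm)
    (Eventually.of_forall fun x => ?_)
  simp only [lens_eq_mul (g := G), lens_eq_mul (g := fun y : R4 => (y j : ℂ) * g y),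
    pderiv_lens_one ht, Complex.real_smul]
  ring

end Lens

/-! ### Duhamel's formula -/

section Duhamel

open FourierTransform

/-- The functional `h ↦ ∫_A 𝓕 h` on `L²`, for a set `A` of finite measure. -/
def fourierIntegralOn {A : Set R4} (hA : MeasurableSet A) (hμ : volume A ≠ ∞) : L2 →L[ℂ] ℂ :=
  (innerSL ℂ (indicatorConstLp 2 hA hμ (1 : ℂ))).comp
    (Lp.fourierTransformₗᵢ R4 ℂ).toContinuousLinearEquiv.toContinuousLinearMap

lemma fourierIntegralOn_apply {A : Set R4} (hA : MeasurableSet A) (hμ : volume A ≠ ∞) (h : L2) :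
    fourierIntegralOn hA hμ h = ∫ ξ in A, (𝓕 h : L2) ξ :=
  L2.inner_indicatorConstLp_one hA hμ _

/-- The functionals h ↦ ∫_A 𝓕 h separate the points of L². They reduce Duhamel's formula to scalar
identities, in which 𝓕 can be taken as the pointwise Fourier integral. -/
lemma ext_fourierIntegralOn {g h : L2}
    (e : ∀ (A : Set R4) (hA : MeasurableSet A) (hμ : volume A ≠ ∞),
      fourierIntegralOn hA hμ g = fourierIntegralOn hA hμ h) : g = h := by
  rw [← sub_eq_zero]
  have h0 : (𝓕 (g - h) : L2) =ᵐ[volume] 0 := by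
    refine Lp.ae_eq_zero_of_forall_setIntegral_eq_zero (𝓕 (g - h) : L2) (by norm_num) (by norm_num)
      (fun A hA hμ => ?_) fun A hA hμ => ?_
    · exact integrableOn_Lp_of_measure_ne_top _ (by norm_num) hμ.ne
    · rw [← fourierIntegralOn_apply hA hμ.ne, map_sub, e A hA hμ.ne, sub_self]
  have h1 : (𝓕 (g - h) : L2) = 0 := (Lp.eq_zero_iff_ae_eq_zero).2 h0
  exact (Lp.fourierTransformₗᵢ R4 ℂ).injective (h1.trans (map_zero _).symm)

lemma fourierIntegralOn_propagator (a c b : ℝ) {A : Set R4} (hA : MeasurableSet A)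
    (hμ : volume A ≠ ∞) {u : R4 → ℂ} (h1 : Integrable u) (h2 : MemLp u 2) (t : ℝ) :
    fourierIntegralOn hA hμ (propagator a c b t (toL2 u)) =
      ∫ ξ in A, schrodingerSymbol a c b t ξ * 𝓕 u ξ := by
  rw [fourierIntegralOn_apply]
  refine integral_congr_ae (ae_restrict_of_ae ?_)
  rw [toL2_eq h2]
  filter_upwards [fourier_propagator a c b t (h2.toLp u), coeFn_fourier_toLp h1 h2] with ξ e1 e2
  rw [e1, e2]

lemma continuous_fourier {g : R4 → ℂ} (hg : Integrable g) : Continuous (𝓕 g) :=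
  VectorFourier.fourierIntegral_continuous Real.continuous_fourierChar continuous_inner hg

lemma continuous_schrodingerSymbol (a c b t : ℝ) : Continuous (schrodingerSymbol a c b t) := by
  unfold schrodingerSymbol
  fun_prop

lemma hasDerivAt_schrodingerSymbol_neg (a c b t : ℝ) (ξ : R4) :
    HasDerivAt (fun t => schrodingerSymbol a c b (-t) ξ)
      (schrodingerSymbol a c b (-t) ξ *
        (Complex.I / a * ((c * (2 * Real.pi * ‖ξ‖) ^ 2 + b : ℝ) : ℂ))) t := by
  have h1 : HasDerivAt (fun t : ℝ => -(-t / a) * (c * (2 * Real.pi * ‖ξ‖) ^ 2 + b))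
      (1 / a * (c * (2 * Real.pi * ‖ξ‖) ^ 2 + b)) t := by
    have := (((hasDerivAt_id t).div_const a).mul_const (c * (2 * Real.pi * ‖ξ‖) ^ 2 + b))
    refine this.congr_of_eventuallyEq (Eventually.of_forall fun s => ?_)
    simp only [id]
    ring
  have h2 := (h1.ofReal_comp.mul_const Complex.I).cexp
  refine h2.congr_deriv ?_
  simp only [schrodingerSymbol]
  push_cast
  ring

/-- Duhamel's formula, for functions whose Fourier transforms solve the differential equations. -/
lemma duhamel_of_hasDerivAt_fourier {a c b T C : ℝ} (hT : 0 < T) {u s : ℝ → R4 → ℂ}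
    (hu1 : ∀ t < T, Integrable (u t)) (hu2 : ∀ t < T, MemLp (u t) 2)
    (hs1 : ∀ t < T, Integrable (s t)) (hs2 : ∀ t < T, MemLp (s t) 2)
    (hsc : ContinuousOn (fun t => toL2 (s t)) (Iio T)) (hC : ∀ t < T, ∀ ξ, ‖𝓕 (s t) ξ‖ ≤ C)
    (hode : ∀ t < T, ∀ ξ, HasDerivAt (fun r => 𝓕 (u r) ξ)
      (Complex.I / a * (-((c * (2 * Real.pi * ‖ξ‖) ^ 2 + b : ℝ) : ℂ) * 𝓕 (u t) ξ + 𝓕 (s t) ξ)) t)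
    {t : ℝ} (ht : t < T) :
    toL2 (u t) = propagator a c b t (toL2 (u 0)) +
      (Complex.I / (a : ℂ)) • ∫ r in (0 : ℝ)..t, propagator a c b (t - r) (toL2 (s r)) := by
  have hsub : ∀ t < T, uIcc 0 t ⊆ Iio T := fun t ht r hr =>
    (le_max_iff.1 hr.2).elim (fun h => h.trans_lt hT) fun h => h.trans_lt ht
  have hcont : ContinuousOn (fun r => propagator a c b (-r) (toL2 (s r))) (Iio T) :=
    continuousOn_propagator a c b continuousOn_neg hsc
  have hint : IntervalIntegrable (fun r => propagator a c b (-r) (toL2 (s r))) volume 0 t :=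
    (hcont.mono (hsub t ht)).intervalIntegrable
  -- Propagated back to time 0, the unknown has the derivative (i/a) U(-r) s(r), the linear part
  -- having cancelled. Tested with ℓ, this is differentiation under the integral over A, legitimate
  -- since the transforms of the source are bounded by C and A has finite measure.
  have key : propagator a c b (-t) (toL2 (u t)) = toL2 (u 0) +
      (Complex.I / (a : ℂ)) • ∫ r in (0 : ℝ)..t, propagator a c b (-r) (toL2 (s r)) := by
    refine ext_fourierIntegralOn fun A hA hμ => ?_
    set ℓ := fourierIntegralOn hA hμ
    have hfin : IsFiniteMeasure (volume.restrict A) := ⟨by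
      rw [Measure.restrict_apply_univ]
      exact hμ.lt_top⟩
    have hderiv : ∀ r < T, HasDerivAt (fun r => ℓ (propagator a c b (-r) (toL2 (u r))))
        ((Complex.I / a) * ℓ (propagator a c b (-r) (toL2 (s r)))) r := fun r hr => by
      have hd : ∀ r < T, ∀ ξ, HasDerivAt (fun r => schrodingerSymbol a c b (-r) ξ * 𝓕 (u r) ξ)
          (Complex.I / a * (schrodingerSymbol a c b (-r) ξ * 𝓕 (s r) ξ)) r := fun r hr ξ => by
        refine ((hasDerivAt_schrodingerSymbol_neg a c b r ξ).mul (hode r hr ξ)).congr_deriv ?_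
        ring
      have h := (hasDerivAt_integral_of_dominated_loc_of_deriv_le (μ := volume.restrict A)
        (bound := fun _ => ‖Complex.I / (a : ℂ)‖ * C) (Iio_mem_nhds hr)
        (F := fun r ξ => schrodingerSymbol a c b (-r) ξ * 𝓕 (u r) ξ)
        (F' := fun r ξ => Complex.I / a * (schrodingerSymbol a c b (-r) ξ * 𝓕 (s r) ξ))
        ?_ ?_ ?_ ?_ (integrable_const _) ?_).2
      · rw [fourierIntegralOn_propagator a c b hA hμ (hs1 r hr) (hs2 r hr), ← integral_const_mul]
        refine h.congr_of_eventuallyEq ?_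
        filter_upwards [Iio_mem_nhds hr] with r' hr'
        exact fourierIntegralOn_propagator a c b hA hμ (hu1 r' hr') (hu2 r' hr') _
      · filter_upwards [Iio_mem_nhds hr] with r' hr'
        exact ((continuous_schrodingerSymbol a c b _).mul
          (continuous_fourier (hu1 r' hr'))).aestronglyMeasurable
      · have h1 : MemLp (fun ξ => schrodingerSymbol a c b (-r) ξ * 𝓕 (u r) ξ) 2 := by
          refine (memLp_congr_ae ?_).1 (Lp.memLp (𝓕 (propagator a c b (-r) (toL2 (u r))) : L2))
          rw [toL2_eq (hu2 r hr)]
          filter_upwards [fourier_propagator a c b (-r) ((hu2 r hr).toLp (u r)),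
            coeFn_fourier_toLp (hu1 r hr) (hu2 r hr)] with ξ e1 e2
          rw [e1, e2]
        exact (h1.restrict A).integrable (by norm_num)
      · exact (continuous_const.mul ((continuous_schrodingerSymbol a c b _).mul
          (continuous_fourier (hs1 r hr)))).aestronglyMeasurable
      · refine Eventually.of_forall fun ξ r' hr' => ?_
        rw [norm_mul, norm_mul, norm_schrodingerSymbol, one_mul]
        exact mul_le_mul_of_nonneg_left (hC r' hr' ξ) (norm_nonneg _)
      · exact Eventually.of_forall fun ξ r' hr' => hd r' hr' ξ
    have hFTC := intervalIntegral.integral_eq_sub_of_hasDerivAt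
      (fun r hr => hderiv r (hsub t ht hr)) ((continuousOn_const.mul
        (ℓ.continuous.comp_continuousOn (hcont.mono (hsub t ht)))).intervalIntegrable)
    rw [intervalIntegral.integral_const_mul, ℓ.intervalIntegral_comp_comm hint] at hFTC
    rw [map_add, map_smul, smul_eq_mul, hFTC, neg_zero, propagator_zero]
    ring
  have h2 := congrArg (propagatorLI a c b t) key
  rw [map_add, map_smul, propagatorLI_apply, propagatorLI_apply, propagator_propagator,
    add_neg_cancel, propagator_zero] at h2
  have h3 := (propagatorLI a c b t).toContinuousLinearMap.intervalIntegral_comp_comm hint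
  have h4 : (propagatorLI a c b t) (∫ r in (0 : ℝ)..t, propagator a c b (-r) (toL2 (s r))) =
      ∫ r in (0 : ℝ)..t, propagator a c b (t - r) (toL2 (s r)) := by
    refine h3.symm.trans (intervalIntegral.integral_congr fun r _ => ?_)
    exact propagator_propagator a c b t (-r) _
  rw [h4] at h2
  exact h2

end Duhamel

/-! ### The lens transform on the Fourier side -/

section LensFourier

open FourierTransform

variable {κ σ T t : ℝ} {g : R4 → ℂ}

/-- The real phase of the kernel of `lens` followed by the Fourier transform. -/
def lensKernelAngle (κ σ T : ℝ) (ξ : R4) (t : ℝ) (y : R4) : ℝ :=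
  κ * (t / (T * (T - t)) - σ * t) - κ * (T - t) / 4 * ‖y‖ ^ 2 - 2 * Real.pi * (T - t) * inner ℝ y ξ

/-- The kernel of `lens` followed by the Fourier transform. -/
def lensKernel (κ σ T : ℝ) (ξ : R4) (t : ℝ) (y : R4) : ℂ :=
  (((T - t) ^ 2 : ℝ) : ℂ) * Complex.exp (((lensKernelAngle κ σ T ξ t y : ℝ) : ℂ) * Complex.I)

/-- The time derivative of `lensKernel`. -/
def lensKernelDeriv (κ σ T : ℝ) (ξ : R4) (t : ℝ) (y : R4) : ℂ :=
  (((-2 * (T - t) : ℝ) : ℂ) + (((T - t) ^ 2 * (2 * Real.pi * inner ℝ y ξ + κ * ‖y‖ ^ 2 / 4 - κ * σ) + κ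
    : ℝ) : ℂ) * Complex.I) * Complex.exp (((lensKernelAngle κ σ T ξ t y : ℝ) : ℂ) * Complex.I)

/-- In y the kernel is a constant times a quadratic phase, so that `integral_quadPhase_mul` can be
applied with it. -/
lemma lensKernel_eq_quadPhase (ξ y : R4) : lensKernel κ σ T ξ t y =
    (((T - t) ^ 2 : ℝ) : ℂ) * Complex.exp (((κ * (t / (T * (T - t)) - σ * t) : ℝ) : ℂ) * Complex.I) *
      quadPhase (-κ * (T - t) / 4) (-(2 * Real.pi * (T - t)) • ξ) y := by
  rw [lensKernel, quadPhase, mul_assoc, ← Complex.exp_add, lensKernelAngle, inner_smul_right]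
  congr 2
  push_cast
  ring

lemma continuous_lensKernelAngle (ξ : R4) (t : ℝ) : Continuous (lensKernelAngle κ σ T ξ t) := by
  unfold lensKernelAngle
  fun_prop

lemma continuous_lensKernel (ξ : R4) (t : ℝ) : Continuous (lensKernel κ σ T ξ t) := by
  unfold lensKernel
  have := continuous_lensKernelAngle (κ := κ) (σ := σ) (T := T) ξ t
  fun_prop

lemma continuous_lensKernelDeriv (ξ : R4) (t : ℝ) : Continuous (lensKernelDeriv κ σ T ξ t) := by
  unfold lensKernelDeriv
  have := continuous_lensKernelAngle (κ := κ) (σ := σ) (T := T) ξ t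
  fun_prop

lemma norm_lensKernel (ξ y : R4) : ‖lensKernel κ σ T ξ t y‖ = (T - t) ^ 2 := by
  rw [lensKernel, norm_mul, Complex.norm_exp_ofReal_mul_I, mul_one, Complex.norm_real,
    Real.norm_of_nonneg (sq_nonneg _)]

/-- Quadratic growth in y, locally uniform in t, is harmless against exponential decay and so
permits differentiation under the integral. -/
lemma norm_lensKernelDeriv_le {Q : ℝ} (ht : t < T) (hQ : T - t ≤ Q) (ξ y : R4) :
    ‖lensKernelDeriv κ σ T ξ t y‖ ≤
      (2 * Q + Q ^ 2 * (2 * Real.pi * ‖ξ‖ + |κ| + |κ * σ|) + |κ|) * (1 + ‖y‖) ^ 2 := by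
  have hq : 0 < T - t := sub_pos.2 ht
  rw [lensKernelDeriv, norm_mul, Complex.norm_exp_ofReal_mul_I, mul_one]
  refine (norm_add_le _ _).trans ?_
  rw [norm_mul, Complex.norm_I, mul_one, Complex.norm_real, Complex.norm_real, Real.norm_eq_abs,
    Real.norm_eq_abs, abs_mul, abs_of_pos hq]
  have hy := norm_nonneg y
  have hπ := Real.pi_pos
  have h1 : (1 : ℝ) ≤ (1 + ‖y‖) ^ 2 := one_le_pow₀ (by linarith)
  have h2 : |inner ℝ y ξ| ≤ ‖ξ‖ * (1 + ‖y‖) ^ 2 := by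
    refine (abs_real_inner_le_norm y ξ).trans ?_
    rw [mul_comm]
    exact mul_le_mul_of_nonneg_left (by nlinarith) (norm_nonneg _)
  have h3 : |2 * Real.pi * inner ℝ y ξ + κ * ‖y‖ ^ 2 / 4 - κ * σ| ≤
      (2 * Real.pi * ‖ξ‖ + |κ| + |κ * σ|) * (1 + ‖y‖) ^ 2 := by
    refine (abs_sub _ _).trans ((add_le_add_left (abs_add_le _ _) _).trans ?_)
    have e1 : |2 * Real.pi * inner ℝ y ξ| = 2 * Real.pi * |inner ℝ y ξ| := by
      rw [abs_mul, abs_of_pos (by positivity)]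
    have e2 : |κ * ‖y‖ ^ 2 / 4| = |κ| * (‖y‖ ^ 2 / 4) := by
      rw [mul_div_assoc, abs_mul, abs_of_nonneg (by positivity : 0 ≤ ‖y‖ ^ 2 / 4)]
    have e3 : |κ| * (‖y‖ ^ 2 / 4) ≤ |κ| * (1 + ‖y‖) ^ 2 :=
      mul_le_mul_of_nonneg_left (by nlinarith) (abs_nonneg _)
    have e4 : |κ * σ| ≤ |κ * σ| * (1 + ‖y‖) ^ 2 := le_mul_of_one_le_right (abs_nonneg _) h1
    have e5 : 2 * Real.pi * |inner ℝ y ξ| ≤ 2 * Real.pi * (‖ξ‖ * (1 + ‖y‖) ^ 2) :=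
      mul_le_mul_of_nonneg_left h2 (by positivity)
    rw [e1, e2]
    nlinarith
  have h4 : (T - t) ^ 2 * |2 * Real.pi * inner ℝ y ξ + κ * ‖y‖ ^ 2 / 4 - κ * σ| ≤
      Q ^ 2 * ((2 * Real.pi * ‖ξ‖ + |κ| + |κ * σ|) * (1 + ‖y‖) ^ 2) := by gcongr
  have h5 := abs_add_le
    ((T - t) ^ 2 * (2 * Real.pi * inner ℝ y ξ + κ * ‖y‖ ^ 2 / 4 - κ * σ)) κ
  rw [abs_mul, abs_of_nonneg (sq_nonneg (T - t))] at h5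
  have h6 : |κ| ≤ |κ| * (1 + ‖y‖) ^ 2 := le_mul_of_one_le_right (abs_nonneg _) h1
  have h7 : Q ≤ Q * (1 + ‖y‖) ^ 2 := le_mul_of_one_le_right (hq.le.trans hQ) h1
  have h8 : |(-2 : ℝ)| = 2 := by norm_num
  rw [h8]
  nlinarith

lemma hasDerivAt_lensKernel (hT : 0 < T) (ht : t < T) (ξ y : R4) :
    HasDerivAt (fun r => lensKernel κ σ T ξ r y) (lensKernelDeriv κ σ T ξ t y) t := by
  have hq : T - t ≠ 0 := (sub_pos.2 ht).ne'
  have h1 : HasDerivAt (fun r => T - r) (-1) t := (hasDerivAt_id t).const_sub T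
  -- The derivative (T-t)⁻² of the time change is cancelled by the amplitude (T-t)² of the kernel,
  -- which leaves the isolated κ in `lensKernelDeriv`.
  have h2 : HasDerivAt (fun r => r / (T * (T - r))) (1 / (T - t) ^ 2) t := by
    refine ((hasDerivAt_id t).div (h1.const_mul T) (mul_ne_zero hT.ne' hq)).congr_deriv ?_
    simp only [id]
    field_simp
    ring
  have h3 : HasDerivAt (fun r => lensKernelAngle κ σ T ξ r y)
      (κ * (1 / (T - t) ^ 2 - σ) + κ / 4 * ‖y‖ ^ 2 + 2 * Real.pi * inner ℝ y ξ) t := by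
    have := (((h2.sub ((hasDerivAt_id t).const_mul σ)).const_mul κ).sub
      (((h1.const_mul κ).div_const 4).mul_const (‖y‖ ^ 2))).sub
      ((h1.const_mul (2 * Real.pi)).mul_const (inner ℝ y ξ))
    refine this.congr_deriv ?_
    ring
  have h4 := ((h1.pow 2).ofReal_comp).mul (h3.ofReal_comp.mul_const Complex.I).cexp
  refine h4.congr_deriv ?_
  have hqc : (T : ℂ) - t ≠ 0 := by
    rw [← Complex.ofReal_sub]
    exact Complex.ofReal_ne_zero.2 hq
  simp only [lensKernelDeriv, Pi.pow_apply]
  push_cast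
  field_simp
  ring

/-- Substitution x = (T-t)y: the Jacobian (T-t)⁴ leaves the amplitude (T-t)², and |x|²/(4(T-t))
becomes (T-t)|y|²/4. Time no longer sits in the argument of g, so that the transform can be
differentiated in t without regularity of g. -/
lemma fourier_lens (ht : t < T) (g : R4 → ℂ) (ξ : R4) :
    𝓕 (lens κ σ T t g) ξ = ∫ y, lensKernel κ σ T ξ t y * g y := by
  have hq : 0 < T - t := sub_pos.2 ht
  rw [fourier_eq_integral_quadPhase]
  have h := Measure.integral_comp_smul (volume : Measure R4)
    (fun x => quadPhase 0 (-(2 * Real.pi) • ξ) x * lens κ σ T t g x) (T - t)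
  rw [finrank_euclideanSpace, Fintype.card_fin, abs_of_pos (by positivity)] at h
  have h2 := congrArg (fun z => ((T - t) ^ 4 : ℝ) • z) h
  simp only [smul_inv_smul₀ (pow_pos hq 4).ne'] at h2
  rw [← h2, ← integral_smul]
  refine integral_congr_ae (Eventually.of_forall fun y => ?_)
  simp only [lens, quadPhase, lensKernel, inv_smul_smul₀ hq.ne']
  have e : Complex.exp (((lensKernelAngle κ σ T ξ t y : ℝ) : ℂ) * Complex.I) =
      Complex.exp (((0 * ‖(T - t) • y‖ ^ 2 + inner ℝ ((T - t) • y) (-(2 * Real.pi) • ξ) : ℝ) : ℂ) *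
        Complex.I) *
      Complex.exp (Complex.I * ((κ * lensAngle σ T t ((T - t) • y) : ℝ) : ℂ)) := by
    rw [← Complex.exp_add, mul_comm Complex.I, ← add_mul, ← Complex.ofReal_add]
    congr 3
    rw [lensKernelAngle, lensAngle, norm_smul, Real.norm_of_nonneg hq.le, inner_smul_left,
      inner_smul_right]
    simp only [conj_trivial]
    field_simp
    ring
  rw [e, Complex.real_smul]
  have hqc : (T : ℂ) - t ≠ 0 := by
    rw [← Complex.ofReal_sub]
    exact Complex.ofReal_ne_zero.2 hq.ne'
  push_cast
  field_simp

lemma hasDerivAt_fourier_lens (hT : 0 < T) (ht : t < T) {h : R4 → ℝ} (hh : HasExpDecay h) (ξ : R4) :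
    HasDerivAt (fun r => 𝓕 (lens κ σ T r fun x => (h x : ℂ)) ξ)
      (∫ y, lensKernelDeriv κ σ T ξ t y * (h y : ℂ)) t := by
  -- The domination takes place for times r in (t-1, T), where T-r ≤ Q.
  set Q := T - t + 1
  set C := 2 * Q + Q ^ 2 * (2 * Real.pi * ‖ξ‖ + |κ| + |κ * σ|) + |κ|
  have hm : AEStronglyMeasurable (fun y => (h y : ℂ)) volume := hh.ofReal.aestronglyMeasurable
  have hi1 : Integrable fun y => (h y : ℂ) := by
    have := (hh.ofReal.mul (a := 1) (C := 1) (m := 0) continuous_one fun x => by simp).1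
    simpa using this
  have hcont : Continuous fun y : R4 => (((1 + ‖y‖) ^ 2 : ℝ) : ℂ) := by fun_prop
  have hi2 := (hh.ofReal.mul (C := 1) (m := 2) hcont fun x => by
    rw [Complex.norm_real, Real.norm_of_nonneg (by positivity), one_mul]).1
  have hnhds : Ioo (t - 1) T ∈ 𝓝 t := Ioo_mem_nhds (by linarith) ht
  have key := (hasDerivAt_integral_of_dominated_loc_of_deriv_le (μ := (volume : Measure R4))
    (bound := fun y => C * ‖(((1 + ‖y‖) ^ 2 : ℝ) : ℂ) * (h y : ℂ)‖) hnhds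
    (F := fun r y => lensKernel κ σ T ξ r y * (h y : ℂ))
    (F' := fun r y => lensKernelDeriv κ σ T ξ r y * (h y : ℂ))
    (Eventually.of_forall fun r => (continuous_lensKernel ξ r).aestronglyMeasurable.mul hm)
    (hi1.bdd_mul (c := (T - t) ^ 2) (continuous_lensKernel ξ t).aestronglyMeasurable
      (Eventually.of_forall fun y => (norm_lensKernel ξ y).le))
    ((continuous_lensKernelDeriv ξ t).aestronglyMeasurable.mul hm)
    (Eventually.of_forall fun y r hr => ?_) (hi2.norm.const_mul C)
    (Eventually.of_forall fun y r hr => (hasDerivAt_lensKernel hT hr.2 ξ y).mul_const _)).2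
  · refine key.congr_of_eventuallyEq ?_
    filter_upwards [Iio_mem_nhds ht] with r hr
    exact fourier_lens hr _ ξ
  · rw [norm_mul, norm_mul, ← mul_assoc, Complex.norm_real ((1 + ‖y‖) ^ 2),
      Real.norm_of_nonneg (by positivity)]
    refine mul_le_mul_of_nonneg_right ?_ (norm_nonneg _)
    exact norm_lensKernelDeriv_le hr.2 (by simp only [Q]; linarith [hr.1]) ξ y

variable {l : ℕ} {α γ : Fin l → ℝ} {f : Fin l → (Fin l → ℂ) → ℂ} {F : (Fin l → ℂ) → ℂ}
  {ψ : Fin l → R4 → ℝ}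

/-- The Fourier transform of the lens transform of a weak solution solves the differential
equations of the evolution system. -/
lemma hasDerivAt_fourier_lens_of_mem (hf : IsAdmissible α γ f F) (hα : ∀ k, 0 < α k)
    (hγ : ∀ k, 0 < γ k) (hψ : ψ ∈ nontrivialSolutions γ (fun k => α k ^ 2 / γ k) f)
    (hT : 0 < T) (ht : t < T) (k : Fin l) (ξ : R4) :
    HasDerivAt (fun r => 𝓕 (lens (α k / γ k) σ T r fun x => (ψ k x : ℂ)) ξ)
      (Complex.I / α k * (-((γ k * (2 * Real.pi * ‖ξ‖) ^ 2 + σ * (α k ^ 2 / γ k) : ℝ) : ℂ) *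
        𝓕 (lens (α k / γ k) σ T t fun x => (ψ k x : ℂ)) ξ +
        𝓕 (fun x => ((((T - t) ^ 2)⁻¹ : ℝ) : ℂ) *
          lens (α k / γ k) σ T t (fun x => f k fun m => (ψ m x : ℂ)) x) ξ)) t := by
  have hb : ∀ k, 0 < α k ^ 2 / γ k := fun k => by have := hα k; have := hγ k; positivity
  have hq : 0 < T - t := sub_pos.2 ht
  obtain ⟨hE, -⟩ := hasExpDecay_of_mem_nontrivialSolutions hγ hb hf.exists_norm_le hψ k
  refine (hasDerivAt_fourier_lens hT ht hE ξ).congr_deriv ?_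
  set κ := α k / γ k with hκ
  have hi1 : Integrable fun y => lensKernel κ σ T ξ t y * (ψ k y : ℂ) :=
    (integrable_of_mem hf hγ hb hψ k).bdd_mul (c := (T - t) ^ 2)
      (continuous_lensKernel ξ t).aestronglyMeasurable
      (Eventually.of_forall fun y => (norm_lensKernel ξ y).le)
  have hi2 := (hE.ofReal.mul (continuous_lensKernelDeriv (κ := κ) (σ := σ) (T := T) ξ t)
    fun y => norm_lensKernelDeriv_le ht le_rfl ξ y).1
  have hα0 : (α k : ℂ) ≠ 0 := Complex.ofReal_ne_zero.2 (hα k).ne'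
  have hγ0 : (γ k : ℂ) ≠ 0 := Complex.ofReal_ne_zero.2 (hγ k).ne'
  set z : ℂ := (((T - t) ^ 2 : ℝ) : ℂ) *
    Complex.exp (((κ * (t / (T * (T - t)) - σ * t) : ℝ) : ℂ) * Complex.I)
  set c₀ := -κ * (T - t) / 4 with hc₀
  set v₀ := -(2 * Real.pi * (T - t)) • ξ with hv₀
  have hz : ∀ y, lensKernel κ σ T ξ t y = z * quadPhase c₀ v₀ y :=
    fun y => lensKernel_eq_quadPhase ξ y
  -- The elliptic equation, tested against the kernel at the time t, replaces f(ψ) by ψ times an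
  -- explicit polynomial. What remains to be shown is an identity between kernels for each y.
  have hs : 𝓕 (fun x => ((((T - t) ^ 2)⁻¹ : ℝ) : ℂ) *
      lens κ σ T t (fun x => f k fun m => (ψ m x : ℂ)) x) ξ =
      ∫ y, ((((T - t) ^ 2)⁻¹ : ℝ) : ℂ) * (z *
        ((((γ k * (∑ j, (2 * c₀ * y j + v₀ j) ^ 2) + α k ^ 2 / γ k : ℝ) : ℂ) -
          8 * γ k * c₀ * Complex.I) * (quadPhase c₀ v₀ y * (ψ k y : ℂ)))) := by
    rw [integral_const_mul, integral_const_mul, integral_quadPhase_mul hf hγ hb hψ,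
      ← integral_const_mul z]
    have e1 : 𝓕 (fun x => ((((T - t) ^ 2)⁻¹ : ℝ) : ℂ) *
        lens κ σ T t (fun x => f k fun m => (ψ m x : ℂ)) x) ξ = ((((T - t) ^ 2)⁻¹ : ℝ) : ℂ) *
        𝓕 (lens κ σ T t fun x => f k fun m => (ψ m x : ℂ)) ξ := by
      rw [fourier_eq_integral_quadPhase, fourier_eq_integral_quadPhase, ← integral_const_mul]
      exact integral_congr_ae (Eventually.of_forall fun x => mul_left_comm _ _ _)
    rw [e1, fourier_lens ht]
    congr 1
    refine integral_congr_ae (Eventually.of_forall fun y => ?_)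
    simp only [hz, mul_assoc]
  have hsum : ∀ y : R4, ∑ j, (2 * c₀ * y j + v₀ j) ^ 2 = (T - t) ^ 2 *
      (κ ^ 2 * ‖y‖ ^ 2 / 4 + 2 * Real.pi * κ * inner ℝ y ξ + (2 * Real.pi * ‖ξ‖) ^ 2) := fun y => by
    rw [mul_pow (2 * Real.pi), EuclideanSpace.norm_sq_eq, EuclideanSpace.norm_sq_eq,
      PiLp.inner_apply]
    simp only [Fin.sum_univ_four, Real.norm_eq_abs, sq_abs, hv₀, hc₀, PiLp.smul_apply, smul_eq_mul,
      RCLike.inner_apply, conj_trivial]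
    ring
  rw [fourier_lens ht, hs, mul_add, ← mul_assoc, ← integral_const_mul, ← integral_const_mul,
    ← sub_eq_iff_eq_add', ← integral_sub hi2 (hi1.const_mul _)]
  -- The |ξ|² terms cancel against the free evolution. The imaginary term -8γc₀i = 2α(T-t)i accounts
  -- for the derivative of the amplitude (T-t)², and the other terms, with κ = α/γ, for that of the
  -- phase.
  refine integral_congr_ae (Eventually.of_forall fun y => ?_)
  simp only [hsum]
  have hz' := hz y
  set w := quadPhase c₀ v₀ y
  rw [show ∀ p q : ℂ, z * (p * (w * q)) = p * (z * w) * q from fun p q => by ring, ← hz',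
    lensKernel, lensKernelDeriv]
  set e := Complex.exp (((lensKernelAngle κ σ T ξ t y : ℝ) : ℂ) * Complex.I)
  have hqc : (T : ℂ) - t ≠ 0 := by
    rw [← Complex.ofReal_sub]
    exact Complex.ofReal_ne_zero.2 hq.ne'
  have hκc : (κ : ℂ) = α k / γ k := by rw [hκ, Complex.ofReal_div]
  simp only [hc₀]
  push_cast
  rw [hκc]
  field_simp
  ring_nf
  simp only [Complex.I_sq]
  ring

end LensFourier

/-! ### The lens transform solves the system -/

section LensSolution

open FourierTransform

variable {l : ℕ} {α γ : Fin l → ℝ} {f : Fin l → (Fin l → ℂ) → ℂ} {F : (Fin l → ℂ) → ℂ}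
  {ψ : Fin l → R4 → ℝ} {σ T t : ℝ}

/-- The lens transform of the vector `ψ`, with the phases `e^{i (αₖ/γₖ) θ}`. -/
def lensWave (α γ : Fin l → ℝ) (σ T : ℝ) (ψ : Fin l → R4 → ℝ) : Fin l → ℝ → R4 → ℂ :=
  fun k t => lens (α k / γ k) σ T t fun x => (ψ k x : ℂ)

/-- Pointwise in x: homogeneity of degree two turns the amplitude (T-t)⁻² into its square, and the
angle θ(x), common to all components, passes through `f k` by gauge covariance. -/
lemma source_lensWave (hf : IsAdmissible α γ f F) (ht : t < T) (k : Fin l) :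
    (fun x => f k fun m => lensWave α γ σ T ψ m t x) = fun x => ((((T - t) ^ 2)⁻¹ : ℝ) : ℂ) *
      lens (α k / γ k) σ T t (fun x => f k fun m => (ψ m x : ℂ)) x := by
  have hq : 0 < T - t := sub_pos.2 ht
  funext x
  have e : (fun m => lensWave α γ σ T ψ m t x) = (((T - t) ^ 2)⁻¹ : ℝ) • fun m =>
      Complex.exp (Complex.I * ((α m / γ m * lensAngle σ T t x : ℝ) : ℂ)) *
        (ψ m ((T - t)⁻¹ • x) : ℂ) := by
    funext m
    simp only [lensWave, lens, Pi.smul_apply, Complex.real_smul, mul_assoc]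
  rw [e, hf.map_real_smul (by positivity),
    hf.map_gauge (lensAngle σ T t x) k fun m => (ψ m ((T - t)⁻¹ • x) : ℂ), lens]
  push_cast
  ring

lemma hasWeakPartial_lensWave (hψ : ∀ k, MemH1 (ψ k)) (ht : t < T) (k : Fin l) (j : Fin 4) :
    HasWeakPartial j (lensWave α γ σ T ψ k t) fun x => ((T - t)⁻¹ : ℝ) *
      lens (α k / γ k) σ T t (fun x => ((weakPartial j (ψ k) x : ℝ) : ℂ)) x +
      -(((α k / γ k : ℝ) : ℂ) / 2 * Complex.I) *
        lens (α k / γ k) σ T t (fun y => (y j : ℂ) * (ψ k y : ℂ)) x :=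
  (((hψ k).hasWeakPartial j).ofReal (locallyIntegrable_of_memLp_two (hψ k).1)
    (locallyIntegrable_of_memLp_two ((hψ k).memLp_weakPartial j))).lens ht (hψ k).1.ofReal
    ((hψ k).memLp_weakPartial j).ofReal

lemma sq_div_pos (hα : ∀ k, 0 < α k) (hγ : ∀ k, 0 < γ k) (k : Fin l) : 0 < α k ^ 2 / γ k := by
  have := hα k
  have := hγ k
  positivity

lemma memLp_weakPartial_lensWave (hf : IsAdmissible α γ f F) (hα : ∀ k, 0 < α k)
    (hγ : ∀ k, 0 < γ k) (hψ : ψ ∈ nontrivialSolutions γ (fun k => α k ^ 2 / γ k) f)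
    (ht : t < T) (k : Fin l) (j : Fin 4) :
    MemLp (fun x => ((T - t)⁻¹ : ℝ) *
      lens (α k / γ k) σ T t (fun x => ((weakPartial j (ψ k) x : ℝ) : ℂ)) x +
      -(((α k / γ k : ℝ) : ℂ) / 2 * Complex.I) *
        lens (α k / γ k) σ T t (fun y => (y j : ℂ) * (ψ k y : ℂ)) x) 2 :=
  ((memLp_lens ht ((hψ.1 k).memLp_weakPartial j).ofReal).const_mul _).add
    ((memLp_lens ht (memLp_two_coord_mul_of_mem hf hγ (sq_div_pos hα hγ) hψ k j)).const_mul _)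

lemma weakPartial_lensWave_ae_eq (hf : IsAdmissible α γ f F) (hα : ∀ k, 0 < α k)
    (hγ : ∀ k, 0 < γ k) (hψ : ψ ∈ nontrivialSolutions γ (fun k => α k ^ 2 / γ k) f)
    (ht : t < T) (k : Fin l) (j : Fin 4) :
    weakPartial j (lensWave α γ σ T ψ k t) =ᵐ[volume] fun x => ((T - t)⁻¹ : ℝ) *
      lens (α k / γ k) σ T t (fun x => ((weakPartial j (ψ k) x : ℝ) : ℂ)) x +
      -(((α k / γ k : ℝ) : ℂ) / 2 * Complex.I) *
        lens (α k / γ k) σ T t (fun y => (y j : ℂ) * (ψ k y : ℂ)) x :=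
  (hasWeakPartial_lensWave hψ.1 ht k j).weakPartial_ae_eq
    (memLp_weakPartial_lensWave hf hα hγ hψ ht k j)

lemma memH1_lensWave (hf : IsAdmissible α γ f F) (hα : ∀ k, 0 < α k)
    (hγ : ∀ k, 0 < γ k) (hψ : ψ ∈ nontrivialSolutions γ (fun k => α k ^ 2 / γ k) f)
    (ht : t < T) (k : Fin l) : MemH1 (lensWave α γ σ T ψ k t) :=
  ⟨memLp_lens ht (hψ.1 k).1.ofReal, fun j => ⟨_, memLp_weakPartial_lensWave hf hα hγ hψ ht k j,
    hasWeakPartial_lensWave hψ.1 ht k j⟩⟩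

/-- A lens transform of a weak solution is bounded in `W^{1,4}`, locally uniformly in time. -/
lemma eLpNorm_four_lensWave_le (hf : IsAdmissible α γ f F) (hα : ∀ k, 0 < α k)
    (hγ : ∀ k, 0 < γ k) (hψ : ψ ∈ nontrivialSolutions γ (fun k => α k ^ 2 / γ k) f)
    (k : Fin l) {Q : ℝ} :
    ∃ B : ℝ≥0∞, B ≠ ∞ ∧ ∀ t < T, (T - t)⁻¹ ≤ Q → eLpNorm (lensWave α γ σ T ψ k t) 4 ≤ B ∧
      ∀ j, eLpNorm (weakPartial j (lensWave α γ σ T ψ k t)) 4 ≤ B := by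
  have hb := sq_div_pos hα hγ
  have h0 := memLp_four_of_mem hψ k
  have h1 := memLp_four_weakPartial_of_mem hf hγ hb hψ k
  have h2 := memLp_four_coord_mul_of_mem hf hγ hb hψ k
  set G : Fin 4 → R4 → ℂ := fun j x => ((weakPartial j (ψ k) x : ℝ) : ℂ)
  set X : Fin 4 → R4 → ℂ := fun j x => (x j : ℂ) * (ψ k x : ℂ)
  set B₀ := ENNReal.ofReal Q * eLpNorm (fun x => (ψ k x : ℂ)) 4
  set B₁ : Fin 4 → ℝ≥0∞ := fun j => ENNReal.ofReal Q * (ENNReal.ofReal Q * eLpNorm (G j) 4) +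
    ‖-(((α k / γ k : ℝ) : ℂ) / 2 * Complex.I)‖ₑ * (ENNReal.ofReal Q * eLpNorm (X j) 4)
  have hB1 : ∀ j, B₁ j ≠ ∞ := fun j => by
    have e1 := (h1 j).2.ne
    have e2 := (h2 j).2.ne
    simp only [B₁]
    finiteness
  refine ⟨B₀ + ∑ j, B₁ j, ENNReal.add_ne_top.2 ⟨ENNReal.mul_ne_top ENNReal.ofReal_ne_top h0.2.ne,
    ENNReal.sum_ne_top.2 fun j _ => hB1 j⟩, fun t ht hQ => ⟨?_, fun j => ?_⟩⟩
  · have e := eLpNorm_lens (κ := α k / γ k) (σ := σ) ht h0.1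
    refine (e.le.trans ?_).trans le_self_add
    exact mul_le_mul_left (ENNReal.ofReal_le_ofReal hQ) _
  · have e1 := eLpNorm_lens (κ := α k / γ k) (σ := σ) ht (h1 j).1
    have e2 := eLpNorm_lens (κ := α k / γ k) (σ := σ) ht (h2 j).1
    have m1 := memLp_lens (κ := α k / γ k) (σ := σ) ht (h1 j)
    have m2 := memLp_lens (κ := α k / γ k) (σ := σ) ht (h2 j)
    have e3 := eLpNorm_congr_ae (p := 4) (weakPartial_lensWave_ae_eq (σ := σ) hf hα hγ hψ ht k j)
    have e4 := eLpNorm_add_le (p := 4) (μ := (volume : Measure R4))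
      ((m1.const_mul ((T - t)⁻¹ : ℝ)).1) (m2.const_mul (-(((α k / γ k : ℝ) : ℂ) / 2 * Complex.I))).1
      (by norm_num)
    have e5 := eLpNorm_const_smul ((((T - t)⁻¹ : ℝ)) : ℂ) (lens (α k / γ k) σ T t (G j)) 4
      (volume : Measure R4)
    have e6 := eLpNorm_const_smul (-(((α k / γ k : ℝ) : ℂ) / 2 * Complex.I))
      (lens (α k / γ k) σ T t (X j)) 4 (volume : Measure R4)
    have e7 : ‖((((T - t)⁻¹ : ℝ)) : ℂ)‖ₑ ≤ ENNReal.ofReal Q := by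
      rw [← ofReal_norm, Complex.norm_real, Real.norm_of_nonneg (inv_pos.2 (sub_pos.2 ht)).le]
      exact ENNReal.ofReal_le_ofReal hQ
    have e8 : B₁ j ≤ B₀ + ∑ j, B₁ j :=
      (Finset.single_le_sum (f := B₁) (fun _ _ => zero_le) (Finset.mem_univ j)).trans le_add_self
    refine (e3.le.trans (e4.trans ?_)).trans e8
    refine add_le_add (e5.le.trans ?_) (e6.le.trans ?_)
    · rw [e1]
      exact mul_le_mul' e7 (mul_le_mul_left (ENNReal.ofReal_le_ofReal hQ) _)
    · rw [e2]
      exact mul_le_mul_right (mul_le_mul_left (ENNReal.ofReal_le_ofReal hQ) _) _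

/-- The lens transform of a weak solution solves the evolution system. -/
theorem isH1Solution_lensWave (hf : IsAdmissible α γ f F) (hα : ∀ k, 0 < α k)
    (hγ : ∀ k, 0 < γ k) (hψ : ψ ∈ nontrivialSolutions γ (fun k => α k ^ 2 / γ k) f) (hT : 0 < T) :
    IsH1Solution α γ (fun k => σ * (α k ^ 2 / γ k)) f (Iio T) (lensWave α γ σ T ψ) := by
  have hb := sq_div_pos hα hγ
  have hs1 := fun k => integrable_source_of_mem hf hψ k
  have hs2 := fun k => memLp_source_of_mem hf hψ k
  have hsc : ∀ k, ContinuousOn (fun t => toL2 fun x => f k fun m => lensWave α γ σ T ψ m t x)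
      (Iio T) := fun k => by
    have h1 : ContinuousOn (fun t : ℝ => ((((T - t) ^ 2)⁻¹ : ℝ) : ℂ)) (Iio T) := by
      refine Complex.continuous_ofReal.comp_continuousOn (ContinuousOn.inv₀ (by fun_prop) ?_)
      exact fun t ht => pow_ne_zero 2 (sub_pos.2 ht).ne'
    refine (h1.smul (continuousOn_toL2_lens (κ := α k / γ k) (σ := σ) hT (hs2 k))).congr
      fun t ht => ?_
    simp only [source_lensWave hf ht k]
    exact toL2_const_mul (memLp_lens ht (hs2 k)) _
  have hsub : ∀ t < T, uIcc 0 t ⊆ Iio T := fun t ht r hr =>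
    (le_max_iff.1 hr.2).elim (fun h => h.trans_lt hT) fun h => h.trans_lt ht
  have hsm : ∀ k, ∀ t < T, MemLp (fun x => f k fun m => lensWave α γ σ T ψ m t x) 2 :=
    fun k t ht => hf.memLp_source (fun m => memLp_lens ht (memLp_four_of_mem hψ m)) k
  refine ⟨fun k t ht => memH1_lensWave hf hα hγ hψ ht k,
    fun k => continuousOn_toL2_lens hT (hψ.1 k).1.ofReal, fun k j => ?_, fun k a b hab => ?_,
    fun k t ht => hsm k t ht, fun k t ht => ?_, fun k t ht => ?_⟩
  · have hG : MemLp (fun x => ((weakPartial j (ψ k) x : ℝ) : ℂ)) 2 :=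
      ((hψ.1 k).memLp_weakPartial j).ofReal
    have hX := memLp_two_coord_mul_of_mem hf hγ hb hψ k j
    have h1 : ContinuousOn (fun t : ℝ => (((T - t)⁻¹ : ℝ) : ℂ)) (Iio T) := by
      refine Complex.continuous_ofReal.comp_continuousOn (ContinuousOn.inv₀ (by fun_prop) ?_)
      exact fun t ht => (sub_pos.2 ht).ne'
    refine ((h1.smul (continuousOn_toL2_lens (κ := α k / γ k) (σ := σ) hT hG)).add
      ((continuousOn_const (c := -(((α k / γ k : ℝ) : ℂ) / 2 * Complex.I))).smul
        (continuousOn_toL2_lens (κ := α k / γ k) (σ := σ) hT hX))).congr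
      fun t ht => ?_
    rw [toL2_congr (weakPartial_lensWave_ae_eq hf hα hγ hψ ht k j),
      toL2_add ((memLp_lens ht hG).const_mul _) ((memLp_lens ht hX).const_mul _),
      toL2_const_mul (memLp_lens ht hG), toL2_const_mul (memLp_lens ht hX)]
    rfl
  · rcases lt_or_ge b a with hba | hba
    · simp [Icc_eq_empty_of_lt hba]
    have hbT : b < T := hab (right_mem_Icc.2 hba)
    obtain ⟨B, hB, h⟩ := eLpNorm_four_lensWave_le (σ := σ) (T := T) hf hα hγ hψ k (Q := (T - b)⁻¹)
    have hle : ∀ t ∈ Icc a b, (eLpNorm (lensWave α γ σ T ψ k t) 4 volume) ^ 2 +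
        ∑ j, (eLpNorm (weakPartial j (lensWave α γ σ T ψ k t)) 4 volume) ^ 2 ≤
        B ^ 2 + ∑ _j : Fin 4, B ^ 2 := fun t ht => by
      obtain ⟨h1, h2⟩ := h t (hab ht) (inv_anti₀ (sub_pos.2 hbT) (by linarith [ht.2]))
      exact add_le_add (pow_le_pow_left' h1 2)
        (Finset.sum_le_sum fun j _ => pow_le_pow_left' (h2 j) 2)
    refine (setLIntegral_mono' measurableSet_Icc hle).trans_lt ?_
    rw [setLIntegral_const, Real.volume_Icc]
    have : B ^ 2 + ∑ _j : Fin 4, B ^ 2 < ∞ := by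
      rw [Fin.sum_univ_four]
      finiteness
    exact ENNReal.mul_lt_top this ENNReal.ofReal_lt_top
  · exact ((continuousOn_propagator _ _ _ (continuousOn_const.sub continuousOn_id)
      ((hsc k).mono (hsub t ht)))).intervalIntegrable
  -- The transforms of the source are bounded uniformly in time by ∫ |f_k(ψ)|, since the factor
  -- (T-t)⁻² cancels the modulus (T-t)² of the kernel.
  · refine duhamel_of_hasDerivAt_fourier (C := ∫ x, ‖f k fun m => (ψ m x : ℂ)‖) hT
      (fun t ht => memLp_one_iff_integrable.1 (memLp_lens ht
        (memLp_one_iff_integrable.2 (integrable_of_mem hf hγ hb hψ k))))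
      (fun t ht => memLp_lens ht (hψ.1 k).1.ofReal) (fun t ht => ?_) (fun t ht => hsm k t ht) (hsc k)
      (fun t ht ξ => ?_) (fun t ht ξ => ?_) ht
    · rw [source_lensWave hf ht]
      exact (memLp_one_iff_integrable.1 (memLp_lens ht
        (memLp_one_iff_integrable.2 (hs1 k)))).const_mul _
    · rw [source_lensWave hf ht]
      have hq : 0 < T - t := sub_pos.2 ht
      have e1 : 𝓕 (fun x => ((((T - t) ^ 2)⁻¹ : ℝ) : ℂ) *
          lens (α k / γ k) σ T t (fun x => f k fun m => (ψ m x : ℂ)) x) ξ =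
          ((((T - t) ^ 2)⁻¹ : ℝ) : ℂ) *
          ∫ y, lensKernel (α k / γ k) σ T ξ t y * f k fun m => (ψ m y : ℂ) := by
        rw [← fourier_lens ht, fourier_eq_integral_quadPhase, fourier_eq_integral_quadPhase,
          ← integral_const_mul]
        exact integral_congr_ae (Eventually.of_forall fun x => mul_left_comm _ _ _)
      rw [e1, norm_mul, Complex.norm_real, Real.norm_of_nonneg (by positivity),
        inv_mul_le_iff₀ (by positivity), ← integral_const_mul]
      refine norm_integral_le_of_norm_le ((hs1 k).norm.const_mul _) (Eventually.of_forall fun y => ?_)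
      rw [norm_mul, norm_lensKernel]
    · rw [source_lensWave hf ht]
      exact hasDerivAt_fourier_lens_of_mem hf hα hγ hψ hT ht k ξ

end LensSolution

/-! ### A uniqueness criterion for scalar differential inequalities -/

section Osgood

lemma integral_le_toReal_lintegral {X : Type*} [MeasurableSpace X] {μ : Measure X} {h : X → ℝ}
    (hh : Integrable h μ) : ∫ x, h x ∂μ ≤ (∫⁻ x, ENNReal.ofReal (h x) ∂μ).toReal := by
  rw [integral_eq_lintegral_pos_part_sub_lintegral_neg_part hh]
  exact sub_le_self _ ENNReal.toReal_nonneg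

/-- The inequalities `y' ≤ m A y^{1 - 3/(2m)}` for all large `m` force a solution starting at `0` to
vanish, as long as `∫ A` is small. -/
lemma eq_zero_of_hasDerivAt_le {y y' : ℝ → ℝ} {A : ℝ → ℝ≥0∞} {a b : ℝ}
    (hy : ContinuousOn y (Icc a b)) (hy' : ContinuousOn y' (Icc a b))
    (hderiv : ∀ t ∈ Ioo a b, HasDerivAt y (y' t) t) (h0 : ∀ t, 0 ≤ y t) (hya : y a = 0)
    (hA : ENNReal.ofReal (3 / 2) * ∫⁻ t in Icc a b, A t < 1)
    (hle : ∀ t ∈ Ioo a b, ∀ m : ℕ, 3 ≤ m →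
      ENNReal.ofReal (y' t) ≤ m * A t * ENNReal.ofReal (y t ^ (1 - 3 / (2 * m) : ℝ)))
    {t : ℝ} (ht : t ∈ Icc a b) : y t = 0 := by
  set r := (ENNReal.ofReal (3 / 2) * ∫⁻ t in Icc a b, A t).toReal
  have hr : r < 1 := by
    have := (ENNReal.toReal_lt_toReal hA.ne_top ENNReal.one_ne_top).2 hA
    rwa [ENNReal.toReal_one] at this
  have key : ∀ m : ℕ, 3 ≤ m → y t ^ (3 / (2 * m) : ℝ) ≤ r := fun m hm => by
    set θ : ℝ := 3 / (2 * m)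
    have hm0 : (0 : ℝ) < m := by
      have : 0 < m := by omega
      exact_mod_cast this
    have hθ : 0 < θ := by positivity
    have hθ1 : θ ≤ 1 := by
      have : (3 : ℝ) ≤ m := by exact_mod_cast hm
      rw [div_le_one (by positivity)]
      linarith
    -- The power θ = 3/(2m) is not differentiable at 0, so y is replaced by y + ε. Then ((y+ε)^θ)' =
    -- θ (y+ε)^{θ-1} y' ≤ θ m A = (3/2) A, a bound without m.
    have hε : ∀ ε > 0, y t ^ θ ≤ ε ^ θ + r := fun ε hε => by
      have hpos : ∀ s, 0 < y s + ε := fun s => by linarith [h0 s]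
      have hz : ContinuousOn (fun s => (y s + ε) ^ θ) (Icc a t) :=
        ((hy.mono (Icc_subset_Icc_right ht.2)).add continuousOn_const).rpow_const
          fun s _ => Or.inl (hpos s).ne'
      have hz' : ∀ s ∈ Ioo a t, HasDerivAt (fun s => (y s + ε) ^ θ)
          (y' s * θ * (y s + ε) ^ (θ - 1)) s := fun s hs =>
        ((hderiv s ⟨hs.1, hs.2.trans_le ht.2⟩).add_const ε).rpow_const (Or.inl (hpos s).ne')
      have hc : ContinuousOn (fun s => y' s * θ * (y s + ε) ^ (θ - 1)) (Icc a t) :=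
        ((hy'.mono (Icc_subset_Icc_right ht.2)).mul continuousOn_const).mul
          (((hy.mono (Icc_subset_Icc_right ht.2)).add continuousOn_const).rpow_const
            fun s _ => Or.inl (hpos s).ne')
      have hint : IntervalIntegrable (fun s => y' s * θ * (y s + ε) ^ (θ - 1)) volume a t :=
        hc.intervalIntegrable_of_Icc ht.1
      have hF := intervalIntegral.integral_eq_sub_of_hasDerivAt_of_le ht.1 hz hz' hint
      rw [intervalIntegral.integral_of_le ht.1, integral_Ioc_eq_integral_Ioo] at hF
      have hle2 : ∫⁻ s in Ioo a t, ENNReal.ofReal (y' s * θ * (y s + ε) ^ (θ - 1)) ≤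
          ENNReal.ofReal (3 / 2) * ∫⁻ t in Icc a b, A t := by
        rw [← lintegral_const_mul' _ _ ENNReal.ofReal_ne_top]
        refine (setLIntegral_mono' measurableSet_Ioo fun s hs => ?_).trans
          (lintegral_mono_set (Ioo_subset_Icc_self.trans (Icc_subset_Icc_right ht.2)))
        have h1 := hle s ⟨hs.1, hs.2.trans_le ht.2⟩ m hm
        have hw : 0 ≤ θ * (y s + ε) ^ (θ - 1) :=
          mul_nonneg hθ.le (Real.rpow_nonneg (hpos s).le _)
        rw [mul_assoc, mul_comm, ENNReal.ofReal_mul hw]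
        refine (mul_le_mul_right h1 _).trans ?_
        have h2 : ENNReal.ofReal (θ * (y s + ε) ^ (θ - 1)) *
            ((m : ℝ≥0∞) * A s * ENNReal.ofReal (y s ^ (1 - θ))) =
            (ENNReal.ofReal (θ * (y s + ε) ^ (θ - 1)) * ENNReal.ofReal m *
              ENNReal.ofReal (y s ^ (1 - θ))) * A s := by
          rw [ENNReal.ofReal_natCast]
          ring
        rw [h2, ← ENNReal.ofReal_mul hw, ← ENNReal.ofReal_mul (by positivity)]
        refine mul_le_mul_left (ENNReal.ofReal_le_ofReal ?_) _
        have h3 : y s ^ (1 - θ) ≤ (y s + ε) ^ (1 - θ) :=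
          Real.rpow_le_rpow (h0 s) (by linarith) (by linarith)
        have h4 : (y s + ε) ^ (θ - 1) * (y s + ε) ^ (1 - θ) = 1 := by
          rw [← Real.rpow_add (hpos s)]
          simp
        have h5 : θ * m = 3 / 2 := by simp only [θ]; field_simp
        calc θ * (y s + ε) ^ (θ - 1) * m * y s ^ (1 - θ) ≤
            θ * (y s + ε) ^ (θ - 1) * m * (y s + ε) ^ (1 - θ) :=
              mul_le_mul_of_nonneg_left h3 (by positivity)
          _ = (θ * m) * ((y s + ε) ^ (θ - 1) * (y s + ε) ^ (1 - θ)) := by ring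
          _ = 3 / 2 := by rw [h4, h5, mul_one]
      have h6 := integral_le_toReal_lintegral
        ((intervalIntegrable_iff_integrableOn_Ioo_of_le ht.1).1 hint)
      rw [hF, hya, zero_add] at h6
      have h7 : (y t + ε) ^ θ ≤ ε ^ θ + r := by
        have := h6.trans (ENNReal.toReal_mono hA.ne_top hle2)
        linarith
      exact (Real.rpow_le_rpow (h0 t) (by linarith) hθ.le).trans h7
    have hlim : Tendsto (fun ε : ℝ => ε ^ θ + r) (𝓝[>] 0) (𝓝 (0 ^ θ + r)) :=
      (((Real.continuousAt_rpow_const 0 θ (Or.inr hθ.le)).tendsto).add_const r).mono_left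
        nhdsWithin_le_nhds
    rw [Real.zero_rpow hθ.ne', zero_add] at hlim
    exact ge_of_tendsto hlim (eventually_nhdsWithin_of_forall hε)
  -- If y(t) ≠ 0, then y(t)^{3/(2m)} tends to 1 as m → ∞, whereas the bound r < 1 does not depend on
  -- m.
  by_contra hne
  have h1 : Tendsto (fun m : ℕ => y t ^ (3 / (2 * m) : ℝ)) atTop (𝓝 (y t ^ (0 : ℝ))) := by
    refine (Real.continuousAt_const_rpow hne).tendsto.comp ?_
    have h2 : Tendsto (fun m : ℕ => (2 : ℝ) * m) atTop atTop :=
      tendsto_natCast_atTop_atTop.const_mul_atTop two_pos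
    exact h2.const_div_atTop 3
  rw [Real.rpow_zero] at h1
  have h2 := le_of_tendsto h1 ((eventually_ge_atTop 3).mono key)
  linarith

end Osgood

/-! ### Measurability and Hölder estimates -/

section Holder

/-- Fatou's lemma along a subsequence converging almost everywhere. The L⁴-norm is thus lower
semicontinuous on L², which yields measurability in time. -/
lemma isClosed_eLpNorm_four_le (c : ℝ≥0∞) : IsClosed {g : L2 | eLpNorm g 4 ≤ c} := by
  refine IsSeqClosed.isClosed fun g h hg hgh => ?_
  obtain ⟨ns, -, hns⟩ := (tendstoInMeasure_of_tendsto_Lp hgh).exists_seq_tendsto_ae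
  refine (Lp.eLpNorm_lim_le_liminf_eLpNorm (fun n => Lp.aestronglyMeasurable (g (ns n))) _ hns).trans ?_
  exact liminf_le_of_le (by isBoundedDefault) fun b hb => by
    obtain ⟨n, hn⟩ := hb.exists
    exact hn.trans (hg (ns n))

lemma aemeasurable_eLpNorm_four {J : Set ℝ} (hJ : MeasurableSet J) {u : ℝ → R4 → ℂ}
    (hu : ContinuousOn (fun t => toL2 (u t)) J) (hm : ∀ t ∈ J, MemLp (u t) 2) :
    AEMeasurable (fun t => eLpNorm (u t) 4) (volume.restrict J) := by
  borelize L2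
  have h1 : Measurable fun g : L2 => eLpNorm g 4 :=
    measurable_of_Iic fun c => (isClosed_eLpNorm_four_le c).measurableSet
  refine (h1.comp_aemeasurable (hu.aemeasurable hJ)).congr ?_
  filter_upwards [ae_restrict_mem hJ] with t ht
  exact eLpNorm_congr_ae (coeFn_toL2 (hm t ht))

/-- Hölder with three factors: |w| D = (|w|^p)^{1/p} D^{1-2/p} (D²)^{1/p}. For D = |w-u|² the
squared L²-distance appears with an exponent just below 1, at the price of an L^p-norm with large p.
-/
lemma lintegral_enorm_mul_le {w : R4 → ℂ} {D : R4 → ℝ≥0∞} (hw : AEMeasurable w)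
    (hD : AEMeasurable D) {p : ℝ} (hp : 2 ≤ p) :
    ∫⁻ x, ‖w x‖ₑ * D x ≤ eLpNorm w (ENNReal.ofReal p) * (∫⁻ x, D x) ^ (1 - 2 / p) *
      (∫⁻ x, D x ^ 2) ^ (1 / p) := by
  have hp0 : 0 < p := by linarith
  have h := ENNReal.lintegral_prod_norm_pow_le (μ := (volume : Measure R4)) (Finset.univ : Finset (Fin 3))
    (f := ![fun x => ‖w x‖ₑ ^ p, D, fun x => D x ^ 2]) (p := ![1 / p, 1 - 2 / p, 1 / p]) ?_ ?_ ?_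
  · simp only [Fin.prod_univ_three, Matrix.cons_val_zero, Matrix.cons_val_one, Matrix.cons_val] at h
    have e : ∀ x, ‖w x‖ₑ * D x = (‖w x‖ₑ ^ p) ^ (1 / p) * D x ^ (1 - 2 / p) *
        (D x ^ 2) ^ (1 / p) := fun x => by
      rw [← ENNReal.rpow_mul, mul_one_div_cancel hp0.ne', ENNReal.rpow_one, mul_assoc,
        ← ENNReal.rpow_natCast, ← ENNReal.rpow_mul, ← ENNReal.rpow_add_of_nonneg]
      · congr 1
        rw [show (1 - 2 / p + ((2 : ℕ) : ℝ) * (1 / p) : ℝ) = 1 by push_cast; field_simp; ring,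
          ENNReal.rpow_one]
      · rw [sub_nonneg, div_le_one hp0]
        exact hp
      · positivity
    simp only [e]
    refine h.trans_eq ?_
    rw [eLpNorm_eq_lintegral_rpow_enorm_toReal (by simpa using hp0) ENNReal.ofReal_ne_top,
      ENNReal.toReal_ofReal hp0.le]
  · intro i _
    fin_cases i
    · exact hw.enorm.pow_const p
    · exact hD
    · exact hD.pow_const 2
  · simp only [Fin.sum_univ_three, Matrix.cons_val_zero, Matrix.cons_val_one, Matrix.cons_val]
    field_simp
    ring
  · intro i _
    fin_cases i
    · exact div_nonneg zero_le_one hp0.le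
    · exact sub_nonneg.2 ((div_le_one hp0).2 hp)
    · exact div_nonneg zero_le_one hp0.le

variable {l : ℕ}

lemma norm_pi_le_sum (z : Fin l → ℂ) : ‖z‖ ≤ ∑ m, ‖z m‖ :=
  (pi_norm_le_iff_of_nonneg (Finset.sum_nonneg fun _ _ => norm_nonneg _)).2 fun m =>
    Finset.single_le_sum (f := fun m => ‖z m‖) (fun _ _ => norm_nonneg _) (Finset.mem_univ m)

lemma eLpNorm_pi_le {u : Fin l → R4 → ℂ} (hu : ∀ m, AEStronglyMeasurable (u m) volume) :
    eLpNorm (fun x m => u m x) 4 ≤ ∑ m, eLpNorm (u m) 4 := by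
  refine (eLpNorm_mono_real (g := fun x => ∑ m, ‖u m x‖) fun x => norm_pi_le_sum _).trans ?_
  have := eLpNorm_sum_le (s := Finset.univ) (p := 4) (f := fun m x => ‖u m x‖)
    (fun m _ => (hu m).norm) (by norm_num)
  have e : (fun x => ∑ m, ‖u m x‖) = ∑ m, fun x => ‖u m x‖ := by
    ext x
    simp
  rw [e]
  exact this.trans_eq (Finset.sum_congr rfl fun m _ => eLpNorm_norm _)

variable {α γ : Fin l → ℝ} {f : Fin l → (Fin l → ℂ) → ℂ} {F : (Fin l → ℂ) → ℂ}

/-- The pointwise bound |f(u) - f(v)| ≤ C(|u| + |v|)|u - v| and Hölder with 1/2 = 1/4 + 1/4. -/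
lemma IsAdmissible.exists_eLpNorm_source_sub_le (hf : IsAdmissible α γ f F) :
    ∃ C : ℝ≥0∞, C ≠ ∞ ∧ ∀ (k : Fin l) (u v : Fin l → R4 → ℂ), (∀ m, AEStronglyMeasurable (u m) volume) →
      (∀ m, AEStronglyMeasurable (v m) volume) →
      eLpNorm (fun x => (f k fun m => u m x) - f k fun m => v m x) 2 ≤
        C * ((∑ m, eLpNorm (u m) 4) + ∑ m, eLpNorm (v m) 4) *
          ∑ m, eLpNorm (fun x => u m x - v m x) 4 := by
  obtain ⟨C, hC, h⟩ := hf.exists_lipschitz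
  refine ⟨ENNReal.ofReal C, ENNReal.ofReal_ne_top, fun k u v hu hv => ?_⟩
  have hum : AEStronglyMeasurable (fun x m => u m x) volume :=
    (aemeasurable_pi_lambda _ fun m => (hu m).aemeasurable).aestronglyMeasurable
  have hvm : AEStronglyMeasurable (fun x m => v m x) volume :=
    (aemeasurable_pi_lambda _ fun m => (hv m).aemeasurable).aestronglyMeasurable
  have : ENNReal.HolderTriple 4 4 2 := ⟨by
    rw [← two_mul, show (4 : ℝ≥0∞) = 2 * 2 by norm_num, ENNReal.mul_inv (by simp) (by simp),
      ← mul_assoc, ENNReal.mul_inv_cancel (by simp) (by simp), one_mul]⟩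
  set a : R4 → ℝ := fun x => C * (‖fun m => u m x‖ + ‖fun m => v m x‖)
  set d : R4 → Fin l → ℂ := fun x m => u m x - v m x
  have h1 : eLpNorm (fun x => (f k fun m => u m x) - f k fun m => v m x) 2 ≤
      eLpNorm (fun x => a x • ‖d x‖) 2 := by
    refine eLpNorm_mono_real (g := fun x => a x • ‖d x‖) fun x => (h k _ _).trans_eq ?_
    rfl
  have h2 := eLpNorm_smul_le_mul_eLpNorm (p := 4) (q := 4) (r := 2) (μ := (volume : Measure R4))
    (f := fun x => ‖d x‖) (φ := a) (hum.sub hvm).norm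
    ((hum.norm.add hvm.norm).const_mul C)
  have h3 : eLpNorm (fun x => ‖d x‖) 4 ≤ ∑ m, eLpNorm (fun x => u m x - v m x) 4 := by
    refine (eLpNorm_norm d).le.trans ?_
    exact eLpNorm_pi_le (u := fun m x => u m x - v m x) fun m => (hu m).sub (hv m)
  have h4 : eLpNorm a 4 ≤ ENNReal.ofReal C * ((∑ m, eLpNorm (u m) 4) + ∑ m, eLpNorm (v m) 4) := by
    have e1 := eLpNorm_const_smul C (fun x => ‖fun m => u m x‖ + ‖fun m => v m x‖) 4
      (volume : Measure R4)
    have e2 : ‖C‖ₑ = ENNReal.ofReal C := by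
      rw [← ofReal_norm, Real.norm_of_nonneg hC]
    rw [e2] at e1
    refine e1.le.trans (mul_le_mul_right ?_ _)
    refine (eLpNorm_add_le hum.norm hvm.norm (by norm_num)).trans ?_
    exact add_le_add ((eLpNorm_norm _).le.trans (eLpNorm_pi_le hu))
      ((eLpNorm_norm _).le.trans (eLpNorm_pi_le hv))
  exact h1.trans (h2.trans (mul_le_mul' h4 h3))

end Holder

/-! ### Sobolev and Trudinger bounds for functions of `H¹` -/

section SobolevDifference

lemma MemH1.hasWeakPartial_sub {u v : R4 → ℂ} (hu : MemH1 u) (hv : MemH1 v) (j : Fin 4) :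
    HasWeakPartial j (fun x => u x - v x) (fun x => weakPartial j u x - weakPartial j v x) := by
  have h1 := (hv.hasWeakPartial j).comp_clm (locallyIntegrable_of_memLp_two hv.1)
    (locallyIntegrable_of_memLp_two (hv.memLp_weakPartial j)) (-ContinuousLinearMap.id ℝ ℂ)
  have h2 := (hu.hasWeakPartial j).add h1 (locallyIntegrable_of_memLp_two hu.1)
    (locallyIntegrable_of_memLp_two hv.1.neg) (locallyIntegrable_of_memLp_two (hu.memLp_weakPartial j))
    (locallyIntegrable_of_memLp_two (hv.memLp_weakPartial j).neg)
  simpa [sub_eq_add_neg] using h2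

/-- The Sobolev embedding, for functions and for differences. -/
lemma exists_sobolev_memH1 : ∃ C : ℝ≥0∞, C ≠ ∞ ∧
    (∀ u : R4 → ℂ, MemH1 u → eLpNorm u 4 ≤ C * ∑ j, ‖toL2 (weakPartial j u)‖ₑ) ∧
    ∀ u v : R4 → ℂ, MemH1 u → MemH1 v → eLpNorm (fun x => u x - v x) 4 ≤
      C * ∑ j, ‖toL2 (weakPartial j u) - toL2 (weakPartial j v)‖ₑ := by
  obtain ⟨C, hC, h⟩ := exists_sobolev
  refine ⟨C, hC, fun u hu => ?_, fun u v hu hv => ?_⟩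
  · refine (h u _ hu.1 hu.memLp_weakPartial hu.hasWeakPartial).trans_eq ?_
    simp only [enorm_toL2 (hu.memLp_weakPartial _)]
  · refine (h _ _ (hu.1.sub hv.1) (fun j => (hu.memLp_weakPartial j).sub (hv.memLp_weakPartial j))
      (hu.hasWeakPartial_sub hv)).trans_eq ?_
    congr 1
    refine Finset.sum_congr rfl fun j _ => ?_
    rw [← toL2_sub (hu.memLp_weakPartial j) (hv.memLp_weakPartial j)]
    exact (enorm_toL2 ((hu.memLp_weakPartial j).sub (hv.memLp_weakPartial j))).symm

/-- The `W^{1,4}`-norm of a function of `H¹` (possibly infinite). -/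
def w14Norm (u : R4 → ℂ) : ℝ≥0∞ := eLpNorm u 4 + ∑ j, eLpNorm (weakPartial j u) 4

lemma exists_trudinger_memH1 : ∃ K : ℝ≥0∞, K ≠ ∞ ∧ ∀ u : R4 → ℂ, MemH1 u → ∀ m : ℕ, 3 ≤ m →
    eLpNorm u (ENNReal.ofReal (4 / 3 * m)) ≤ K * (m * w14Norm u) := by
  obtain ⟨K, hK, h⟩ := exists_trudinger
  -- The constant K + 1 is nonzero, so that the right-hand side is infinite whenever the
  -- W^{1,4}-norm is.
  refine ⟨K + 1, by finiteness, fun u hu m hm => ?_⟩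
  by_cases hinf : w14Norm u = ∞
  · have hm0 : (m : ℝ≥0∞) ≠ 0 := by
      have : m ≠ 0 := by omega
      exact_mod_cast this
    rw [hinf, ENNReal.mul_top hm0, ENNReal.mul_top (by simp)]
    exact le_top
  · have h1 := ENNReal.add_ne_top.1 hinf
    have h2 := ENNReal.sum_ne_top.1 h1.2
    refine (h u (fun j => weakPartial j u) ⟨hu.1.1, h1.1.lt_top⟩
      (fun j => ⟨(hu.memLp_weakPartial j).1, (h2 j (Finset.mem_univ j)).lt_top⟩)
      hu.hasWeakPartial m hm).trans ?_
    exact mul_le_mul_left le_self_add _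

end SobolevDifference

/-! ### Energy estimates for the difference of two solutions -/

section Uniqueness

variable {l : ℕ} {α γ β : Fin l → ℝ} {f : Fin l → (Fin l → ℂ) → ℂ} {F : (Fin l → ℂ) → ℂ}
  {J : Set ℝ} {u w : Fin l → ℝ → R4 → ℂ}

lemma IsH1Solution.mono (h : IsH1Solution α γ β f J u) {J' : Set ℝ} (hJ : J' ⊆ J) :
    IsH1Solution α γ β f J' u where
  memH1 k t ht := h.memH1 k t (hJ ht)
  continuousOn k := (h.continuousOn k).mono hJ
  continuousOn_grad k j := (h.continuousOn_grad k j).mono hJ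
  memW14 k a b hab := h.memW14 k a b (hab.trans hJ)
  source_memLp k t ht := h.source_memLp k t (hJ ht)
  source_integrable k t ht := h.source_integrable k t (hJ ht)
  duhamel k t ht := h.duhamel k t (hJ ht)

/-- The source term is continuous in time, with values in `L²`. -/
lemma IsH1Solution.continuousOn_source (h : IsH1Solution α γ β f J u) (hf : IsAdmissible α γ f F)
    (k : Fin l) : ContinuousOn (fun t => toL2 fun x => f k fun m => u m t x) J := by
  obtain ⟨C, hC, hlip⟩ := hf.exists_eLpNorm_source_sub_le
  obtain ⟨S, hS, hsob, hsob2⟩ := exists_sobolev_memH1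
  intro s hs
  rw [ContinuousWithinAt, tendsto_iff_edist_tendsto_0]
  set N : ℝ → ℝ≥0∞ := fun r => ∑ m, S * ∑ j, ‖toL2 (weakPartial j (u m r))‖ₑ
  set D : ℝ → ℝ≥0∞ := fun r => ∑ m, S * ∑ j,
    ‖toL2 (weakPartial j (u m r)) - toL2 (weakPartial j (u m s))‖ₑ
  have hN : Tendsto N (𝓝[J] s) (𝓝 (N s)) := tendsto_finsetSum _ fun m _ =>
    ENNReal.Tendsto.const_mul (tendsto_finsetSum _ fun j _ =>
      ((h.continuousOn_grad m j) s hs).tendsto.enorm) (Or.inr hS)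
  have hD : Tendsto D (𝓝[J] s) (𝓝 0) := by
    have h1 : Tendsto D (𝓝[J] s) (𝓝 (∑ m : Fin l, S * ∑ j : Fin 4,
        ‖toL2 (weakPartial j (u m s)) - toL2 (weakPartial j (u m s))‖ₑ)) :=
      tendsto_finsetSum _ fun m _ => ENNReal.Tendsto.const_mul (tendsto_finsetSum _ fun j _ =>
        (((h.continuousOn_grad m j) s hs).tendsto.sub_const _).enorm) (Or.inr hS)
    simpa using h1
  have hNs : N s ≠ ∞ := ENNReal.sum_ne_top.2 fun m _ => ENNReal.mul_ne_top hS
    (ENNReal.sum_ne_top.2 fun j _ => enorm_ne_top)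
  have hlim : Tendsto (fun r => C * (N r + N s) * D r) (𝓝[J] s) (𝓝 0) := by
    have h1 := ENNReal.Tendsto.mul (ENNReal.Tendsto.const_mul (hN.add_const (N s)) (Or.inr hC))
      (Or.inr ENNReal.zero_ne_top) hD (Or.inr (ENNReal.mul_ne_top hC (ENNReal.add_ne_top.2 ⟨hNs, hNs⟩)))
    simpa using h1
  refine tendsto_of_tendsto_of_tendsto_of_le_of_le' tendsto_const_nhds hlim
    (Eventually.of_forall fun _ => zero_le) ?_
  filter_upwards [self_mem_nhdsWithin] with r hr
  rw [edist_eq_enorm_sub, ← toL2_sub (h.source_memLp k r hr) (h.source_memLp k s hs)]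
  refine (enorm_toL2 ((h.source_memLp k r hr).sub (h.source_memLp k s hs))).le.trans ?_
  refine (hlip k (fun m => u m r) (fun m => u m s) (fun m => (h.memH1 m r hr).1.1)
    fun m => (h.memH1 m s hs).1.1).trans ?_
  refine mul_le_mul' (mul_le_mul_right (add_le_add ?_ ?_) _) ?_
  · exact Finset.sum_le_sum fun m _ => hsob _ (h.memH1 m r hr)
  · exact Finset.sum_le_sum fun m _ => hsob _ (h.memH1 m s hs)
  · exact Finset.sum_le_sum fun m _ => hsob2 _ _ (h.memH1 m r hr) (h.memH1 m s hs)

lemma enorm_inner_toL2_le {a b : R4 → ℂ} (ha : MemLp a 2) (hb : MemLp b 2) :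
    ‖inner ℂ (toL2 a) (toL2 b)‖ₑ ≤ ∫⁻ x, ‖a x‖ₑ * ‖b x‖ₑ := by
  rw [L2.inner_def]
  refine (enorm_integral_le_lintegral_enorm _).trans (lintegral_mono_ae ?_)
  filter_upwards [coeFn_toL2 ha, coeFn_toL2 hb] with x h1 h2
  rw [h1, h2]
  refine le_of_eq ?_
  rw [RCLike.inner_apply, enorm_mul, mul_comm]
  congr 1
  exact RCLike.enorm_conj _

/-- The norm of `Fin l → ℂ` is the maximum norm, which is dominated by the Euclidean one. -/
lemma lintegral_enorm_pi_sq_le {d : Fin l → R4 → ℂ} (hd : ∀ n, MemLp (d n) 2) :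
    ∫⁻ x, ‖fun n => d n x‖ₑ ^ 2 ≤ ENNReal.ofReal (∑ n, ‖toL2 (d n)‖ ^ 2) := by
  have hpt : ∀ x, ‖fun n => d n x‖ₑ ^ 2 ≤ ENNReal.ofReal (∑ n, ‖d n x‖ ^ 2) := fun x => by
    rw [← ofReal_norm, ← ENNReal.ofReal_pow (norm_nonneg _)]
    refine ENNReal.ofReal_le_ofReal ?_
    have h0 : 0 ≤ ∑ n, ‖d n x‖ ^ 2 := Finset.sum_nonneg fun _ _ => by positivity
    refine (Real.le_sqrt (norm_nonneg _) h0).1 ?_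
    exact (pi_norm_le_iff_of_nonneg (Real.sqrt_nonneg _)).2 fun n => Real.le_sqrt_of_sq_le
      (Finset.single_le_sum (f := fun n => ‖d n x‖ ^ 2) (fun _ _ => by positivity)
        (Finset.mem_univ n))
  have hi : ∀ n ∈ Finset.univ, Integrable fun x => ‖d n x‖ ^ 2 := fun n _ => (hd n).norm.integrable_sq
  refine (lintegral_mono hpt).trans_eq ?_
  rw [← ofReal_integral_eq_lintegral_ofReal (integrable_finsetSum _ hi)
    (Eventually.of_forall fun x => Finset.sum_nonneg fun _ _ => by positivity),
    integral_finsetSum _ hi]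
  simp only [norm_toL2_sq (hd _)]

lemma lintegral_enorm_sq_sq_le {d : R4 → Fin l → ℂ} :
    ∫⁻ x, (‖d x‖ₑ ^ 2) ^ 2 = eLpNorm d 4 ^ 4 := by
  have h := eLpNorm_nnreal_pow_eq_lintegral (f := d) (μ := (volume : Measure R4)) (p := 4) (by norm_num)
  have e : ((4 : NNReal) : ℝ) = ((4 : ℕ) : ℝ) := by norm_num
  simp only [e, ENNReal.rpow_natCast] at h
  simp only [← pow_mul]
  exact h.symm

/-- The energy estimate for the difference of two solutions, at a fixed time. -/
lemma IsAdmissible.exists_enorm_inner_le (hf : IsAdmissible α γ f F) : ∃ C : ℝ≥0∞, C ≠ ∞ ∧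
    ∀ (w u : Fin l → R4 → ℂ), (∀ m, MemH1 (w m)) → (∀ m, MemH1 (u m)) →
    (∀ k, MemLp (fun x => f k fun m => w m x) 2) → (∀ k, MemLp (fun x => f k fun m => u m x) 2) →
    ∀ (k : Fin l) (m : ℕ), 3 ≤ m → ∀ B : ℝ≥0∞, 1 ≤ B →
      (∑ n, eLpNorm (fun x => w n x - u n x) 4 ≤ B) →
      ‖inner ℂ (toL2 (w k) - toL2 (u k))
        (toL2 (fun x => f k fun m => w m x) - toL2 fun x => f k fun m => u m x)‖ₑ ≤
      C * (m * (∑ n, (w14Norm (w n) + w14Norm (u n))) *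
        ENNReal.ofReal ((∑ n, ‖toL2 (w n) - toL2 (u n)‖ ^ 2) ^ (1 - 3 / (2 * m) : ℝ)) * B ^ 4) := by
  obtain ⟨C, hC, hlip⟩ := hf.exists_lipschitz
  obtain ⟨K, hK, htr⟩ := exists_trudinger_memH1
  refine ⟨ENNReal.ofReal C * K, by finiteness, fun w u hw hu hfw hfu k m hm B hB1 hB => ?_⟩
  have hm0 : (3 : ℝ) ≤ m := by exact_mod_cast hm
  set d : R4 → Fin l → ℂ := fun x n => w n x - u n x
  set D : R4 → ℝ≥0∞ := fun x => ‖d x‖ₑ ^ 2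
  have hd : AEStronglyMeasurable d volume :=
    (aemeasurable_pi_lambda _ fun n => ((hw n).1.sub (hu n).1).1.aemeasurable).aestronglyMeasurable
  have hD : AEMeasurable D := hd.enorm.pow_const 2
  have hDint : ∫⁻ x, D x ≤ ENNReal.ofReal (∑ n, ‖toL2 (w n) - toL2 (u n)‖ ^ 2) := by
    refine (lintegral_enorm_pi_sq_le (d := fun n x => w n x - u n x)
      fun n => (hw n).1.sub (hu n).1).trans_eq ?_
    simp only [toL2_sub (hw _).1 (hu _).1]
  have hD2 : ∫⁻ x, D x ^ 2 ≤ B ^ 4 := by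
    rw [lintegral_enorm_sq_sq_le]
    exact pow_le_pow_left' ((eLpNorm_pi_le (u := fun n x => w n x - u n x)
      fun n => ((hw n).1.sub (hu n).1).1).trans hB) 4
  have hterm : ∀ v : R4 → ℂ, MemH1 v → ∫⁻ x, ‖v x‖ₑ * D x ≤ K * (m * w14Norm v) *
      ENNReal.ofReal ((∑ n, ‖toL2 (w n) - toL2 (u n)‖ ^ 2) ^ (1 - 3 / (2 * m) : ℝ)) * B ^ 4 := by
    intro v hv
    -- The exponent p = 4m/3 gives 1 - 2/p = 1 - 3/(2m). Because B ≥ 1, the factor (B⁴)^{1/p} is at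
    -- most B⁴, uniformly in m.
    have hp : (2 : ℝ) ≤ 4 / 3 * m := by linarith
    refine (lintegral_enorm_mul_le hv.1.1.aemeasurable hD hp).trans ?_
    have e : (1 - 2 / (4 / 3 * m) : ℝ) = 1 - 3 / (2 * m) := by
      field_simp
      ring
    rw [e]
    have he : (0 : ℝ) ≤ 1 - 3 / (2 * m) := by
      rw [sub_nonneg, div_le_one (by linarith)]
      linarith
    refine mul_le_mul' (mul_le_mul' (htr v hv m hm) ?_) ?_
    · rw [← ENNReal.ofReal_rpow_of_nonneg (Finset.sum_nonneg fun _ _ => by positivity) he]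
      exact ENNReal.rpow_le_rpow hDint he
    · refine (ENNReal.rpow_le_rpow hD2 (by positivity)).trans ?_
      refine (ENNReal.rpow_le_rpow_of_exponent_le (one_le_pow_of_one_le' hB1 4)
        (?_ : (1 / (4 / 3 * m) : ℝ) ≤ 1)).trans_eq (ENNReal.rpow_one _)
      rw [div_le_one (by linarith)]
      linarith
  rw [← toL2_sub (hw k).1 (hu k).1, ← toL2_sub (hfw k) (hfu k)]
  refine (enorm_inner_toL2_le ((hw k).1.sub (hu k).1) ((hfw k).sub (hfu k))).trans ?_
  have hpt : ∀ x, ‖w k x - u k x‖ₑ * ‖(f k fun m => w m x) - f k fun m => u m x‖ₑ ≤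
      ENNReal.ofReal C * ∑ n, (‖w n x‖ₑ * D x + ‖u n x‖ₑ * D x) := fun x => by
    have h1 : ‖w k x - u k x‖ₑ ≤ ‖d x‖ₑ := by
      rw [← ofReal_norm, ← ofReal_norm]
      exact ENNReal.ofReal_le_ofReal (norm_le_pi_norm (d x) k)
    have hs : ∀ z : Fin l → ℂ, ‖z‖ₑ ≤ ∑ n, ‖z n‖ₑ := fun z => by
      rw [← ofReal_norm]
      refine (ENNReal.ofReal_le_ofReal (norm_pi_le_sum z)).trans_eq ?_
      rw [ENNReal.ofReal_sum_of_nonneg fun _ _ => norm_nonneg _]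
      simp only [ofReal_norm]
    have h2 : ‖(f k fun m => w m x) - f k fun m => u m x‖ₑ ≤ ENNReal.ofReal C *
        (∑ n, ‖w n x‖ₑ + ∑ n, ‖u n x‖ₑ) * ‖d x‖ₑ := by
      rw [← ofReal_norm]
      refine (ENNReal.ofReal_le_ofReal (hlip k _ _)).trans ?_
      rw [ENNReal.ofReal_mul (by positivity), ENNReal.ofReal_mul hC,
        ENNReal.ofReal_add (norm_nonneg _) (norm_nonneg _), ofReal_norm, ofReal_norm, ofReal_norm]
      exact mul_le_mul_left (mul_le_mul_right (add_le_add (hs _) (hs _)) _) _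
    refine (mul_le_mul' h1 h2).trans_eq ?_
    simp only [D]
    rw [Finset.sum_add_distrib, ← Finset.sum_mul, ← Finset.sum_mul]
    ring
  refine (lintegral_mono hpt).trans ?_
  rw [lintegral_const_mul' _ _ ENNReal.ofReal_ne_top, lintegral_finsetSum', mul_assoc]
  · refine mul_le_mul_right ?_ _
    have hs : ∀ n, ∫⁻ x, (‖w n x‖ₑ * D x + ‖u n x‖ₑ * D x) = (∫⁻ x, ‖w n x‖ₑ * D x) +
        ∫⁻ x, ‖u n x‖ₑ * D x := fun n =>
      lintegral_add_left' ((hw n).1.1.aemeasurable.enorm.mul hD) _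
    simp only [hs]
    refine (Finset.sum_le_sum fun n _ => add_le_add (hterm _ (hw n)) (hterm _ (hu n))).trans_eq ?_
    simp only [Finset.mul_sum, Finset.sum_mul]
    exact Finset.sum_congr rfl fun n _ => by ring
  · intro n _
    exact ((hw n).1.1.aemeasurable.enorm.mul hD).add ((hu n).1.1.aemeasurable.enorm.mul hD)

end Uniqueness

/-! ### Uniqueness of solutions -/

section Uniqueness

variable {l : ℕ} {α γ β : Fin l → ℝ} {f : Fin l → (Fin l → ℂ) → ℂ} {F : (Fin l → ℂ) → ℂ}
  {u w : Fin l → ℝ → R4 → ℂ} {S : ℝ}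

/-- The `W^{1,4}`-norm of a solution is measurable and integrable in time. -/
lemma IsH1Solution.w14Norm_time {J : Set ℝ} (h : IsH1Solution α γ β f J u) {a b : ℝ}
    (hab : Icc a b ⊆ J) (k : Fin l) :
    AEMeasurable (fun t => w14Norm (u k t)) (volume.restrict (Icc a b)) ∧
      ∫⁻ t in Icc a b, w14Norm (u k t) ≠ ∞ := by
  have m0 : AEMeasurable (fun t => eLpNorm (u k t) 4) (volume.restrict (Icc a b)) :=
    aemeasurable_eLpNorm_four measurableSet_Icc ((h.continuousOn k).mono hab)
      fun t ht => (h.memH1 k t (hab ht)).1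
  have m1 : ∀ j, AEMeasurable (fun t => eLpNorm (weakPartial j (u k t)) 4)
      (volume.restrict (Icc a b)) := fun j =>
    aemeasurable_eLpNorm_four measurableSet_Icc ((h.continuousOn_grad k j).mono hab)
      fun t ht => (h.memH1 k t (hab ht)).memLp_weakPartial j
  have m2 : AEMeasurable (fun t => ∑ j, eLpNorm (weakPartial j (u k t)) 4)
      (volume.restrict (Icc a b)) := Finset.aemeasurable_fun_sum _ fun j _ => m1 j
  refine ⟨m0.add m2, ?_⟩
  -- On a bounded interval z ≤ 1 + z² reduces integrability in time to square integrability. The 5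
  -- below counts the function and its four derivatives.
  have hsq : ∀ z : ℝ≥0∞, z ≤ 1 + z ^ 2 := fun z => by
    rcases le_total z 1 with h1 | h1
    · exact h1.trans le_self_add
    · refine le_trans ?_ le_add_self
      rw [sq]
      exact le_mul_of_one_le_left' h1
  have hbound := h.memW14 k a b hab
  have hpt : ∀ t, w14Norm (u k t) ≤ 5 + ((eLpNorm (u k t) 4) ^ 2 +
      ∑ j, (eLpNorm (weakPartial j (u k t)) 4) ^ 2) := fun t => by
    refine (add_le_add (hsq _) (Finset.sum_le_sum fun j _ => hsq _)).trans_eq ?_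
    rw [Finset.sum_add_distrib, Finset.sum_const, Finset.card_univ, Fintype.card_fin, nsmul_eq_mul,
      mul_one, Nat.cast_ofNat, add_add_add_comm]
    congr 1
    norm_num
  refine ((lintegral_mono hpt).trans_lt ?_).ne
  rw [lintegral_add_left measurable_const, setLIntegral_const, Real.volume_Icc]
  exact ENNReal.add_lt_top.2 ⟨ENNReal.mul_lt_top (by norm_num) ENNReal.ofReal_lt_top, hbound⟩

/-- The difference of two solutions with the same data, propagated back to the time `0`. -/
lemma IsH1Solution.sub_eq_propagator (hw : IsH1Solution α γ β f (Ico 0 S) w)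
    (hu : IsH1Solution α γ β f (Ico 0 S) u) (hf : IsAdmissible α γ f F)
    (h0 : ∀ k, w k 0 =ᵐ[volume] u k 0) (k : Fin l) {t : ℝ} (ht : t ∈ Ico 0 S) :
    toL2 (w k t) - toL2 (u k t) = propagator (α k) (γ k) (β k) t ((Complex.I / (α k : ℂ)) •
      ∫ s in (0 : ℝ)..t, propagator (α k) (γ k) (β k) (-s)
        ((toL2 fun x => f k fun m => w m s x) - toL2 fun x => f k fun m => u m s x)) := by
  have hsub : uIcc 0 t ⊆ Ico 0 S := by
    rw [uIcc_of_le ht.1]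
    exact fun s hs => ⟨hs.1, hs.2.trans_lt ht.2⟩
  have hint : IntervalIntegrable (fun s => propagator (α k) (γ k) (β k) (-s)
      ((toL2 fun x => f k fun m => w m s x) - toL2 fun x => f k fun m => u m s x)) volume 0 t :=
    ((continuousOn_propagator _ _ _ continuousOn_neg
      ((hw.continuousOn_source hf k).sub (hu.continuousOn_source hf k))).mono hsub).intervalIntegrable
  have h1 := (propagatorLI (α k) (γ k) (β k) t).toContinuousLinearMap.intervalIntegral_comp_comm hint
  rw [hw.duhamel k t ht, hu.duhamel k t ht, toL2_congr (h0 k), add_sub_add_left_eq_sub, ← smul_sub,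
    ← intervalIntegral.integral_sub (hw.source_integrable k t ht) (hu.source_integrable k t ht),
    ← propagatorLI_apply, map_smul]
  congr 1
  refine Eq.trans (intervalIntegral.integral_congr fun s _ => ?_) h1
  simp only [LinearIsometry.coe_toContinuousLinearMap, propagatorLI_apply, propagator_propagator,
    ← sub_eq_add_neg]
  simp only [← propagatorLI_apply, map_sub]

/-- The squared `L²`-distance of two solutions with the same data is differentiable. -/
lemma IsH1Solution.hasDerivAt_norm_sub_sq (hw : IsH1Solution α γ β f (Ico 0 S) w)
    (hu : IsH1Solution α γ β f (Ico 0 S) u) (hf : IsAdmissible α γ f F)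
    (h0 : ∀ k, w k 0 =ᵐ[volume] u k 0) (k : Fin l) {t : ℝ} (ht : t ∈ Ioo 0 S) :
    HasDerivAt (fun t => ‖toL2 (w k t) - toL2 (u k t)‖ ^ 2)
      (2 * (inner ℂ (toL2 (w k t) - toL2 (u k t)) ((Complex.I / (α k : ℂ)) •
        ((toL2 fun x => f k fun m => w m t x) - toL2 fun x => f k fun m => u m t x))).re) t := by
  set h : ℝ → L2 := fun s => (toL2 fun x => f k fun m => w m s x) - toL2 fun x => f k fun m => u m s x
  set G : ℝ → L2 := fun s => propagator (α k) (γ k) (β k) (-s) (h s)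
  set V : ℝ → L2 := fun t => (Complex.I / (α k : ℂ)) • ∫ s in (0 : ℝ)..t, G s
  have hG : ContinuousOn G (Ico 0 S) := continuousOn_propagator _ _ _ continuousOn_neg
    ((hw.continuousOn_source hf k).sub (hu.continuousOn_source hf k))
  have hδ : ∀ s ∈ Ico 0 S, toL2 (w k s) - toL2 (u k s) =
      propagator (α k) (γ k) (β k) s (V s) := fun s hs => hw.sub_eq_propagator hu hf h0 k hs
  have hsub : uIcc 0 t ⊆ Ico 0 S := by
    rw [uIcc_of_le ht.1.le]
    exact fun s hs => ⟨hs.1, hs.2.trans_lt ht.2⟩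
  -- The difference of the solutions is U(t)V(t), and V is, up to a constant factor, the primitive
  -- of a continuous function with values in L². Since U(t) is isometric, the squared norm is that
  -- of V and is differentiable, even though U(t)V(t) need not be differentiable in L².
  have hV : HasDerivAt V ((Complex.I / (α k : ℂ)) • G t) t := by
    refine HasDerivAt.const_smul (Complex.I / (α k : ℂ)) ?_
    have hGo : ContinuousOn G (Ioo 0 S) := hG.mono Ioo_subset_Ico_self
    exact intervalIntegral.integral_hasDerivAt_right ((hG.mono hsub).intervalIntegrable)
      (hGo.stronglyMeasurableAtFilter isOpen_Ioo t ht) (hGo.continuousAt (isOpen_Ioo.mem_nhds ht))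
  have h1 := Complex.reCLM.hasFDerivAt.comp_hasDerivAt t (hV.inner ℂ hV)
  have h2 : HasDerivAt (fun t => ‖toL2 (w k t) - toL2 (u k t)‖ ^ 2)
      (Complex.reCLM (inner ℂ (V t) ((Complex.I / (α k : ℂ)) • G t) +
        inner ℂ ((Complex.I / (α k : ℂ)) • G t) (V t))) t := by
    refine h1.congr_of_eventuallyEq ?_
    filter_upwards [Ioo_mem_nhds ht.1 ht.2] with s hs
    rw [hδ s (Ioo_subset_Ico_self hs), norm_propagator, ← inner_self_eq_norm_sq (𝕜 := ℂ)]
    rfl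
  refine h2.congr_deriv ?_
  have e1 : h t = propagator (α k) (γ k) (β k) t (G t) := by
    rw [propagator_propagator, add_neg_cancel, propagator_zero]
  change _ = 2 * (inner ℂ _ ((Complex.I / (α k : ℂ)) • h t)).re
  rw [hδ t (Ioo_subset_Ico_self ht), e1, ← propagatorLI_apply, ← propagatorLI_apply, ← map_smul,
    LinearIsometry.inner_map_map, Complex.reCLM_apply, Complex.add_re, two_mul]
  congr 1
  exact inner_re_symm (𝕜 := ℂ) _ _

/-- Solutions are unique. -/
theorem IsH1Solution.unique (hw : IsH1Solution α γ β f (Ico 0 S) w)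
    (hu : IsH1Solution α γ β f (Ico 0 S) u) (hf : IsAdmissible α γ f F)
    (h0 : ∀ k, w k 0 =ᵐ[volume] u k 0) {t : ℝ} (ht : t ∈ Ico 0 S) (k : Fin l) :
    toL2 (w k t) = toL2 (u k t) := by
  obtain ⟨C, hC, hineq⟩ := hf.exists_enorm_inner_le
  obtain ⟨Sc, hSc, -, hsob⟩ := exists_sobolev_memH1
  set δ : Fin l → ℝ → L2 := fun k t => toL2 (w k t) - toL2 (u k t)
  set h : Fin l → ℝ → L2 := fun k s =>
    (toL2 fun x => f k fun m => w m s x) - toL2 fun x => f k fun m => u m s x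
  set y : ℝ → ℝ := fun t => ∑ k, ‖δ k t‖ ^ 2
  set y' : ℝ → ℝ := fun t => ∑ k, 2 * (inner ℂ (δ k t) ((Complex.I / (α k : ℂ)) • h k t)).re
  have hsub : Icc 0 t ⊆ Ico 0 S := fun s hs => ⟨hs.1, hs.2.trans_lt ht.2⟩
  have hδc : ∀ k, ContinuousOn (δ k) (Ico 0 S) := fun k => (hw.continuousOn k).sub (hu.continuousOn k)
  have hhc : ∀ k, ContinuousOn (h k) (Ico 0 S) := fun k =>
    (hw.continuousOn_source hf k).sub (hu.continuousOn_source hf k)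
  have hy : ContinuousOn y (Ico 0 S) := continuousOn_finsetSum _ fun k _ => (hδc k).norm.pow 2
  have hy' : ContinuousOn y' (Ico 0 S) := continuousOn_finsetSum _ fun k _ =>
    continuousOn_const.mul (Complex.continuous_re.comp_continuousOn
      ((hδc k).inner (𝕜 := ℂ)
      ((hhc k).const_smul (Complex.I / (α k : ℂ)) :
        ContinuousOn (fun t => (Complex.I / (α k : ℂ)) • h k t) _)))
  have hder : ∀ s ∈ Ioo 0 S, HasDerivAt y (y' s) s := fun s hs =>
    HasDerivAt.fun_sum fun k _ => hw.hasDerivAt_norm_sub_sq hu hf h0 k hs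
  have hy0 : ∀ s, 0 ≤ y s := fun s => Finset.sum_nonneg fun _ _ => by positivity
  have hδ0 : ∀ s, y s = 0 → ∀ k, δ k s = 0 := fun s hs k => by
    have := (Finset.sum_eq_zero_iff_of_nonneg fun k _ => by positivity).1 hs k (Finset.mem_univ k)
    simpa using this
  -- a uniform bound in `L⁴`
  obtain ⟨B, hB, hB1, hB4⟩ : ∃ B : ℝ≥0∞, B ≠ ∞ ∧ 1 ≤ B ∧ ∀ s ∈ Icc 0 t,
      ∑ n, eLpNorm (fun x => w n s x - u n s x) 4 ≤ B := by
    set g : ℝ → ℝ := fun s => ∑ n, ∑ j,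
      ‖toL2 (weakPartial j (w n s)) - toL2 (weakPartial j (u n s))‖
    have hg : ContinuousOn g (Icc 0 t) := continuousOn_finsetSum _ fun n _ =>
      continuousOn_finsetSum _ fun j _ =>
        (((hw.continuousOn_grad n j).sub (hu.continuousOn_grad n j)).norm).mono hsub
    obtain ⟨M, hM⟩ := isCompact_Icc.exists_bound_of_continuousOn hg
    refine ⟨1 + Sc * ENNReal.ofReal M, by finiteness, le_self_add, fun s hs => ?_⟩
    have h1 : ∑ n, eLpNorm (fun x => w n s x - u n s x) 4 ≤ ∑ n, Sc * ∑ j,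
        ‖toL2 (weakPartial j (w n s)) - toL2 (weakPartial j (u n s))‖ₑ :=
      Finset.sum_le_sum fun n _ => hsob _ _ (hw.memH1 n s (hsub hs)) (hu.memH1 n s (hsub hs))
    refine (h1.trans ?_).trans le_add_self
    rw [← Finset.mul_sum]
    refine mul_le_mul_right (le_trans (le_of_eq ?_)
      (ENNReal.ofReal_le_ofReal ((le_abs_self _).trans (hM s hs)))) _
    rw [ENNReal.ofReal_sum_of_nonneg fun _ _ => Finset.sum_nonneg fun _ _ => norm_nonneg _]
    refine Finset.sum_congr rfl fun n _ => ?_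
    rw [ENNReal.ofReal_sum_of_nonneg fun _ _ => norm_nonneg _]
    simp only [ofReal_norm]
  set c₀ : ℝ≥0∞ := (∑ k, ENNReal.ofReal (2 * |(α k)⁻¹|)) * C * B ^ 4
  have hc₀ : c₀ ≠ ∞ := by
    have : ∑ k, ENNReal.ofReal (2 * |(α k)⁻¹|) ≠ ∞ :=
      ENNReal.sum_ne_top.2 fun k _ => ENNReal.ofReal_ne_top
    finiteness
  set A : ℝ → ℝ≥0∞ := fun s => c₀ * ∑ n, (w14Norm (w n s) + w14Norm (u n s))
  have hA : ∫⁻ s in Icc 0 t, A s ≠ ∞ := by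
    have hwm := fun n => hw.w14Norm_time hsub n
    have hum := fun n => hu.w14Norm_time hsub n
    have hadd : ∀ n ∈ Finset.univ, AEMeasurable (fun s => w14Norm (w n s) + w14Norm (u n s))
        (volume.restrict (Icc 0 t)) := fun n _ => (hwm n).1.add (hum n).1
    rw [lintegral_const_mul' _ _ hc₀, lintegral_finsetSum' _ hadd]
    refine ENNReal.mul_ne_top hc₀ (ENNReal.sum_ne_top.2 fun n _ => ?_)
    rw [lintegral_add_left' (hwm n).1]
    exact ENNReal.add_ne_top.2 ⟨(hwm n).2, (hum n).2⟩
  have hle : ∀ s ∈ Icc 0 t, ∀ m : ℕ, 3 ≤ m →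
      ENNReal.ofReal (y' s) ≤ m * A s * ENNReal.ofReal (y s ^ (1 - 3 / (2 * m) : ℝ)) :=
    fun s hs m hm => by
    have h1 : y' s ≤ ∑ k, 2 * |(α k)⁻¹| * ‖inner ℂ (δ k s) (h k s)‖ := by
      refine Finset.sum_le_sum fun k _ => ?_
      rw [mul_assoc]
      refine mul_le_mul_of_nonneg_left ((Complex.re_le_norm _).trans_eq ?_) zero_le_two
      rw [inner_smul_right, norm_mul, norm_div, Complex.norm_I, Complex.norm_real, Real.norm_eq_abs,
        abs_inv, one_div]
    refine (ENNReal.ofReal_le_ofReal h1).trans ?_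
    rw [ENNReal.ofReal_sum_of_nonneg fun k _ => by positivity]
    have h2 : ∀ k ∈ Finset.univ, ENNReal.ofReal (2 * |(α k)⁻¹| * ‖inner ℂ (δ k s) (h k s)‖) ≤
        ENNReal.ofReal (2 * |(α k)⁻¹|) * (C * (m * (∑ n, (w14Norm (w n s) + w14Norm (u n s))) *
          ENNReal.ofReal (y s ^ (1 - 3 / (2 * m) : ℝ)) * B ^ 4)) := fun k _ => by
      rw [ENNReal.ofReal_mul (by positivity), ofReal_norm]
      exact mul_le_mul_right (hineq (fun n => w n s) (fun n => u n s)
        (fun n => hw.memH1 n s (hsub hs)) (fun n => hu.memH1 n s (hsub hs))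
        (fun k => hw.source_memLp k s (hsub hs)) (fun k => hu.source_memLp k s (hsub hs)) k m hm B hB1
        (hB4 s hs)) _
    refine (Finset.sum_le_sum h2).trans_eq ?_
    rw [← Finset.sum_mul]
    simp only [A, c₀]
    ring
  -- Continuous induction: the zero set of y is closed and contains 0, and a zero at a propagates to
  -- an interval on which ∫ A < 1/2, so that (3/2) ∫ A < 1.
  have hclosed : Icc 0 t ⊆ {s | y s = 0} := by
    refine IsClosed.Icc_subset_of_forall_exists_gt ?_ ?_ fun a ha b hb => ?_
    · rw [inter_comm]
      exact (hy.mono hsub).preimage_isClosed_of_isClosed isClosed_Icc isClosed_singleton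
    · refine Finset.sum_eq_zero fun k _ => ?_
      simp [δ, toL2_congr (h0 k)]
    · have ha' := ha.2
      have hab : a < b := hb
      obtain ⟨η, hη, hsmall⟩ := exists_pos_setLIntegral_lt_of_measure_lt hA
        (ε := ENNReal.ofReal (1 / 2)) (by simp)
      -- Truncation at 1 gives a finite length even if η is infinite.
      have hη1 : min η 1 ≠ ∞ := ((min_le_right _ _).trans_lt ENNReal.one_lt_top).ne
      have hr : 0 < (min η 1).toReal :=
        ENNReal.toReal_pos (lt_min hη zero_lt_one).ne' hη1
      set r := (min η 1).toReal
      set b' := min (min b t) (a + r / 2)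
      have hab' : a < b' := lt_min (lt_min hab ha'.2) (by linarith)
      have hb't : b' ≤ t := (min_le_left _ _).trans (min_le_right _ _)
      have hss : Icc a b' ⊆ Icc 0 t := Icc_subset_Icc ha'.1 hb't
      have hss' : Ioo a b' ⊆ Icc 0 t := Ioo_subset_Icc_self.trans hss
      have hvol : (volume.restrict (Icc 0 t)) (Icc a b') < η := by
        refine (Measure.restrict_apply_le _ _).trans_lt ?_
        rw [Real.volume_Icc]
        refine (ENNReal.ofReal_lt_iff_lt_toReal (by linarith) hη1).2 ?_ |>.trans_le (min_le_left _ _)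
        have : b' ≤ a + r / 2 := min_le_right _ _
        simp only [r] at this hr ⊢
        linarith
      have hint := hsmall _ hvol
      rw [Measure.restrict_restrict_of_subset hss] at hint
      refine ⟨b', ?_, hab', (min_le_left _ _).trans (min_le_left _ _)⟩
      refine eq_zero_of_hasDerivAt_le (hy.mono (hss.trans hsub)) (hy'.mono (hss.trans hsub))
        (fun s hs => hder s ⟨ha'.1.trans_lt hs.1, (hs.2.trans_le hb't).trans ht.2⟩) hy0 ha.1 ?_
        (fun s hs => hle s (hss' hs)) (right_mem_Icc.2 hab'.le)
      refine (mul_le_mul_right hint.le _).trans_lt ?_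
      rw [← ENNReal.ofReal_mul (by norm_num), ENNReal.ofReal_lt_one]
      norm_num
  have := hclosed (right_mem_Icc.2 ht.1)
  exact sub_eq_zero.1 (hδ0 t this k)

end Uniqueness

/-! ### Charge, kinetic energy and blow-up -/

section BlowUp

variable {l : ℕ} {α γ : Fin l → ℝ} {f : Fin l → (Fin l → ℂ) → ℂ} {F : (Fin l → ℂ) → ℂ}
  {ψ : Fin l → R4 → ℝ} {σ T t : ℝ}

/-- With the common factor E removed, the contribution of the gradient of the real function ψ is
real and that of the phase is imaginary, so there is no cross term. -/
lemma norm_sq_ofReal_add_mul_I (r c a b : ℝ) (E : ℂ) :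
    ‖(r : ℂ) * (E * (a : ℂ)) + -((c : ℂ) / 2 * Complex.I) * (E * (b : ℂ))‖ ^ 2 =
      r ^ 2 * ‖E * (a : ℂ)‖ ^ 2 + (c / 2) ^ 2 * ‖E * (b : ℂ)‖ ^ 2 := by
  have e : (r : ℂ) * (E * (a : ℂ)) + -((c : ℂ) / 2 * Complex.I) * (E * (b : ℂ)) =
      E * ((r * a : ℝ) + (-(c / 2) * b : ℝ) * Complex.I) := by
    push_cast
    ring
  rw [e, norm_mul, norm_mul, norm_mul, mul_pow, mul_pow, mul_pow, ← Complex.normSq_eq_norm_sq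
    (_ + _), Complex.normSq_add_mul_I, Complex.norm_real, Complex.norm_real, Real.norm_eq_abs,
    Real.norm_eq_abs, sq_abs, sq_abs]
  ring

lemma integral_weakPartial_lensWave_sq (hf : IsAdmissible α γ f F) (hα : ∀ k, 0 < α k)
    (hγ : ∀ k, 0 < γ k) (hψ : ψ ∈ nontrivialSolutions γ (fun k => α k ^ 2 / γ k) f)
    (ht : t < T) (k : Fin l) (j : Fin 4) :
    ∫ x, ‖weakPartial j (lensWave α γ σ T ψ k t) x‖ ^ 2 =
      ((T - t)⁻¹) ^ 2 * (∫ x, ‖weakPartial j (ψ k) x‖ ^ 2) +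
        (α k / γ k / 2) ^ 2 * ∫ x, ‖(x j : ℂ) * (ψ k x : ℂ)‖ ^ 2 := by
  have h1 : MemLp (fun x => ((weakPartial j (ψ k) x : ℝ) : ℂ)) 2 :=
    ((hψ.1 k).memLp_weakPartial j).ofReal
  have h2 := memLp_two_coord_mul_of_mem hf hγ (sq_div_pos hα hγ) hψ k j
  have e : (fun x => ‖weakPartial j (lensWave α γ σ T ψ k t) x‖ ^ 2) =ᵐ[volume] fun x =>
      ((T - t)⁻¹) ^ 2 * ‖lens (α k / γ k) σ T t (fun x => ((weakPartial j (ψ k) x : ℝ) : ℂ)) x‖ ^ 2 +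
        (α k / γ k / 2) ^ 2 *
          ‖lens (α k / γ k) σ T t (fun y => (y j : ℂ) * (ψ k y : ℂ)) x‖ ^ 2 := by
    filter_upwards [weakPartial_lensWave_ae_eq (σ := σ) hf hα hγ hψ ht k j] with x hx
    rw [hx, lens_eq_mul, lens_eq_mul (g := fun y : R4 => (y j : ℂ) * (ψ k y : ℂ)),
      ← Complex.ofReal_mul, norm_sq_ofReal_add_mul_I]
  rw [integral_congr_ae e, integral_add, integral_const_mul, integral_const_mul,
    integral_norm_lens_sq ht, integral_norm_lens_sq ht]
  · simp only [Complex.norm_real]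
  · exact ((memLp_lens ht h1).integrable_norm_pow two_ne_zero).const_mul _
  · exact ((memLp_lens ht h2).integrable_norm_pow two_ne_zero).const_mul _

lemma charge_lensWave (ht : t < T) :
    charge α γ (fun k => lensWave α γ σ T ψ k t) = charge α γ ψ := by
  simp only [charge, lensWave, integral_norm_lens_sq ht, Complex.norm_real]

/-- The derivatives of ψ carry the factor (T-t)⁻¹; the derivative of the phase contributes the lens
transform of x_j ψ, whose L²-norm does not depend on time. -/
lemma kinetic_lensWave (hf : IsAdmissible α γ f F) (hα : ∀ k, 0 < α k)
    (hγ : ∀ k, 0 < γ k) (hψ : ψ ∈ nontrivialSolutions γ (fun k => α k ^ 2 / γ k) f) (ht : t < T) :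
    kinetic γ (fun k => lensWave α γ σ T ψ k t) = kinetic γ ψ * (T - t) ^ (-2 : ℤ) +
      ∑ k, γ k * ∑ j, (α k / γ k / 2) ^ 2 * ∫ x, ‖(x j : ℂ) * (ψ k x : ℂ)‖ ^ 2 := by
  simp only [kinetic, integral_weakPartial_lensWave_sq hf hα hγ hψ ht, Finset.sum_add_distrib,
    mul_add, Finset.sum_mul, ← Finset.mul_sum]
  congr 1
  refine Finset.sum_congr rfl fun k _ => ?_
  rw [zpow_neg, zpow_ofNat, inv_pow]
  ring

/-- Some component of a nontrivial weak solution has a nonvanishing gradient. -/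
lemma exists_integral_weakPartial_pos {b : Fin l → ℝ} (hψ : ψ ∈ nontrivialSolutions γ b f) :
    ∃ k j, 0 < ∫ x, ‖weakPartial j (ψ k) x‖ ^ 2 := by
  -- If all gradients vanished, the Sobolev inequality would force ψ = 0.
  by_contra! h
  refine hψ.2.1 fun k => ?_
  obtain ⟨C, -, hC⟩ := exists_sobolev_real
  obtain ⟨h4, hle⟩ := hC (ψ k) (fun j => weakPartial j (ψ k)) (hψ.1 k).1
    (hψ.1 k).memLp_weakPartial (hψ.1 k).hasWeakPartial
  have h0 : ∀ j, ∫ x, weakPartial j (ψ k) x ^ 2 = 0 := fun j => by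
    refine le_antisymm ?_ (integral_nonneg fun x => sq_nonneg _)
    simpa only [Real.norm_eq_abs, sq_abs] using h k j
  have hp : ∀ x, 0 ≤ ψ k x ^ 4 := fun x => by positivity
  have hi : Integrable fun x => ψ k x ^ 4 := by
    refine (h4.integrable_norm_pow four_ne_zero).congr (Eventually.of_forall fun x => ?_)
    simp only [Real.norm_eq_abs]
    exact Even.pow_abs ⟨2, rfl⟩ _
  have h1 : ∫ x, ψ k x ^ 4 = 0 :=
    le_antisymm (by simpa [h0] using hle) (integral_nonneg hp)
  filter_upwards [(integral_eq_zero_iff_of_nonneg hp hi).1 h1] with x hx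
  simpa using hx

lemma kinetic_pos {b : Fin l → ℝ} (hγ : ∀ k, 0 < γ k) (hψ : ψ ∈ nontrivialSolutions γ b f) :
    0 < kinetic γ ψ := by
  obtain ⟨k, j, h⟩ := exists_integral_weakPartial_pos hψ
  have hn : ∀ k j, 0 ≤ ∫ x, ‖weakPartial j (ψ k) x‖ ^ 2 := fun k j =>
    integral_nonneg fun x => by positivity
  refine Finset.sum_pos' (fun k _ => mul_nonneg (hγ k).le (Finset.sum_nonneg fun j _ => hn k j))
    ⟨k, Finset.mem_univ k, mul_pos (hγ k) ?_⟩
  exact Finset.sum_pos' (fun j _ => hn k j) ⟨j, Finset.mem_univ j, h⟩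

lemma tendsto_zpow_neg_two_sub : Tendsto (fun t => (T - t) ^ (-2 : ℤ)) (𝓝[<] T) atTop := by
  have h1 : Tendsto (fun t => T - t) (𝓝[<] T) (𝓝[>] 0) := by
    refine tendsto_nhdsWithin_iff.2 ⟨?_, ?_⟩
    · have : Tendsto (fun t => T - t) (𝓝 T) (𝓝 (T - T)) :=
        (continuous_const.sub continuous_id).tendsto T
      rw [sub_self] at this
      exact this.mono_left nhdsWithin_le_nhds
    · filter_upwards [self_mem_nhdsWithin] with t ht using sub_pos.2 (mem_Iio.1 ht)
  have h2 := (tendsto_pow_atTop two_ne_zero).comp (tendsto_inv_nhdsGT_zero.comp h1)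
  refine h2.congr fun t => ?_
  simp only [Function.comp_apply, zpow_neg, zpow_ofNat, inv_pow]

/-- The main term has the positive coefficient K(ψ), and the moment term is constant, hence
negligible against (T-t)⁻². -/
theorem kinetic_lensWave_isTheta (hf : IsAdmissible α γ f F) (hα : ∀ k, 0 < α k)
    (hγ : ∀ k, 0 < γ k) (hψ : ψ ∈ nontrivialSolutions γ (fun k => α k ^ 2 / γ k) f) :
    (fun t => kinetic γ (fun k => lensWave α γ σ T ψ k t))
      =Θ[𝓝[<] T] (fun t => (T - t) ^ (-2 : ℤ)) := by
  have h1 : (fun t => kinetic γ ψ * (T - t) ^ (-2 : ℤ)) =Θ[𝓝[<] T] fun t => (T - t) ^ (-2 : ℤ) :=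
    (isTheta_refl _ _).const_mul_left (kinetic_pos hγ hψ).ne'
  have h2 : (fun _ : ℝ => ∑ k, γ k * ∑ j, (α k / γ k / 2) ^ 2 *
      ∫ x, ‖(x j : ℂ) * (ψ k x : ℂ)‖ ^ 2) =o[𝓝[<] T] fun t => (T - t) ^ (-2 : ℤ) :=
    isLittleO_const_left.2 (Or.inr (tendsto_norm_atTop_atTop.comp tendsto_zpow_neg_two_sub))
  refine IsTheta.trans ?_ ((h2.trans_isTheta h1.symm).right_isTheta_add'.symm.trans h1)
  refine EventuallyEq.isTheta ?_
  filter_upwards [self_mem_nhdsWithin] with t ht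
  exact kinetic_lensWave hf hα hγ hψ ht

/-- Blow-up of one fixed derivative of one fixed component: the form that directly contradicts
`IsH1Solution.continuousOn_grad`. -/
lemma tendsto_integral_weakPartial_lensWave (hf : IsAdmissible α γ f F) (hα : ∀ k, 0 < α k)
    (hγ : ∀ k, 0 < γ k) (hψ : ψ ∈ nontrivialSolutions γ (fun k => α k ^ 2 / γ k) f) :
    ∃ k j, Tendsto (fun t => ∫ x, ‖weakPartial j (lensWave α γ σ T ψ k t) x‖ ^ 2)
      (𝓝[<] T) atTop := by
  obtain ⟨k, j, h⟩ := exists_integral_weakPartial_pos hψ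
  refine ⟨k, j, tendsto_atTop_mono' _ ?_ (tendsto_zpow_neg_two_sub.atTop_mul_const h)⟩
  filter_upwards [self_mem_nhdsWithin] with t ht
  rw [integral_weakPartial_lensWave_sq hf hα hγ hψ ht, zpow_neg, zpow_ofNat, inv_pow]
  exact le_add_of_nonneg_right (mul_nonneg (sq_nonneg _) (integral_nonneg fun x => by positivity))

theorem tendsto_h1Norm_lensWave (hf : IsAdmissible α γ f F) (hα : ∀ k, 0 < α k)
    (hγ : ∀ k, 0 < γ k) (hψ : ψ ∈ nontrivialSolutions γ (fun k => α k ^ 2 / γ k) f) :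
    Tendsto (fun t => h1Norm (fun k => lensWave α γ σ T ψ k t)) (𝓝[<] T) atTop := by
  obtain ⟨k, j, h⟩ := tendsto_integral_weakPartial_lensWave (σ := σ) (T := T) hf hα hγ hψ
  refine tendsto_atTop_mono (fun t => ?_) (Real.tendsto_sqrt_atTop.comp h)
  refine le_trans (Real.sqrt_le_sqrt ?_) (Finset.single_le_sum (f := fun k =>
    Real.sqrt ((∫ x, ‖lensWave α γ σ T ψ k t x‖ ^ 2) +
      ∑ j, ∫ x, ‖weakPartial j (lensWave α γ σ T ψ k t) x‖ ^ 2))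
    (fun k _ => Real.sqrt_nonneg _) (Finset.mem_univ k))
  refine le_trans ?_ (le_add_of_nonneg_left (integral_nonneg fun x => by positivity))
  exact Finset.single_le_sum (f := fun j => ∫ x, ‖weakPartial j (lensWave α γ σ T ψ k t) x‖ ^ 2)
    (fun j _ => integral_nonneg fun x => by positivity) (Finset.mem_univ j)

/-- A solution with the initial data of the lens transform of `ψ` does not exist beyond `T`. -/
theorem IsH1Solution.le_of_lensWave (hf : IsAdmissible α γ f F) (hα : ∀ k, 0 < α k)
    (hγ : ∀ k, 0 < γ k) (hψ : ψ ∈ nontrivialSolutions γ (fun k => α k ^ 2 / γ k) f) (hT : 0 < T)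
    {S : ℝ} {w : Fin l → ℝ → R4 → ℂ}
    (hw : IsH1Solution α γ (fun k => σ * (α k ^ 2 / γ k)) f (Ico 0 S) w)
    (h0 : ∀ k, w k 0 =ᵐ[volume] lensWave α γ σ T ψ k 0) : S ≤ T := by
  by_contra! hS
  obtain ⟨k, j, h⟩ := tendsto_integral_weakPartial_lensWave (σ := σ) (T := T) hf hα hγ hψ
  have hu := (isH1Solution_lensWave (σ := σ) hf hα hγ hψ hT).mono (J' := Ico 0 T) fun s hs => hs.2
  have hsub : Ico 0 T ⊆ Ico 0 S := fun s hs => ⟨hs.1, hs.2.trans hS⟩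
  have hwT := hw.mono hsub
  have hmem : T ∈ Ico 0 S := ⟨hT.le, hS⟩
  -- The derivative of w is continuous in L² at the time T, since T < S. Before T uniqueness
  -- identifies it with that of the lens transform, which is unbounded.
  have hc : Tendsto (fun t => ‖toL2 (weakPartial j (w k t))‖ ^ 2) (𝓝[<] T)
      (𝓝 (‖toL2 (weakPartial j (w k T))‖ ^ 2)) := by
    have : 𝓝[<] T ≤ 𝓝[Ico 0 S] T := by
      refine nhdsWithin_le_of_mem ?_
      filter_upwards [Ioo_mem_nhdsLT hT] with s hs using ⟨hs.1.le, hs.2.trans hS⟩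
    exact (((hw.continuousOn_grad k j T hmem).mono_left this).norm).pow 2
  refine not_tendsto_nhds_of_tendsto_atTop (h.congr' ?_) _ hc
  filter_upwards [Ioo_mem_nhdsLT hT] with s hs
  have hs' : s ∈ Ico 0 T := ⟨hs.1.le, hs.2⟩
  have hae := ae_eq_of_toL2_eq (hwT.memH1 k s hs').1 (hu.memH1 k s hs').1
    (hwT.unique hu hf h0 hs' k)
  have hwp : weakPartial j (w k s) =ᵐ[volume] weakPartial j (lensWave α γ σ T ψ k s) :=
    (((hu.memH1 k s hs').hasWeakPartial j).congr hae.symm EventuallyEq.rfl).weakPartial_ae_eq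
      ((hu.memH1 k s hs').memLp_weakPartial j)
  rw [norm_toL2_sq ((hwT.memH1 k s hs').memLp_weakPartial j)]
  refine integral_congr_ae ?_
  filter_upwards [hwp] with x hx
  rw [hx]

/-- The standing wave is evaluated at the time (t/T)/(T-t), and its phase there is the second term
of `lensAngle`. -/
lemma vA_eq_lensWave (hT : 0 < T) : vA α γ ψ T hT = lensWave α γ 0 T ψ := by
  funext k t x
  have h0 : (blowUpMatrix T hT).1 0 0 = T := by simp [blowUpMatrix]
  have hq : T + -1 * t = T - t := by ring
  have h1 : (blowUpMatrix T hT).1 1 0 + (blowUpMatrix T hT).1 1 1 * t = 1 / T * t := by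
    simp [blowUpMatrix]
  have h2 : (blowUpMatrix T hT).1 0 1 = -1 := by simp [blowUpMatrix]
  simp only [vA, pseudoConformal, standingWave, lensWave, lens, lensAngle, h0, h1, h2, hq]
  rw [← mul_assoc, mul_assoc _ (Complex.exp _) (Complex.exp _), ← Complex.exp_add, ← mul_add,
    ← Complex.ofReal_add]
  have e : α k / γ k * (-1 * ‖x‖ ^ 2 / (4 * (T - t))) + α k / γ k * 1 * (1 / T * t / (T - t)) =
      α k / γ k * (-‖x‖ ^ 2 / (4 * (T - t)) + t / (T * (T - t)) - 0 * t) := by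
    rw [← div_div t]
    ring
  rw [e]

/-- The factor e^{-iκt} is the term -σt of `lensAngle` with σ = 1; it trades β = 0 for β_k =
α_k²/γ_k. -/
lemma uA_eq_lensWave (hT : 0 < T) : uA α γ ψ T hT = lensWave α γ 1 T ψ := by
  funext k t x
  simp only [uA, vA_eq_lensWave, lensWave, lens, lensAngle]
  rw [← mul_assoc, mul_left_comm, ← Complex.exp_add, neg_mul, ← mul_neg, ← mul_add,
    ← Complex.ofReal_neg, ← Complex.ofReal_add]
  have e : -(α k / γ k * t) +
      α k / γ k * (-‖x‖ ^ 2 / (4 * (T - t)) + t / (T * (T - t)) - 0 * t) =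
      α k / γ k * (-‖x‖ ^ 2 / (4 * (T - t)) + t / (T * (T - t)) - 1 * t) := by
    ring
  rw [e]

lemma vA_apply (hT : 0 < T) (k : Fin l) (t : ℝ) (x : R4) : vA α γ ψ T hT k t x =
    (((T - t) ^ (-2 : ℤ) : ℝ) : ℂ) *
      Complex.exp (-Complex.I * ((α k / γ k * (‖x‖ ^ 2 / (4 * (T - t))) : ℝ) : ℂ) +
        Complex.I * ((α k / γ k * (t / (T * (T - t))) : ℝ) : ℂ)) *
      ((ψ k ((T - t)⁻¹ • x) : ℝ) : ℂ) := by
  rw [vA_eq_lensWave, lensWave, lens, lensAngle, zpow_neg, zpow_ofNat]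
  congr 3
  push_cast
  ring

end BlowUp

end QuadNLS

end
-- The theorem
theorem mainTheorem7 {l : ℕ} (α γ : Fin l → ℝ) (hα : ∀ k, 0 < α k) (hγ : ∀ k, 0 < γ k)
    (f : Fin l → (Fin l → ℂ) → ℂ) (F : (Fin l → ℂ) → ℂ) (hf : QuadNLS.IsAdmissible α γ f F)
    (ψ : Fin l → QuadNLS.R4 → ℝ) (hψ : ψ ∈ QuadNLS.groundStates α γ f F 1 0) :
    (∀ (T : ℝ) (hT : 0 < T),
      -- the explicit form of the transform `v^A`
      (∀ k, ∀ t < T, ∀ x : QuadNLS.R4, QuadNLS.vA α γ ψ T hT k t x =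
        (((T - t) ^ (-2 : ℤ) : ℝ) : ℂ) *
          Complex.exp (-Complex.I * ((α k / γ k * (‖x‖ ^ 2 / (4 * (T - t))) : ℝ) : ℂ) +
            Complex.I * ((α k / γ k * (t / (T * (T - t))) : ℝ) : ℂ)) *
          ((ψ k ((T - t)⁻¹ • x) : ℝ) : ℂ)) ∧
      -- `v^A` solves the system with `β = 0`
      QuadNLS.IsH1Solution α γ 0 f (Iio T) (QuadNLS.vA α γ ψ T hT) ∧
      -- its initial data
      (∀ k, ∀ x : QuadNLS.R4, QuadNLS.vA α γ ψ T hT k 0 x =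
        ((T ^ (-2 : ℤ) : ℝ) : ℂ) *
          Complex.exp (-Complex.I * ((α k / γ k * (‖x‖ ^ 2 / (4 * T)) : ℝ) : ℂ)) *
          ((ψ k (T⁻¹ • x) : ℝ) : ℂ)) ∧
      -- its charge
      (∀ t < T, QuadNLS.charge α γ (fun k => QuadNLS.vA α γ ψ T hT k t) =
        QuadNLS.charge α γ ψ) ∧
      -- the blow-up rate
      (fun t => QuadNLS.kinetic γ (fun k => QuadNLS.vA α γ ψ T hT k t))
        =Θ[𝓝[<] T] (fun t => (T - t) ^ (-2 : ℤ)) ∧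
      -- `u^A` solves the system with `βₖ = αₖ² / γₖ`, has the charge of `ψ`, and blows up at the
      -- time `T`, which is the maximal time of existence
      QuadNLS.IsH1Solution α γ (fun k => α k ^ 2 / γ k) f (Iio T) (QuadNLS.uA α γ ψ T hT) ∧
      QuadNLS.charge α γ (fun k => QuadNLS.uA α γ ψ T hT k 0) = QuadNLS.charge α γ ψ ∧
      Tendsto (fun t => QuadNLS.h1Norm (fun k => QuadNLS.uA α γ ψ T hT k t)) (𝓝[<] T) atTop ∧
      (∀ (S : ℝ) (w : Fin l → ℝ → QuadNLS.R4 → ℂ),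
        QuadNLS.IsH1Solution α γ (fun k => α k ^ 2 / γ k) f (Ico 0 S) w →
        (∀ k, w k 0 =ᵐ[volume] QuadNLS.uA α γ ψ T hT k 0) → S ≤ T)) ∧
    -- sharpness: some initial data of charge exactly `Q(ψ)` has no global solution
    (∃ u₀ : Fin l → QuadNLS.R4 → ℂ, (∀ k, QuadNLS.MemH1 (u₀ k)) ∧
      QuadNLS.charge α γ u₀ = QuadNLS.charge α γ ψ ∧
      ¬ ∃ w : Fin l → ℝ → QuadNLS.R4 → ℂ,
        QuadNLS.IsH1Solution α γ (fun k => α k ^ 2 / γ k) f (Ici 0) w ∧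
        ∀ k, w k 0 =ᵐ[volume] u₀ k) := by
  -- With ω = 1 and β = 0, the coefficients of the elliptic system are b_k = α_k²/γ_k.
  have hψ' : ψ ∈ QuadNLS.nontrivialSolutions γ (fun k => α k ^ 2 / γ k) f := by
    simpa using hψ.1
  have hβ : (fun k => (1 : ℝ) * (α k ^ 2 / γ k)) = fun k => α k ^ 2 / γ k := by
    simp only [one_mul]
  have hβ0 : (fun k => (0 : ℝ) * (α k ^ 2 / γ k)) = 0 := by
    funext k
    simp
  have key : ∀ (T : ℝ) (hT : 0 < T) (S : ℝ) (w : Fin l → ℝ → QuadNLS.R4 → ℂ),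
      QuadNLS.IsH1Solution α γ (fun k => α k ^ 2 / γ k) f (Ico 0 S) w →
      (∀ k, w k 0 =ᵐ[volume] QuadNLS.uA α γ ψ T hT k 0) → S ≤ T := fun T hT S w hw h0 => by
    rw [← hβ] at hw
    rw [QuadNLS.uA_eq_lensWave hT] at h0
    exact hw.le_of_lensWave hf hα hγ hψ' hT h0
  refine ⟨fun T hT => ⟨fun k t _ x => QuadNLS.vA_apply hT k t x, ?_, fun k x => ?_, fun t ht => ?_,
    ?_, ?_, ?_, ?_, key T hT⟩, fun k => QuadNLS.uA α γ ψ 1 one_pos k 0, fun k => ?_, ?_, ?_⟩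
  · rw [QuadNLS.vA_eq_lensWave, ← hβ0]
    exact QuadNLS.isH1Solution_lensWave hf hα hγ hψ' hT
  · simpa using QuadNLS.vA_apply (α := α) (γ := γ) (ψ := ψ) hT k 0 x
  · rw [QuadNLS.vA_eq_lensWave]
    exact QuadNLS.charge_lensWave ht
  · rw [QuadNLS.vA_eq_lensWave]
    exact QuadNLS.kinetic_lensWave_isTheta hf hα hγ hψ'
  · rw [QuadNLS.uA_eq_lensWave, ← hβ]
    exact QuadNLS.isH1Solution_lensWave hf hα hγ hψ' hT
  · rw [QuadNLS.uA_eq_lensWave]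
    exact QuadNLS.charge_lensWave hT
  · rw [QuadNLS.uA_eq_lensWave]
    exact QuadNLS.tendsto_h1Norm_lensWave hf hα hγ hψ'
  · rw [QuadNLS.uA_eq_lensWave]
    exact QuadNLS.memH1_lensWave hf hα hγ hψ' one_pos k
  · rw [QuadNLS.uA_eq_lensWave]
    exact QuadNLS.charge_lensWave one_pos
  · rintro ⟨w, hw, h0⟩
    -- A global solution with the data of u^A for T = 1 would exist on [0, 2), and then 2 ≤ 1.
    have := key 1 one_pos 2 w (hw.mono fun s hs => hs.1) h0
    norm_num at this
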